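/- All manifolds, vector fields and distributions are smooth ($C^\infty$). A $(2,3,5)$-distribution on a (Hausdorff) $5$-manifold $M$ is a rank $2$ distribution $\mathcal D\subset TM$ that is locally spanned by vector fields $\xi_1,\xi_2$ such that $\xi_1,\ \xi_2,\ [\xi_1,\xi_2],\ [\xi_1,[\xi_1,\xi_2]],\ [\xi_2,[\xi_1,\xi_2]]$ are linearly independent at each point. Let $[\mathcal D,\mathcal D]\subset TM$ be the rank $3$ distribution spanned by the sections of $\mathcal D$ and their Lie brackets. The twistor bundle of $\mathcal D$ is the $7$-manifold $$\pi:\mathbb T=\mathbb P([\mathcal D,\mathcal D])\setminus\mathbb P(\mathcal D)\to M$$ of pairs $(x,\ell)$, where $\ell\subset[\mathcal D,\mathcal D]_x$ is a line with $\ell\not\subset\mathcal D_x$. The prolongation of $\mathcal D$ is the rank $3$ distribution $$\mathcal S_{(x,\ell)}=\{\xi\in T_{(x,\ell)}\mathbb T:\ \pi_*(\xi)\in\ell\}$$ on $\mathbb T$. An infinitesimal symmetry of a distribution is a vector field $X$ such that $[X,\xi]$ is a section of the distribution for every section $\xi$ of it (over any open set). The lift of an infinitesimal symmetry $X$ of $\mathcal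 D$ is the vector field $\widetilde X$ on $\mathbb T$ whose value at $(x,\ell)$ is the velocity at $t=0$ of the curve $t\mapsto(\phi_t(x),(\phi_t)_*\ell)$, where $\phi_t$ is the local flow of $X$ around $x$. **Proposition.** Let $\mathcal D$ be a $(2,3,5)$-distribution on a $5$-manifold $M$. Then every infinitesimal symmetry of $\mathcal D$ has a unique lift to $\mathbb T$, and the infinitesimal symmetries of the prolongation $\mathcal S\subset T\mathbb T$ are precisely the lifts of the infinitesimal symmetries of $\mathcal D$. -/

import Mathlib

open scoped Manifold ContDiff

namespace TwoThreeFive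

section General

variable {E : Type*} [NormedAddCommGroup E] [NormedSpace ℝ E]
  {H : Type*} [TopologicalSpace H] (I : ModelWithCorners ℝ E H)
  {M : Type*} [TopologicalSpace M] [ChartedSpace H M] [IsManifold I ∞ M]

/-- The vector field `X` is smooth on the set `U`. -/
def SmoothFieldOn (X : ∀ x : M, TangentSpace I x) (U : Set M) : Prop :=
  ContMDiffOn I I.tangent ∞ (fun x => (⟨x, X x⟩ : TangentBundle I M)) U

/-- The vector field `X` is a smooth section over `U` of the distribution `D`. -/
def IsSectionOn (D : ∀ x : M, Submodule ℝ (TangentSpace I x)) (X : ∀ x : M, TangentSpace I x)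
    (U : Set M) : Prop :=
  SmoothFieldOn I X U ∧ ∀ x ∈ U, X x ∈ D x

/-- An infinitesimal symmetry of the distribution `D`: a smooth vector field `X` such that
`[X, ξ]` is a section of `D` for every section `ξ` of `D` (over any open set). -/
def IsInfinitesimalSymmetry (D : ∀ x : M, Submodule ℝ (TangentSpace I x))
    (X : ∀ x : M, TangentSpace I x) : Prop :=
  SmoothFieldOn I X Set.univ ∧
    ∀ (U : Set M) (ξ : ∀ x : M, TangentSpace I x), IsOpen U → IsSectionOn I D ξ U →
      IsSectionOn I D (VectorField.mlieBracket I X ξ) U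

/-- The derived distribution `[D, D]`, whose fibre at `x` is spanned by the values at `x` of
sections of `D` and of Lie brackets of two sections of `D`, the sections being defined on some
open neighbourhood of `x`. -/
noncomputable def derived (D : ∀ x : M, Submodule ℝ (TangentSpace I x)) (x : M) :
    Submodule ℝ (TangentSpace I x) :=
  Submodule.span ℝ
    {v | ∃ (U : Set M) (ξ η : ∀ y : M, TangentSpace I y), IsOpen U ∧ x ∈ U ∧
      IsSectionOn I D ξ U ∧ IsSectionOn I D η U ∧
      (v = ξ x ∨ v = VectorField.mlieBracket I ξ η x)}

/-- The five vector fields `ξ₁, ξ₂, [ξ₁, ξ₂], [ξ₁, [ξ₁, ξ₂]], [ξ₂, [ξ₁, ξ₂]]`. -/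
noncomputable def fiveFields (ξ₁ ξ₂ : ∀ x : M, TangentSpace I x) :
    Fin 5 → ∀ x : M, TangentSpace I x :=
  ![ξ₁, ξ₂, VectorField.mlieBracket I ξ₁ ξ₂,
    VectorField.mlieBracket I ξ₁ (VectorField.mlieBracket I ξ₁ ξ₂),
    VectorField.mlieBracket I ξ₂ (VectorField.mlieBracket I ξ₁ ξ₂)]

/-- Two vector fields that span `D` over the open set `U` and satisfy there the
`(2,3,5)`-condition. -/
structure IsGenericFrame (D : ∀ x : M, Submodule ℝ (TangentSpace I x))
    (ξ₁ ξ₂ : ∀ x : M, TangentSpace I x) (U : Set M) : Prop where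
  isOpen : IsOpen U
  smooth₁ : SmoothFieldOn I ξ₁ U
  smooth₂ : SmoothFieldOn I ξ₂ U
  span_eq : ∀ x ∈ U, D x = Submodule.span ℝ {ξ₁ x, ξ₂ x}
  linearIndependent : ∀ x ∈ U, LinearIndependent ℝ (fun i => fiveFields I ξ₁ ξ₂ i x)

/-! ### Smoothness of coefficients with respect to a frame -/

variable {I}

lemma SmoothFieldOn.mlieBracket [CompleteSpace E] {X Y : ∀ x : M, TangentSpace I x} {U : Set M}
    (hU : IsOpen U) (hX : SmoothFieldOn I X U) (hY : SmoothFieldOn I Y U) :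
    SmoothFieldOn I (VectorField.mlieBracket I X Y) U := by
  intro x hx
  have : IsManifold I (((⊤ : ℕ∞) : WithTop ℕ∞) + 1) M := by
    simpa using (inferInstance : IsManifold I ∞ M)
  have : IsManifold I (minSmoothness ℝ 2) M := by
    rw [minSmoothness_of_isRCLikeNormedField]; infer_instance
  exact (ContMDiffAt.mlieBracket_vectorField (m := ⊤) (n := ⊤) ((hX x hx).contMDiffAt (hU.mem_nhds hx))
    ((hY x hx).contMDiffAt (hU.mem_nhds hx)) (by simp)).contMDiffWithinAt

lemma contMDiffAt_coeff [CompleteSpace E] {ι : Type*} [Fintype ι] [FiniteDimensional ℝ E]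
    {s : ι → ∀ x : M, TangentSpace I x} {U : Set M} (hU : IsOpen U)
    (hs : ∀ i, SmoothFieldOn I (s i) U) (b : ∀ x ∈ U, Module.Basis ι ℝ (TangentSpace I x))
    (hb : ∀ x hx i, b x hx i = s i x) {X : ∀ x : M, TangentSpace I x} 
    (hX : SmoothFieldOn I X U) {c : M → ι → ℝ}
    (hc : ∀ x ∈ U, X x = ∑ i, c x i • s i x) : 
    ContMDiffOn I 𝓘(ℝ, ι → ℝ) ∞ c U := by
  intro x₀ hx₀
  apply ContMDiffAt.contMDiffWithinAt
  have hUx := hU.mem_nhds hx₀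
  let t := trivializationAt E (TangentSpace I) x₀
  have key : ∀ {Y : ∀ x : M, TangentSpace I x}, SmoothFieldOn I Y U →
      ContMDiffAt I 𝓘(ℝ, E) ∞ (fun x => (t ⟨x, Y x⟩).2) x₀ := fun hY => by
    have := (hY x₀ hx₀).contMDiffAt hUx
    exact (Bundle.contMDiffAt_section x₀).1 this
  let Φ : M → ((ι → ℝ) →L[ℝ] E) := fun x =>
    ∑ i, (ContinuousLinearMap.proj (R := ℝ) (φ := fun _ : ι => ℝ) i).smulRight (t ⟨x, s i x⟩).2
  have hΦ : ContMDiffAt I 𝓘(ℝ, (ι → ℝ) →L[ℝ] E) ∞ Φ x₀ := by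
    apply ContMDiffAt.sum
    intro i _
    have : ContMDiff 𝓘(ℝ, E) 𝓘(ℝ, (ι → ℝ) →L[ℝ] E) ∞ (fun v : E => (ContinuousLinearMap.proj (R := ℝ) (φ := fun _ : ι => ℝ) i).smulRight v) := by
      rw [contMDiff_iff_contDiff]
      exact (ContinuousLinearMap.smulRightL ℝ (ι → ℝ) E (ContinuousLinearMap.proj (R := ℝ) (φ := fun _ : ι => ℝ) i)).contDiff
    exact (this.contMDiffAt).comp x₀ (key (hs i))
  have hbase : ∀ᶠ x in nhds x₀, x ∈ t.baseSet := 
    t.open_baseSet.mem_nhds (FiberBundle.mem_baseSet_trivializationAt' x₀)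
  have hinv : ∀ x ∈ U, x ∈ t.baseSet → (Φ x).IsInvertible := by
    intro x hx hxt
    let e' : (ι → ℝ) ≃ₗ[ℝ] E := (b x hx).equivFun.symm.trans (t.continuousLinearEquivAt ℝ x hxt).toLinearEquiv
    refine ⟨e'.toContinuousLinearEquiv, ?_⟩
    ext1 w
    simp [e', Φ, Module.Basis.equivFun_symm_apply, hb]
  have hval : ∀ x ∈ U, x ∈ t.baseSet → Φ x (c x) = (t ⟨x, X x⟩).2 := by
    intro x hx hxt
    have h2 := map_sum (t.continuousLinearEquivAt ℝ x hxt) (fun i => c x i • s i x) Finset.univ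
    rw [← hc x hx] at h2
    simpa [Φ] using h2.symm
  have : ∀ᶠ x in nhds x₀, c x = (Φ x).inverse ((t ⟨x, X x⟩).2) := by
    filter_upwards [hbase, hUx] with x hx hxU
    rw [← hval x hxU hx, (hinv x hxU hx).inverse_apply_self]
  have hcd : ContMDiffAt I 𝓘(ℝ, E →L[ℝ] (ι → ℝ)) ∞ (fun x => (Φ x).inverse) x₀ := by
    obtain ⟨e, he⟩ := hinv x₀ hx₀ (FiberBundle.mem_baseSet_trivializationAt' x₀)
    have := contDiffAt_map_inverse (𝕜 := ℝ) (n := ∞) e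
    rw [he] at this
    exact this.contMDiffAt.comp x₀ hΦ
  exact (hcd.clm_apply (key hX)).congr_of_eventuallyEq this


end General


section Frames

variable {M : Type*} [TopologicalSpace M] [ChartedSpace (EuclideanSpace ℝ (Fin 5)) M]
  [IsManifold (𝓡 5) ∞ M] {D : ∀ x : M, Submodule ℝ (TangentSpace (𝓡 5) x)}
  {ξ₁ ξ₂ : ∀ x : M, TangentSpace (𝓡 5) x} {U : Set M}

namespace IsGenericFrame

/-- The basis of a tangent space given by the five fields of a generic frame. -/
noncomputable def basis (h : IsGenericFrame (𝓡 5) D ξ₁ ξ₂ U)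
    {x : M} (hx : x ∈ U) : Module.Basis (Fin 5) ℝ (TangentSpace (𝓡 5) x) :=
  haveI : FiniteDimensional ℝ (TangentSpace (𝓡 5) x) :=
    inferInstanceAs (FiniteDimensional ℝ (EuclideanSpace ℝ (Fin 5)))
  basisOfLinearIndependentOfCardEqFinrank (h.linearIndependent x hx)
    (by
      have : Module.finrank ℝ (TangentSpace (𝓡 5) x) = 5 :=
        finrank_euclideanSpace_fin (𝕜 := ℝ) (n := 5)
      simp [this])

lemma basis_apply (h : IsGenericFrame (𝓡 5) D ξ₁ ξ₂ U)
    {x : M} (hx : x ∈ U) (i : Fin 5) :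
    h.basis hx i = fiveFields (𝓡 5) ξ₁ ξ₂ i x := by
  simp [basis]

lemma smooth_fiveFields (h : IsGenericFrame (𝓡 5) D ξ₁ ξ₂ U)
    (i : Fin 5) : SmoothFieldOn (𝓡 5) (fiveFields (𝓡 5) ξ₁ ξ₂ i) U := by
  have h₃ := h.smooth₁.mlieBracket h.isOpen h.smooth₂
  fin_cases i
  · exact h.smooth₁
  · exact h.smooth₂
  · exact h₃
  · exact h.smooth₁.mlieBracket h.isOpen h₃
  · exact h.smooth₂.mlieBracket h.isOpen h₃

open Classical in
/-- The coefficients of a tangent vector with respect to the five fields. -/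
noncomputable def coeff (h : IsGenericFrame (𝓡 5) D ξ₁ ξ₂ U)
    (x : M) (v : TangentSpace (𝓡 5) x) (i : Fin 5) : ℝ :=
  if hx : x ∈ U then (h.basis hx).repr v i else 0

lemma sum_coeff (h : IsGenericFrame (𝓡 5) D ξ₁ ξ₂ U)
    {x : M} (hx : x ∈ U) (v : TangentSpace (𝓡 5) x) :
    v = ∑ i, h.coeff x v i • fiveFields (𝓡 5) ξ₁ ξ₂ i x := by
  conv_lhs => rw [← (h.basis hx).sum_repr v]
  simp [coeff, hx, basis_apply]

lemma coeff_unique (h : IsGenericFrame (𝓡 5) D ξ₁ ξ₂ U)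
    {x : M} (hx : x ∈ U) {v : TangentSpace (𝓡 5) x} {c : Fin 5 → ℝ}
    (hv : v = ∑ i, c i • fiveFields (𝓡 5) ξ₁ ξ₂ i x) : h.coeff x v = c := by
  have : v = (h.basis hx).equivFun.symm c := by
    simp [Module.Basis.equivFun_symm_apply, basis_apply, hv]
  funext i
  simp only [coeff, hx, dif_pos]
  rw [← Module.Basis.equivFun_apply, this, LinearEquiv.apply_symm_apply]

lemma contMDiffOn_coeff (h : IsGenericFrame (𝓡 5) D ξ₁ ξ₂ U)
    {X : ∀ x : M, TangentSpace (𝓡 5) x} {V : Set M} (hV : IsOpen V)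
    (hVU : V ⊆ U) (hX : SmoothFieldOn (𝓡 5) X V) (i : Fin 5) :
    ContMDiffOn (𝓡 5) 𝓘(ℝ, ℝ) ∞ (fun x => h.coeff x (X x) i) V := by
  have := contMDiffAt_coeff (I := 𝓡 5) hV (fun i => (h.smooth_fiveFields i).mono hVU)
    (fun x hx => h.basis (hVU hx)) (fun x hx i => h.basis_apply _ i) hX
    (c := fun x => h.coeff x (X x)) (fun x hx => h.sum_coeff (hVU hx) _)
  exact contMDiffOn_pi_space.1 this i

lemma mem_iff (h : IsGenericFrame (𝓡 5) D ξ₁ ξ₂ U)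
    {x : M} (hx : x ∈ U) {v : TangentSpace (𝓡 5) x} :
    v ∈ D x ↔ ∃ a b : ℝ, v = a • ξ₁ x + b • ξ₂ x := by
  rw [h.span_eq x hx, Submodule.mem_span_pair]
  simp only [eq_comm]

lemma eq_coeff (h : IsGenericFrame (𝓡 5) D ξ₁ ξ₂ U)
    {x : M} (hx : x ∈ U) {v : TangentSpace (𝓡 5) x} (hv : v ∈ D x) :
    v = h.coeff x v 0 • ξ₁ x + h.coeff x v 1 • ξ₂ x := by
  obtain ⟨a, b, hab⟩ := (h.mem_iff hx).1 hv
  have := h.coeff_unique hx (v := v) (c := ![a, b, 0, 0, 0])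
    (by simp [Fin.sum_univ_five, fiveFields, hab])
  rw [this]
  simpa using hab

/-- On the domain of a generic frame, `[D, D]` is spanned by `ξ₁`, `ξ₂` and `[ξ₁, ξ₂]`. -/
lemma mem_derived_iff (h : IsGenericFrame (𝓡 5) D ξ₁ ξ₂ U)
    {x : M} (hx : x ∈ U) {v : TangentSpace (𝓡 5) x} :
    v ∈ derived (𝓡 5) D x ↔
      ∃ a b c : ℝ, v = a • ξ₁ x + b • ξ₂ x + c • VectorField.mlieBracket (𝓡 5) ξ₁ ξ₂ x := by
  have hs : ∀ w, w ∈ Submodule.span ℝ {ξ₁ x, ξ₂ x, VectorField.mlieBracket (𝓡 5) ξ₁ ξ₂ x} ↔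
      ∃ a b c : ℝ, w = a • ξ₁ x + b • ξ₂ x + c • VectorField.mlieBracket (𝓡 5) ξ₁ ξ₂ x := by
    intro w
    rw [Submodule.mem_span_triple]
    simp only [eq_comm]
  have h₁ : IsSectionOn (𝓡 5) D ξ₁ U :=
    ⟨h.smooth₁, fun y hy => (h.mem_iff hy).2 ⟨1, 0, by simp⟩⟩
  have h₂ : IsSectionOn (𝓡 5) D ξ₂ U :=
    ⟨h.smooth₂, fun y hy => (h.mem_iff hy).2 ⟨0, 1, by simp⟩⟩
  rw [← hs]
  suffices derived (𝓡 5) D x =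
      Submodule.span ℝ {ξ₁ x, ξ₂ x, VectorField.mlieBracket (𝓡 5) ξ₁ ξ₂ x} by rw [this]
  apply le_antisymm
  · refine Submodule.span_le.2 ?_
    rintro w ⟨V, ξ, η, hV, hxV, hξ, hη, rfl | rfl⟩
    · obtain ⟨a, b, hab⟩ := (h.mem_iff hx).1 (hξ.2 x hxV)
      exact (hs _).2 ⟨a, b, 0, by simp [hab]⟩
    have hW : IsOpen (U ∩ V) := h.isOpen.inter hV
    have hxW : U ∩ V ∈ nhds x := hW.mem_nhds ⟨hx, hxV⟩
    have hd : ∀ {Z : ∀ y : M, TangentSpace (𝓡 5) y} {N : Set M}, SmoothFieldOn (𝓡 5) Z N →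
        N ∈ nhds x → MDifferentiableAt (𝓡 5) (𝓡 5).tangent
          (fun y => (⟨y, Z y⟩ : TangentBundle (𝓡 5) M)) x := fun hZ hN =>
      (hZ.contMDiffAt hN).mdifferentiableAt (by simp)
    have hc : ∀ {Z : ∀ y : M, TangentSpace (𝓡 5) y}, IsSectionOn (𝓡 5) D Z V → ∀ i,
        MDifferentiableAt (𝓡 5) 𝓘(ℝ, ℝ) (fun y => h.coeff y (Z y) i) x := fun hZ i =>
      ((h.contMDiffOn_coeff hW Set.inter_subset_left
        (hZ.1.mono Set.inter_subset_right) i).contMDiffAt hxW).mdifferentiableAt (by simp)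
    have he : ∀ {Z : ∀ y : M, TangentSpace (𝓡 5) y}, IsSectionOn (𝓡 5) D Z V →
        Z =ᶠ[nhds x] ((fun y => h.coeff y (Z y) 0) • ξ₁ + (fun y => h.coeff y (Z y) 1) • ξ₂) :=
      fun hZ => by
        filter_upwards [hxW] with y hy
        exact h.eq_coeff hy.1 (hZ.2 y hy.2)
    have hxU := h.isOpen.mem_nhds hx
    have d₁ := hd h.smooth₁ hxU
    have d₂ := hd h.smooth₂ hxU
    have m : ∀ {f : M → ℝ} {Z : ∀ y : M, TangentSpace (𝓡 5) y},
        MDifferentiableAt (𝓡 5) 𝓘(ℝ, ℝ) f x →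
        MDifferentiableAt (𝓡 5) (𝓡 5).tangent
          (fun y => (⟨y, Z y⟩ : TangentBundle (𝓡 5) M)) x →
        MDifferentiableAt (𝓡 5) (𝓡 5).tangent
          (fun y => (⟨y, (f • Z) y⟩ : TangentBundle (𝓡 5) M)) x :=
      fun hf hZ => hf.smul_section hZ
    rw [(he hξ).mlieBracket_vectorField_eq (he hη)]
    have e₁ := m (hc hξ 0) d₁
    have e₂ := m (hc hξ 1) d₂
    have e₃ := m (hc hη 0) d₁
    have e₄ := m (hc hη 1) d₂
    rw [VectorField.mlieBracket_add_left e₁ e₂,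
      VectorField.mlieBracket_add_right e₃ e₄, VectorField.mlieBracket_add_right e₃ e₄]
    simp only [VectorField.mlieBracket_smul_right (hc hη 0) d₁,
      VectorField.mlieBracket_smul_right (hc hη 1) d₂,
      VectorField.mlieBracket_smul_left (hc hξ 0) d₁,
      VectorField.mlieBracket_smul_left (hc hξ 1) d₂]
    have hS₁ : ξ₁ x ∈ Submodule.span ℝ {ξ₁ x, ξ₂ x, VectorField.mlieBracket (𝓡 5) ξ₁ ξ₂ x} :=
      Submodule.subset_span (by simp)
    have hS₂ : ξ₂ x ∈ Submodule.span ℝ {ξ₁ x, ξ₂ x, VectorField.mlieBracket (𝓡 5) ξ₁ ξ₂ x} :=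
      Submodule.subset_span (by simp)
    have hS₃ : VectorField.mlieBracket (𝓡 5) ξ₁ ξ₂ x ∈
        Submodule.span ℝ {ξ₁ x, ξ₂ x, VectorField.mlieBracket (𝓡 5) ξ₁ ξ₂ x} :=
      Submodule.subset_span (by simp)
    have hS₄ : VectorField.mlieBracket (𝓡 5) ξ₂ ξ₁ x ∈
        Submodule.span ℝ {ξ₁ x, ξ₂ x, VectorField.mlieBracket (𝓡 5) ξ₁ ξ₂ x} := by
      have := Submodule.neg_mem _ hS₃
      rwa [← VectorField.mlieBracket_swap_apply] at this
    have hS₅ : ∀ Z : ∀ y : M, TangentSpace (𝓡 5) y, VectorField.mlieBracket (𝓡 5) Z Z x ∈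
        Submodule.span ℝ {ξ₁ x, ξ₂ x, VectorField.mlieBracket (𝓡 5) ξ₁ ξ₂ x} := by
      intro Z; simp
    have hk₁ : ∀ {f : M → ℝ}, (f • ξ₁) x ∈
        Submodule.span ℝ {ξ₁ x, ξ₂ x, VectorField.mlieBracket (𝓡 5) ξ₁ ξ₂ x} :=
      fun {f} => Submodule.smul_mem _ (f x) hS₁
    have hk₂ : ∀ {f : M → ℝ}, (f • ξ₂) x ∈
        Submodule.span ℝ {ξ₁ x, ξ₂ x, VectorField.mlieBracket (𝓡 5) ξ₁ ξ₂ x} :=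
      fun {f} => Submodule.smul_mem _ (f x) hS₂
    refine Submodule.add_mem _ (Submodule.add_mem _ ?_ ?_) (Submodule.add_mem _ ?_ ?_) <;>
    · refine Submodule.add_mem _ (Submodule.smul_mem _ _ (by assumption))
        (Submodule.smul_mem _ _ (Submodule.add_mem _ (Submodule.smul_mem _ _ (by assumption))
          (Submodule.smul_mem _ _ (by first | assumption | exact hS₅ _))))
  · refine Submodule.span_le.2 ?_
    rintro w (rfl | rfl | rfl)
    · exact Submodule.subset_span ⟨U, ξ₁, ξ₁, h.isOpen, hx, h₁, h₁, .inl rfl⟩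
    · exact Submodule.subset_span ⟨U, ξ₂, ξ₂, h.isOpen, hx, h₂, h₂, .inl rfl⟩
    · exact Submodule.subset_span ⟨U, ξ₁, ξ₂, h.isOpen, hx, h₁, h₂, .inr rfl⟩

end IsGenericFrame

end Frames

/-- A `(2,3,5)`-distribution on a `5`-manifold `M`: a rank two distribution that is locally spanned
by smooth vector fields `ξ₁`, `ξ₂` such that `ξ₁, ξ₂, [ξ₁, ξ₂], [ξ₁, [ξ₁, ξ₂]], [ξ₂, [ξ₁, ξ₂]]` are
linearly independent at each point. -/
structure GenericDistribution (M : Type*) [TopologicalSpace M]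
    [ChartedSpace (EuclideanSpace ℝ (Fin 5)) M] [IsManifold (𝓡 5) ∞ M] where
  fiber : ∀ x : M, Submodule ℝ (TangentSpace (𝓡 5) x)
  exists_frame : ∀ x : M, ∃ (U : Set M) (ξ₁ ξ₂ : ∀ y : M, TangentSpace (𝓡 5) y),
    x ∈ U ∧ IsGenericFrame (𝓡 5) fiber ξ₁ ξ₂ U

section Twistor

variable {M : Type*} [TopologicalSpace M] [ChartedSpace (EuclideanSpace ℝ (Fin 5)) M]
  [IsManifold (𝓡 5) ∞ M]

/-- `ℓ` is a line in `[D, D]` at `x` that is not contained in `D`. -/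
def IsTransversalLine (D : ∀ x : M, Submodule ℝ (TangentSpace (𝓡 5) x)) (x : M)
    (ℓ : Submodule ℝ (TangentSpace (𝓡 5) x)) : Prop :=
  Module.finrank ℝ ℓ = 1 ∧ ℓ ≤ derived (𝓡 5) D x ∧ ¬ ℓ ≤ D x

/-- The twistor bundle `P([D, D]) \ P(D)`: the lines in `[D, D]` that are transversal to `D`. -/
structure Twistor (D : GenericDistribution M) where
  point : M
  line : Submodule ℝ (TangentSpace (𝓡 5) point)
  isTransversal : IsTransversalLine D.fiber point line

/-- The line spanned by `[ξ₁, ξ₂] + a ξ₁ + b ξ₂` at `x`, where `p = (a, b)`. -/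
noncomputable def affineLine (ξ₁ ξ₂ : ∀ x : M, TangentSpace (𝓡 5) x) (x : M) (p : ℝ × ℝ) :
    Submodule ℝ (TangentSpace (𝓡 5) x) :=
  Submodule.span ℝ {VectorField.mlieBracket (𝓡 5) ξ₁ ξ₂ x + p.1 • ξ₁ x + p.2 • ξ₂ x}

namespace IsGenericFrame

variable {D : ∀ x : M, Submodule ℝ (TangentSpace (𝓡 5) x)}
  {ξ₁ ξ₂ : ∀ x : M, TangentSpace (𝓡 5) x} {U : Set M}

lemma coeff_combination (h : IsGenericFrame (𝓡 5) D ξ₁ ξ₂ U)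
    {x : M} (hx : x ∈ U) (a b c : ℝ) :
    h.coeff x (a • ξ₁ x + b • ξ₂ x + c • VectorField.mlieBracket (𝓡 5) ξ₁ ξ₂ x) =
      ![a, b, c, 0, 0] :=
  h.coeff_unique hx (by simp [Fin.sum_univ_five, fiveFields])

lemma coeff_affine (h : IsGenericFrame (𝓡 5) D ξ₁ ξ₂ U)
    {x : M} (hx : x ∈ U) (p : ℝ × ℝ) :
    h.coeff x (VectorField.mlieBracket (𝓡 5) ξ₁ ξ₂ x + p.1 • ξ₁ x + p.2 • ξ₂ x) =
      ![p.1, p.2, 1, 0, 0] := by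
  rw [← h.coeff_combination hx]
  congr 1
  module

lemma isTransversalLine_affineLine (h : IsGenericFrame (𝓡 5) D ξ₁ ξ₂ U)
    {x : M} (hx : x ∈ U) (p : ℝ × ℝ) :
    IsTransversalLine D x (affineLine ξ₁ ξ₂ x p) := by
  have hmem : VectorField.mlieBracket (𝓡 5) ξ₁ ξ₂ x + p.1 • ξ₁ x + p.2 • ξ₂ x ∉ D x := by
    intro hD
    obtain ⟨a, b, hab⟩ := (h.mem_iff hx).1 hD
    have h1 := h.coeff_affine hx p
    have h2 := h.coeff_combination hx a b 0
    rw [zero_smul, add_zero, ← hab, h1] at h2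
    simpa using congrFun h2 2
  refine ⟨finrank_span_singleton fun h0 => hmem (h0 ▸ (D x).zero_mem), ?_, ?_⟩
  · rw [affineLine, Submodule.span_singleton_le_iff_mem, h.mem_derived_iff hx]
    exact ⟨p.1, p.2, 1, by module⟩
  · rw [affineLine, Submodule.span_singleton_le_iff_mem]
    exact hmem

/-- The affine coordinates of the line spanned by a vector of `[D, D]` outside `D`. -/
lemma span_eq_affineLine (h : IsGenericFrame (𝓡 5) D ξ₁ ξ₂ U)
    {x : M} (hx : x ∈ U) {v : TangentSpace (𝓡 5) x}
    (hv : v ∈ derived (𝓡 5) D x) (hvD : v ∉ D x) :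
    h.coeff x v 2 ≠ 0 ∧ Submodule.span ℝ {v} =
      affineLine ξ₁ ξ₂ x (h.coeff x v 0 / h.coeff x v 2, h.coeff x v 1 / h.coeff x v 2) := by
  obtain ⟨a, b, c, rfl⟩ := (h.mem_derived_iff hx).1 hv
  rw [h.coeff_combination hx]
  have hc : c ≠ 0 := by
    rintro rfl
    exact hvD ((h.mem_iff hx).2 ⟨a, b, by simp⟩)
  refine ⟨by simpa using hc, ?_⟩
  have := Submodule.span_singleton_smul_eq (R := ℝ) (IsUnit.mk0 c hc)
    (VectorField.mlieBracket (𝓡 5) ξ₁ ξ₂ x + (a / c) • ξ₁ x + (b / c) • ξ₂ x)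
  simp only [affineLine, Matrix.cons_val]
  rw [← this]
  congr 2
  rw [smul_add, smul_add, smul_smul, smul_smul, mul_div_cancel₀ _ hc, mul_div_cancel₀ _ hc]
  abel

lemma affineLine_injective (h : IsGenericFrame (𝓡 5) D ξ₁ ξ₂ U)
    {x : M} (hx : x ∈ U) :
    Function.Injective (affineLine ξ₁ ξ₂ x) := by
  intro p q hpq
  have : VectorField.mlieBracket (𝓡 5) ξ₁ ξ₂ x + q.1 • ξ₁ x + q.2 • ξ₂ x ∈
      affineLine ξ₁ ξ₂ x p := hpq ▸ Submodule.mem_span_singleton_self _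
  obtain ⟨r, hr⟩ := Submodule.mem_span_singleton.1 this
  have h1 := h.coeff_affine hx q
  have h2 := h.coeff_combination hx (r * p.1) (r * p.2) r
  rw [← hr, show r • (VectorField.mlieBracket (𝓡 5) ξ₁ ξ₂ x + p.1 • ξ₁ x + p.2 • ξ₂ x) =
    (r * p.1) • ξ₁ x + (r * p.2) • ξ₂ x + r • VectorField.mlieBracket (𝓡 5) ξ₁ ξ₂ x by module,
    h2] at h1
  have h3 := congrFun h1 2
  have h4 := congrFun h1 0
  have h5 := congrFun h1 1
  simp only [Matrix.cons_val] at h3 h4 h5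
  subst h3
  exact Prod.ext (by simpa using h4) (by simpa using h5)

lemma exists_affineLine (h : IsGenericFrame (𝓡 5) D ξ₁ ξ₂ U)
    {x : M} (hx : x ∈ U) {ℓ : Submodule ℝ (TangentSpace (𝓡 5) x)}
    (hℓ : IsTransversalLine D x ℓ) : ∃ p, ℓ = affineLine ξ₁ ξ₂ x p := by
  obtain ⟨h1, h2, h3⟩ := hℓ
  obtain ⟨v, hv, hvD⟩ := SetLike.not_le_iff_exists.1 h3
  have hv0 : v ≠ 0 := fun h0 => hvD (h0 ▸ (D x).zero_mem)
  have : Submodule.span ℝ {v} = ℓ := by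
    have : FiniteDimensional ℝ ℓ := Module.finite_of_finrank_eq_succ h1
    exact Submodule.eq_of_le_of_finrank_eq ((Submodule.span_singleton_le_iff_mem _ _).2 hv)
      (by rw [finrank_span_singleton hv0, h1])
  exact ⟨_, this ▸ (h.span_eq_affineLine hx (h2 hv) hvD).2⟩

end IsGenericFrame

open Classical in
/-- The affine coordinates `(a, b)` of a line spanned by `[ξ₁, ξ₂] + a ξ₁ + b ξ₂`. -/
noncomputable def slope (ξ₁ ξ₂ : ∀ x : M, TangentSpace (𝓡 5) x) (x : M)
    (ℓ : Submodule ℝ (TangentSpace (𝓡 5) x)) : ℝ × ℝ :=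
  if hℓ : ∃ p, ℓ = affineLine ξ₁ ξ₂ x p then hℓ.choose else 0

lemma affineLine_slope {ξ₁ ξ₂ : ∀ x : M, TangentSpace (𝓡 5) x} {x : M}
    {ℓ : Submodule ℝ (TangentSpace (𝓡 5) x)} (hℓ : ∃ p, ℓ = affineLine ξ₁ ξ₂ x p) :
    affineLine ξ₁ ξ₂ x (slope ξ₁ ξ₂ x ℓ) = ℓ := by
  rw [slope, dif_pos hℓ]
  exact hℓ.choose_spec.symm

namespace Twistor

variable {D : GenericDistribution M}

lemma exists_over (D : GenericDistribution M) (x : M) : ∃ z : Twistor D, z.point = x := by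
  obtain ⟨U, ξ₁, ξ₂, hx, h⟩ := D.exists_frame x
  exact ⟨⟨x, affineLine ξ₁ ξ₂ x 0, h.isTransversalLine_affineLine hx 0⟩, rfl⟩

/-- The data from which a chart of the twistor bundle is made: a chart of `M` and a generic
frame of `D`. -/
structure ChartData (D : GenericDistribution M) where
  chart : OpenPartialHomeomorph M (EuclideanSpace ℝ (Fin 5))
  chart_mem : chart ∈ atlas (EuclideanSpace ℝ (Fin 5)) M
  dom : Set M
  ξ₁ : ∀ x : M, TangentSpace (𝓡 5) x
  ξ₂ : ∀ x : M, TangentSpace (𝓡 5) x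
  frame : IsGenericFrame (𝓡 5) D.fiber ξ₁ ξ₂ dom

open Classical in
/-- The chart with coordinates `(u, a, b)`: the point with coordinates `u` in the chart of `M`,
and the line spanned by `[ξ₁, ξ₂] + a ξ₁ + b ξ₂` there. -/
noncomputable def ChartData.toPartialEquiv (c : ChartData D) :
    PartialEquiv (Twistor D) (EuclideanSpace ℝ (Fin 5) × ℝ × ℝ) where
  toFun z := (c.chart z.point, slope c.ξ₁ c.ξ₂ z.point z.line)
  invFun w :=
    if hx : c.chart.symm w.1 ∈ c.dom then
      ⟨c.chart.symm w.1, affineLine c.ξ₁ c.ξ₂ (c.chart.symm w.1) w.2,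
        c.frame.isTransversalLine_affineLine hx w.2⟩
    else (exists_over D (c.chart.symm w.1)).choose
  source := {z | z.point ∈ c.chart.source ∩ c.dom}
  target := {w | w.1 ∈ c.chart.target ∧ c.chart.symm w.1 ∈ c.dom}
  map_source' := by
    intro z hz
    exact ⟨c.chart.map_source hz.1, by simpa [c.chart.left_inv hz.1] using hz.2⟩
  map_target' := by
    intro w hw
    rw [dif_pos hw.2]
    exact ⟨c.chart.map_target hw.1, hw.2⟩
  left_inv' := by
    rintro ⟨x, ℓ, hℓ⟩ ⟨hx, hxU⟩
    have hx' : c.chart.symm (c.chart x) = x := c.chart.left_inv hx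
    have hs := affineLine_slope (c.frame.exists_affineLine hxU hℓ)
    have : ∀ y (hy : y = x) (hyU : y ∈ c.dom),
        (⟨y, affineLine c.ξ₁ c.ξ₂ y (slope c.ξ₁ c.ξ₂ x ℓ),
          c.frame.isTransversalLine_affineLine hyU _⟩ : Twistor D) = ⟨x, ℓ, hℓ⟩ := by
      rintro y rfl hyU
      congr
    have hd : c.chart.symm (c.chart x) ∈ c.dom := by rwa [hx']
    simp only [dif_pos hd]
    exact this _ hx' hd
  right_inv' := by
    rintro ⟨u, p⟩ ⟨hu, huU⟩
    simp only at hu huU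
    rw [dif_pos huU]
    refine Prod.ext (c.chart.right_inv hu) (c.frame.affineLine_injective huU ?_)
    exact affineLine_slope ⟨p, rfl⟩

lemma ChartData.symm_apply (c : ChartData D) {w : EuclideanSpace ℝ (Fin 5) × ℝ × ℝ}
    (hx : c.chart.symm w.1 ∈ c.dom) :
    c.toPartialEquiv.symm w = ⟨c.chart.symm w.1, affineLine c.ξ₁ c.ξ₂ (c.chart.symm w.1) w.2,
      c.frame.isTransversalLine_affineLine hx w.2⟩ :=
  dif_pos hx

lemma transition_source (c c' : ChartData D) :
    (c.toPartialEquiv.symm.trans c'.toPartialEquiv).source =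
      (c.chart.target ∩ c.chart.symm ⁻¹' (c.dom ∩ (c'.chart.source ∩ c'.dom))) ×ˢ Set.univ := by
  ext ⟨u, p⟩
  simp only [PartialEquiv.trans_source, PartialEquiv.symm_source, Set.mem_inter_iff,
    Set.mem_preimage, Set.mem_prod, Set.mem_univ, and_true]
  constructor
  · rintro ⟨⟨h1, h2⟩, h3⟩
    have h2' : c.chart.symm u ∈ c.dom := h2
    simp only [ChartData.toPartialEquiv, PartialEquiv.coe_symm_mk, dif_pos h2'] at h3
    exact ⟨h1, h2, h3⟩
  · rintro ⟨h1, h2, h3⟩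
    refine ⟨⟨h1, h2⟩, ?_⟩
    simp only [ChartData.toPartialEquiv, PartialEquiv.coe_symm_mk, dif_pos h2]
    exact h3

lemma isOpen_transition_source (c c' : ChartData D) :
    IsOpen (c.toPartialEquiv.symm.trans c'.toPartialEquiv).source := by
  rw [transition_source]
  exact (c.chart.isOpen_inter_preimage_symm (c.frame.isOpen.inter
    (c'.chart.open_source.inter c'.frame.isOpen))).prod isOpen_univ

/-- The changes of coordinates are smooth. -/
lemma contDiffOn_transition (c c' : ChartData D) :
    ContDiffOn ℝ ∞ (c.toPartialEquiv.symm.trans c'.toPartialEquiv)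
      (c.toPartialEquiv.symm.trans c'.toPartialEquiv).source := by
  rw [transition_source]
  set W : Set M := c.dom ∩ (c'.chart.source ∩ c'.dom) with hW
  have hWo : IsOpen W :=
    c.frame.isOpen.inter (c'.chart.open_source.inter c'.frame.isOpen)
  set O : Set (EuclideanSpace ℝ (Fin 5)) := c.chart.target ∩ c.chart.symm ⁻¹' W with hO
  have hsymm : ContMDiffOn (𝓡 5) (𝓡 5) ∞ c.chart.symm O :=
    (contMDiffOn_symm_of_mem_maximalAtlas
      (IsManifold.subset_maximalAtlas c.chart_mem)).mono Set.inter_subset_left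
  have hbase : ContDiffOn ℝ ∞ (fun w : EuclideanSpace ℝ (Fin 5) × ℝ × ℝ =>
      c'.chart (c.chart.symm w.1)) (O ×ˢ Set.univ) := by
    have h1 : ContMDiffOn (𝓡 5) (𝓡 5) ∞ (fun u => c'.chart (c.chart.symm u)) O :=
      (contMDiffOn_of_mem_maximalAtlas
        (IsManifold.subset_maximalAtlas c'.chart_mem)).comp hsymm fun u hu => hu.2.2.1
    exact (contMDiffOn_iff_contDiffOn.1 h1).comp contDiffOn_fst fun w hw => hw.1
  have hcoef : ∀ (X : ∀ x : M, TangentSpace (𝓡 5) x), SmoothFieldOn (𝓡 5) X W → ∀ i,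
      ContDiffOn ℝ ∞ (fun w : EuclideanSpace ℝ (Fin 5) × ℝ × ℝ =>
        c'.frame.coeff (c.chart.symm w.1) (X (c.chart.symm w.1)) i) (O ×ˢ Set.univ) := by
    intro X hX i
    have h1 := (c'.frame.contMDiffOn_coeff hWo (fun x hx => hx.2.2) hX i).comp hsymm
      fun u hu => hu.2
    exact (contMDiffOn_iff_contDiffOn.1 h1).comp contDiffOn_fst fun w hw => hw.1
  -- the vector spanning the line, and its coefficients in the second frame
  let v : ∀ w : EuclideanSpace ℝ (Fin 5) × ℝ × ℝ, TangentSpace (𝓡 5) (c.chart.symm w.1) :=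
    fun w => VectorField.mlieBracket (𝓡 5) c.ξ₁ c.ξ₂ (c.chart.symm w.1) +
      w.2.1 • c.ξ₁ (c.chart.symm w.1) + w.2.2 • c.ξ₂ (c.chart.symm w.1)
  have hv : ∀ i, ContDiffOn ℝ ∞ (fun w : EuclideanSpace ℝ (Fin 5) × ℝ × ℝ =>
      c'.frame.coeff (c.chart.symm w.1) (v w) i) (O ×ˢ Set.univ) := by
    intro i
    have h₀ := hcoef _ ((c.frame.smooth_fiveFields 2).mono fun x hx => hx.1) i
    have h₁ := hcoef _ ((c.frame.smooth_fiveFields 0).mono fun x hx => hx.1) i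
    have h₂ := hcoef _ ((c.frame.smooth_fiveFields 1).mono fun x hx => hx.1) i
    refine ((h₀.add ((contDiffOn_snd.fst).mul h₁)).add ((contDiffOn_snd.snd).mul h₂)).congr ?_
    intro w hw
    have hx : c.chart.symm w.1 ∈ c'.dom := hw.1.2.2.2
    simp only [IsGenericFrame.coeff, dif_pos hx, v, fiveFields, map_add, map_smul,
      Finsupp.add_apply, Finsupp.smul_apply, smul_eq_mul, Matrix.cons_val]
  have hline : ∀ w ∈ O ×ˢ (Set.univ : Set (ℝ × ℝ)), c'.frame.coeff (c.chart.symm w.1) (v w) 2 ≠ 0 ∧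
      affineLine c.ξ₁ c.ξ₂ (c.chart.symm w.1) w.2 = affineLine c'.ξ₁ c'.ξ₂ (c.chart.symm w.1)
        (c'.frame.coeff (c.chart.symm w.1) (v w) 0 / c'.frame.coeff (c.chart.symm w.1) (v w) 2,
          c'.frame.coeff (c.chart.symm w.1) (v w) 1 /
            c'.frame.coeff (c.chart.symm w.1) (v w) 2) := by
    intro w hw
    have ht := c.frame.isTransversalLine_affineLine hw.1.2.1 w.2
    refine c'.frame.span_eq_affineLine hw.1.2.2.2 ?_ ?_
    · exact ht.2.1 (Submodule.mem_span_singleton_self _)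
    · exact fun hD => ht.2.2 ((Submodule.span_singleton_le_iff_mem _ _).2 hD)
  have hne := fun w hw => (hline w hw).1
  refine (hbase.prodMk (((hv 0).div (hv 2) hne).prodMk ((hv 1).div (hv 2) hne))).congr ?_
  intro w hw
  have hd : c.chart.symm w.1 ∈ c.dom := hw.1.2.1
  rw [PartialEquiv.coe_trans, Function.comp_apply, c.symm_apply hd]
  refine Prod.ext rfl (c'.frame.affineLine_injective hw.1.2.2.2 ?_)
  exact (affineLine_slope ⟨_, (hline w hw).2⟩).trans (hline w hw).2

/-- A chart around a given point of the twistor bundle. -/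
noncomputable def chartDataAt (z : Twistor D) : ChartData D where
  chart := chartAt _ z.point
  chart_mem := chart_mem_atlas _ _
  dom := (D.exists_frame z.point).choose
  ξ₁ := (D.exists_frame z.point).choose_spec.choose
  ξ₂ := (D.exists_frame z.point).choose_spec.choose_spec.choose
  frame := (D.exists_frame z.point).choose_spec.choose_spec.choose_spec.2

/-- The atlas of the twistor bundle consisting of all the charts above. -/
noncomputable def core (D : GenericDistribution M) :
    ChartedSpaceCore (EuclideanSpace ℝ (Fin 5) × ℝ × ℝ) (Twistor D) where
  atlas := Set.range ChartData.toPartialEquiv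
  chartAt z := (chartDataAt z).toPartialEquiv
  mem_chart_source z := ⟨mem_chart_source _ z.point,
    (D.exists_frame z.point).choose_spec.choose_spec.choose_spec.1⟩
  chart_mem_atlas z := ⟨_, rfl⟩
  open_source := by
    rintro _ _ ⟨c, rfl⟩ ⟨c', rfl⟩
    exact isOpen_transition_source c c'
  continuousOn_toFun := by
    rintro _ _ ⟨c, rfl⟩ ⟨c', rfl⟩
    exact (contDiffOn_transition c c').continuousOn

noncomputable instance : TopologicalSpace (Twistor D) := (core D).toTopologicalSpace

noncomputable instance : ChartedSpace (EuclideanSpace ℝ (Fin 5) × ℝ × ℝ) (Twistor D) :=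
  (core D).toChartedSpace

/-- The twistor bundle is a smooth manifold of dimension seven. -/
instance : IsManifold 𝓘(ℝ, EuclideanSpace ℝ (Fin 5) × ℝ × ℝ) ∞ (Twistor D) := by
  apply isManifold_of_contDiffOn
  intro e e' he he'
  obtain ⟨_, ⟨⟨c, rfl⟩, rfl⟩⟩ := Set.mem_iUnion₂.1 he
  obtain ⟨_, ⟨⟨c', rfl⟩, rfl⟩⟩ := Set.mem_iUnion₂.1 he'
  simp only [modelWithCornersSelf_coe, modelWithCornersSelf_coe_symm, Set.range_id, Set.inter_univ,
    Set.preimage_id, Function.comp_id, Function.id_comp]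
  exact contDiffOn_transition c c'

end Twistor

/-- The prolongation `S` of `D`: the distribution on the twistor bundle whose fibre at `(x, ℓ)`
consists of the tangent vectors that the bundle projection maps into `ℓ`. -/
noncomputable def prolongation (D : GenericDistribution M) (z : Twistor D) :
    Submodule ℝ (TangentSpace 𝓘(ℝ, EuclideanSpace ℝ (Fin 5) × ℝ × ℝ) z) :=
  z.line.comap
    (mfderiv 𝓘(ℝ, EuclideanSpace ℝ (Fin 5) × ℝ × ℝ) (𝓡 5) Twistor.point z).toLinearMap

/-- `φ` is a local flow of the vector field `X`, defined for times in `(-ε, ε)` and initial points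
in the open set `U`. -/
structure IsLocalFlow (X : ∀ x : M, TangentSpace (𝓡 5) x) (U : Set M) (ε : ℝ)
    (φ : ℝ → M → M) : Prop where
  isOpen : IsOpen U
  pos : 0 < ε
  continuousOn : ContinuousOn (fun q : ℝ × M => φ q.1 q.2) (Set.Ioo (-ε) ε ×ˢ U)
  map_zero : ∀ x ∈ U, φ 0 x = x
  isMIntegralCurveOn : ∀ x ∈ U, IsMIntegralCurveOn (fun t => φ t x) X (Set.Ioo (-ε) ε)

/-- The vector field `Y` on the twistor bundle is the prolongation lift of the vector field `X`
on `M`: its value at a point `(x, ℓ)` is the velocity at time `0` of the curve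
`t ↦ (φ_t(x), (φ_t)_* ℓ)`, where `φ` is the local flow of `X` around `x`. -/
def IsProlongationLift (D : GenericDistribution M) (X : ∀ x : M, TangentSpace (𝓡 5) x)
    (Y : ∀ z : Twistor D, TangentSpace 𝓘(ℝ, EuclideanSpace ℝ (Fin 5) × ℝ × ℝ) z) : Prop :=
  ∀ z : Twistor D, ∃ (U : Set M) (ε : ℝ) (φ : ℝ → M → M) (γ : ℝ → Twistor D),
    z.point ∈ U ∧ IsLocalFlow X U ε φ ∧ γ 0 = z ∧
    (∀ t ∈ Set.Ioo (-ε) ε,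
      ∃ h : IsTransversalLine D.fiber (φ t z.point)
          (z.line.map (mfderiv (𝓡 5) (𝓡 5) (φ t) z.point).toLinearMap),
        γ t = ⟨φ t z.point,
          z.line.map (mfderiv (𝓡 5) (𝓡 5) (φ t) z.point).toLinearMap, h⟩) ∧
    HasMFDerivAt 𝓘(ℝ, ℝ) 𝓘(ℝ, EuclideanSpace ℝ (Fin 5) × ℝ × ℝ) γ 0
      ((1 : ℝ →L[ℝ] ℝ).smulRight (Y (γ 0)))

end Twistor

end TwoThreeFive

/-! A chart of `M` together with a generic frame `ξ₁, ξ₂` gives coordinates `(u, a, b)` on the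
twistor bundle. With `x₁, x₂, x₃` the expressions of `ξ₁, ξ₂, [ξ₁, ξ₂]`, the line at `(u, a, b)` is
spanned by `d = x₃ + a x₁ + b x₂` (`director`), and the prolongation consists of all `(v, e)` with
`v ∈ ℝ d`. Hence only first components of brackets matter. For a field `(X, q)` with `X` depending
on `u` alone, the bracket with `(d, 0)` has first component `d'(X, q) - X'(d)`. Requiring it to be a
multiple of `d` is the condition `IsLiftSlope`, and for a symmetry `X` of `D` it also determines the
velocity `q` of the coordinates of a line carried along by the flow of `X`. This double role links
the two distributions.

From `D` to the prolongation: by the Jacobi identity a symmetry `X` of `D` preserves `[D, D]`, so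
the frame coefficients of `(φ_t)_* d` solve a linear equation (`exists_variational_solution`). The
moved line therefore stays in `[D, D]`, remains transversal to `D` for small times, and its
coordinates have velocity `q` (`isProlongationLiftAt`). The lift is unique because integral curves
on a Hausdorff manifold are. If a section of the prolongation has first component `f d`, its bracket
with the lift `Y` has first component `(Y f + f k) d`, so `Y` is a symmetry.

From the prolongation to `D`: bracketing a symmetry `Y` with the vertical fields `(0, e)` shows that
the vertical derivatives of its first component `Q` are multiples of `d`, and equality of the mixed
derivatives forces them to vanish (`fderiv_fst_localField_eq_zero`). So `Y` projects to a field `X`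
on `M`. Bracketing with `(d, 0)` gives `IsLiftSlope` for `X`. Evaluated at three slopes it shows
that `X` preserves `[D, D]`, and the Jacobi identity together with the `(2,3,5)` condition improves
this to preserving `D` (`mlieBracket_mem_of_mem_derived`). The same slope condition identifies `Y`
as the lift of `X`. -/

namespace TwoThreeFive

/-! ### Vector fields in charts -/

section LocalFields

open VectorField Filter Topology

variable {F : Type*} [NormedAddCommGroup F] [NormedSpace ℝ F]
  {N : Type*} [TopologicalSpace N] [ChartedSpace F N]

/-- The expression of a vector field in a chart. -/
noncomputable def localField (e : OpenPartialHomeomorph N F)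
    (Y : ∀ z : N, TangentSpace 𝓘(ℝ, F) z) : F → F :=
  mpullback 𝓘(ℝ, F) 𝓘(ℝ, F) e.symm Y

/-- The vector field with a given expression in a chart. -/
noncomputable def pushField (e : OpenPartialHomeomorph N F) (V : F → F) :
    ∀ z : N, TangentSpace 𝓘(ℝ, F) z :=
  mpullback 𝓘(ℝ, F) 𝓘(ℝ, F) e V

/-- The tangent vector with a given expression in a chart. -/
noncomputable def tangentOf (e : OpenPartialHomeomorph N F) (w : F) :
    F →L[ℝ] TangentSpace 𝓘(ℝ, F) (e.symm w) :=
  mfderiv 𝓘(ℝ, F) 𝓘(ℝ, F) e.symm w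

variable [IsManifold 𝓘(ℝ, F) ∞ N] {e : OpenPartialHomeomorph N F}

lemma mdifferentiable_of_mem_atlas' (he : e ∈ atlas F N) :
    e.MDifferentiable 𝓘(ℝ, F) 𝓘(ℝ, F) :=
  haveI : IsManifold 𝓘(ℝ, F) 1 N := IsManifold.of_le (n := ∞) (by simp)
  mdifferentiable_of_mem_atlas he

lemma isInvertible_mfderiv_symm (he : e ∈ atlas F N) {w : F} (hw : w ∈ e.target) :
    (mfderiv 𝓘(ℝ, F) 𝓘(ℝ, F) e.symm w).IsInvertible :=
  ⟨(mdifferentiable_of_mem_atlas' he).symm.mfderiv hw, rfl⟩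

lemma isInvertible_mfderiv (he : e ∈ atlas F N) {z : N} (hz : z ∈ e.source) :
    (mfderiv 𝓘(ℝ, F) 𝓘(ℝ, F) e z).IsInvertible :=
  ⟨(mdifferentiable_of_mem_atlas' he).mfderiv hz, rfl⟩

lemma tangentOf_bijective (he : e ∈ atlas F N) {w : F} (hw : w ∈ e.target) :
    Function.Bijective (tangentOf e w) :=
  ((mdifferentiable_of_mem_atlas' he).symm.mfderiv hw).bijective

lemma tangentOf_localField (he : e ∈ atlas F N) {w : F} (hw : w ∈ e.target)
    (Y : ∀ z : N, TangentSpace 𝓘(ℝ, F) z) :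
    tangentOf e w (localField e Y w) = Y (e.symm w) := by
  obtain ⟨A, hA⟩ := isInvertible_mfderiv_symm he hw
  unfold tangentOf localField
  rw [mpullback_apply, ← hA, ContinuousLinearMap.inverse_equiv]
  exact A.apply_symm_apply _

lemma localField_eq_iff (he : e ∈ atlas F N) {w : F} (hw : w ∈ e.target)
    {Y : ∀ z : N, TangentSpace 𝓘(ℝ, F) z} {v : F} :
    localField e Y w = v ↔ tangentOf e w v = Y (e.symm w) := by
  rw [← tangentOf_localField he hw Y, (tangentOf_bijective he hw).1.eq_iff, eq_comm]

lemma contDiffAt_localField [CompleteSpace F] (he : e ∈ atlas F N) {w : F} (hw : w ∈ e.target)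
    {Y : ∀ z : N, TangentSpace 𝓘(ℝ, F) z} {U : Set N} (hY : SmoothFieldOn 𝓘(ℝ, F) Y U)
    (hU : U ∈ 𝓝 (e.symm w)) : ContDiffAt ℝ ∞ (localField e Y) w := by
  have h1 : ContMDiffAt 𝓘(ℝ, F) 𝓘(ℝ, F) ∞ e.symm w :=
    contMDiffAt_symm_of_mem_maximalAtlas (IsManifold.subset_maximalAtlas he) hw
  have h2 := ContMDiffAt.mpullback_vectorField_preimage (m := ∞) (n := ∞)
    (hY.contMDiffAt hU) h1 (isInvertible_mfderiv_symm he hw) (by simp)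
  exact contMDiffAt_vectorSpace_iff_contDiffAt.1 h2

lemma contMDiffAt_pushField [CompleteSpace F] (he : e ∈ atlas F N) {z : N} (hz : z ∈ e.source)
    {V : F → F} (hV : ContDiffAt ℝ ∞ V (e z)) :
    ContMDiffAt 𝓘(ℝ, F) 𝓘(ℝ, F).tangent ∞
      (fun z => (⟨z, pushField e V z⟩ : TangentBundle 𝓘(ℝ, F) N)) z := by
  have h1 : ContMDiffAt 𝓘(ℝ, F) 𝓘(ℝ, F) ∞ e z :=
    contMDiffAt_of_mem_maximalAtlas (IsManifold.subset_maximalAtlas he) hz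
  exact ContMDiffAt.mpullback_vectorField_preimage (m := ∞) (n := ∞)
    (contMDiffAt_vectorSpace_iff_contDiffAt.2 hV) h1 (isInvertible_mfderiv he hz) (by simp)

lemma tangentOf_eq_pushField (he : e ∈ atlas F N) {w : F} (hw : w ∈ e.target) (V : F → F) :
    tangentOf e w (V w) = pushField e V (e.symm w) := by
  obtain ⟨A, hA⟩ := isInvertible_mfderiv he (e.map_target hw)
  have h := (mdifferentiable_of_mem_atlas' he).comp_symm_deriv hw
  have hp : pushField e V (e.symm w) = A.symm (V (e (e.symm w))) := by
    change (mfderiv 𝓘(ℝ, F) 𝓘(ℝ, F) e (e.symm w)).inverse (V (e (e.symm w))) = _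
    rw [← hA, ContinuousLinearMap.inverse_equiv]
    rfl
  rw [hp]
  apply A.injective
  rw [← hA] at h
  have h' : A (tangentOf e w (V w)) = V w := DFunLike.congr_fun h (V w)
  rw [h']
  exact (congrArg V (e.right_inv hw)).symm.trans (A.apply_symm_apply _).symm

lemma localField_pushField (he : e ∈ atlas F N) {w : F} (hw : w ∈ e.target) (V : F → F) :
    localField e (pushField e V) w = V w :=
  (localField_eq_iff he hw).2 (tangentOf_eq_pushField he hw V)

lemma pushField_localField (he : e ∈ atlas F N) {z : N} (hz : z ∈ e.source)
    (Y : ∀ z : N, TangentSpace 𝓘(ℝ, F) z) : pushField e (localField e Y) z = Y z := by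
  have := tangentOf_eq_pushField he (e.map_source hz) (localField e Y)
  rw [tangentOf_localField he (e.map_source hz), e.left_inv hz] at this
  exact this.symm

/-- Near each point of the chart domain `Y` is the push-forward of its own expression, so its
smoothness can be tested on that expression. -/
lemma smoothFieldOn_of_localField [CompleteSpace F] (he : e ∈ atlas F N)
    {Y : ∀ z : N, TangentSpace 𝓘(ℝ, F) z}
    {U : Set N} (hU : U ⊆ e.source) (hY : ∀ z ∈ U, ContDiffAt ℝ ∞ (localField e Y) (e z)) :
    SmoothFieldOn 𝓘(ℝ, F) Y U := by
  intro z hz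
  refine (ContMDiffAt.congr_of_eventuallyEq (contMDiffAt_pushField he (hU hz) (hY z hz))
    ?_).contMDiffWithinAt
  filter_upwards [e.open_source.mem_nhds (hU hz)] with y hy
  rw [pushField_localField he hy]

/-- Brackets are natural under pullback along the inverse chart. This turns every later bracket
computation into an identity between Fréchet derivatives. -/
lemma localField_mlieBracket [CompleteSpace F] (he : e ∈ atlas F N) {w : F} (hw : w ∈ e.target)
    {Y Z : ∀ z : N, TangentSpace 𝓘(ℝ, F) z} {U V : Set N} (hY : SmoothFieldOn 𝓘(ℝ, F) Y U)
    (hZ : SmoothFieldOn 𝓘(ℝ, F) Z V) (hU : U ∈ 𝓝 (e.symm w)) (hV : V ∈ 𝓝 (e.symm w)) :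
    localField e (mlieBracket 𝓘(ℝ, F) Y Z) w =
      lieBracket ℝ (localField e Y) (localField e Z) w := by
  have h1 : ContMDiffAt 𝓘(ℝ, F) 𝓘(ℝ, F) ∞ e.symm w :=
    contMDiffAt_symm_of_mem_maximalAtlas (IsManifold.subset_maximalAtlas he) hw
  have h3 : minSmoothness ℝ 2 ≤ ∞ := by
    rw [minSmoothness_of_isRCLikeNormedField]; exact WithTop.coe_le_coe.2 le_top
  have : IsManifold 𝓘(ℝ, F) (minSmoothness ℝ 3) N := by
    rw [minSmoothness_of_isRCLikeNormedField]
    exact IsManifold.of_le (n := ∞) (WithTop.coe_le_coe.2 le_top)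
  unfold localField
  rw [mpullback_mlieBracket ((hY.contMDiffAt hU).mdifferentiableAt (by simp))
    ((hZ.contMDiffAt hV).mdifferentiableAt (by simp)) h1 h3]
  rw [← mlieBracketWithin_univ, mlieBracketWithin_eq_lieBracketWithin]
  exact congrFun lieBracketWithin_univ w

end LocalFields

end TwoThreeFive

/-! ### Local flows and their derivative in the initial point -/

namespace TwoThreeFive

section Flows

open Filter Topology Metric Set

variable {E : Type*} [NormedAddCommGroup E] [NormedSpace ℝ E]
  {G : Type*} [NormedAddCommGroup G] [NormedSpace ℝ G]

/-- Second order Taylor estimate, uniformly in the base point. -/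
lemma exists_norm_sub_sub_fderiv_le {f : E → G} {u₀ : E} (hf : ContDiffAt ℝ 2 f u₀) :
    ∃ K > 0, ∃ r > 0, (∀ x ∈ ball u₀ r, ‖fderiv ℝ f x‖ ≤ K) ∧
      ∀ x ∈ ball u₀ r, ∀ y ∈ ball u₀ r, ‖f y - f x - fderiv ℝ f x (y - x)‖ ≤ K * ‖y - x‖ ^ 2 := by
  have h1 : ContDiffAt ℝ 1 (fderiv ℝ f) u₀ := hf.fderiv_right (m := 1) (by norm_num)
  obtain ⟨K, t, ht, hK⟩ := h1.exists_lipschitzOnWith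
  have h2 : ∀ᶠ x in 𝓝 u₀, DifferentiableAt ℝ f x :=
    (hf.eventually (by simp)).mono fun x hx => hx.differentiableAt (by simp)
  have h3 : ∀ᶠ x in 𝓝 u₀, ‖fderiv ℝ f x‖ < ‖fderiv ℝ f u₀‖ + 1 :=
    h1.continuousAt.norm.eventually_lt continuousAt_const (lt_add_one _)
  obtain ⟨r, hr, h⟩ := Metric.eventually_nhds_iff_ball.1 ((h2.and h3).and ht)
  -- A single constant serves both as Lipschitz constant of the derivative and as bound for its
  -- norm.
  refine ⟨max K (‖fderiv ℝ f u₀‖ + 1), lt_max_of_lt_right (by positivity), r, hr,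
    fun x hx => (h x hx).1.2.le.trans (le_max_right _ _), fun x hx y hy => ?_⟩
  -- On this smaller convex set the derivative differs from its value at `x` by at most `K * ‖y -
  -- x‖`, so the mean value inequality produces the square.
  have hs : Convex ℝ (ball u₀ r ∩ closedBall x ‖y - x‖) :=
    (convex_ball _ _).inter (convex_closedBall _ _)
  have := hs.norm_image_sub_le_of_norm_hasFDerivWithin_le' (f := f) (f' := fderiv ℝ f)
    (φ := fderiv ℝ f x) (C := K * ‖y - x‖)
    (fun z hz => (h z hz.1).1.1.hasFDerivAt.hasFDerivWithinAt)
    (fun z hz => by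
      have h4 := hK.norm_sub_le (h z hz.1).2 (h x hx).2
      exact h4.trans (by gcongr; simpa [dist_eq_norm] using hz.2))
    (x := x) (y := y) ⟨hx, by simp⟩ ⟨hy, by simp [dist_eq_norm]⟩
  calc _ ≤ K * ‖y - x‖ * ‖y - x‖ := this
    _ = K * ‖y - x‖ ^ 2 := by ring
    _ ≤ _ := by gcongr; exact le_max_left _ _

/-- A flow is differentiable with respect to the initial point, the derivative being the solution
of the variational equation. -/
lemma eventually_hasFDerivAt_flow {f : E → E} {u₀ : E} (hf : ContDiffAt ℝ 2 f u₀)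
    {Φ : E → ℝ → E} {r ε L : ℝ} (hr : 0 < r) (hε : 0 < ε) (h0 : ∀ u ∈ ball u₀ r, Φ u 0 = u)
    (hΦ : ∀ u ∈ ball u₀ r, ∀ t ∈ Ioo (-ε) ε, HasDerivAt (Φ u) (f (Φ u t)) t)
    (hL : ∀ u ∈ ball u₀ r, ∀ t ∈ Ioo (-ε) ε, ‖Φ u t - Φ u₀ t‖ ≤ L * ‖u - u₀‖)
    {A : ℝ → E →L[ℝ] E} (hA0 : A 0 = ContinuousLinearMap.id ℝ E)
    (hA : ∀ᶠ t in 𝓝 0, HasDerivAt A ((fderiv ℝ f (Φ u₀ t)).comp (A t)) t) :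
    ∀ᶠ t in 𝓝 0, HasFDerivAt (fun u => Φ u t) (A t) u₀ := by
  obtain ⟨K, hK, ρ, hρ, hK1, hK2⟩ := exists_norm_sub_sub_fderiv_le hf
  have hu₀ : u₀ ∈ ball u₀ r := mem_ball_self hr
  have hc : ContinuousAt (Φ u₀) 0 := (hΦ u₀ hu₀ 0 ⟨by linarith, hε⟩).continuousAt
  have h1 : ∀ᶠ t in 𝓝 (0 : ℝ), Φ u₀ t ∈ ball u₀ (ρ / 2) :=
    hc.preimage_mem_nhds (by rw [h0 u₀ hu₀]; exact ball_mem_nhds _ (by positivity))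
  have h2 : ∀ᶠ t in 𝓝 (0 : ℝ), t ∈ Ioo (-ε) ε := Ioo_mem_nhds (by linarith) hε
  obtain ⟨δ, hδ, hall⟩ := Metric.eventually_nhds_iff_ball.1 ((h1.and h2).and hA)
  -- The bound `1 / (2 * K)` gives `K * τ ≤ 1 / 2`, which allows an absorption below; `δ / 2` keeps
  -- the closed interval inside the ball of radius `δ`.
  set τ : ℝ := min (δ / 2) (1 / (2 * K)) with hτ
  have hτ0 : 0 < τ := lt_min (by positivity) (by positivity)
  have hτK : K * τ ≤ 1 / 2 := by
    calc K * τ ≤ K * (1 / (2 * K)) := by gcongr; exact min_le_right _ _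
      _ = 1 / 2 := by field_simp
  have hIcc : ∀ s ∈ Icc (-τ) τ, s ∈ ball (0 : ℝ) δ := by
    intro s hs
    rw [mem_ball_zero_iff, Real.norm_eq_abs]
    have : τ ≤ δ / 2 := min_le_left _ _
    have := abs_le.2 hs
    linarith
  filter_upwards [Icc_mem_nhds (neg_lt_zero.2 hτ0) hτ0] with t ht
  refine HasFDerivAt.of_isLittleO ?_
  have hnear : ∀ᶠ u in 𝓝 u₀, u ∈ ball u₀ r ∧ L * ‖u - u₀‖ < ρ / 2 := by
    refine Filter.Eventually.and (ball_mem_nhds u₀ hr) ?_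
    have : ContinuousAt (fun u : E => L * ‖u - u₀‖) u₀ := by fun_prop
    exact this.eventually_lt continuousAt_const (by simpa using hρ)
  refine Asymptotics.IsBigO.trans_isLittleO (g := fun u => ‖u - u₀‖ ^ 2) ?_
    (Asymptotics.isLittleO_pow_sub_sub u₀ one_lt_two)
  refine Asymptotics.IsBigO.of_bound (L ^ 2) ?_
  filter_upwards [hnear] with u hu
  -- The error of the linear approximation satisfies `w' = f'(Φ u₀) w` up to a remainder quadratic
  -- in `u - u₀`. As `w 0 = 0`, its maximum `S` on `[-τ, τ]` is at most `K τ (S + (L ‖u - u₀‖)²)`.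
  -- Since `K τ ≤ 1 / 2`, the term in `S` is absorbed and `S` is quadratically small, without
  -- Grönwall's inequality.
  set w : ℝ → E := fun s => Φ u s - Φ u₀ s - A s (u - u₀) with hw
  have hw' : ∀ s ∈ Icc (-τ) τ, HasDerivAt w (f (Φ u s) - f (Φ u₀ s) -
      fderiv ℝ f (Φ u₀ s) (A s (u - u₀))) s := by
    intro s hs
    have hs' := hall s (hIcc s hs)
    exact ((hΦ u hu.1 s hs'.1.2).sub (hΦ u₀ hu₀ s hs'.1.2)).sub
      (hs'.2.clm_apply (hasDerivAt_const s (u - u₀)) |>.congr_deriv (by simp))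
  have hwc : ContinuousOn w (Icc (-τ) τ) := fun s hs => (hw' s hs).continuousAt.continuousWithinAt
  have h0τ : (0 : ℝ) ∈ Icc (-τ) τ := ⟨by linarith, hτ0.le⟩
  obtain ⟨s₀, hs₀, hmax⟩ := isCompact_Icc.exists_isMaxOn ⟨0, h0τ⟩ hwc.norm
  have hmax' : ∀ s ∈ Icc (-τ) τ, ‖w s‖ ≤ ‖w s₀‖ := fun s hs => hmax hs
  set S := ‖w s₀‖
  have hbound : ∀ s ∈ Icc (-τ) τ, ‖f (Φ u s) - f (Φ u₀ s) -
      fderiv ℝ f (Φ u₀ s) (A s (u - u₀))‖ ≤ K * S + K * (L * ‖u - u₀‖) ^ 2 := by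
    intro s hs
    have hs' := hall s (hIcc s hs)
    have hm0 : Φ u₀ s ∈ ball u₀ ρ := ball_subset_ball (by linarith) hs'.1.1
    have hlip := hL u hu.1 s hs'.1.2
    have hm : Φ u s ∈ ball u₀ ρ := by
      rw [mem_ball, dist_eq_norm]
      have h5 : ‖Φ u₀ s - u₀‖ < ρ / 2 := by simpa [dist_eq_norm] using hs'.1.1
      calc ‖Φ u s - u₀‖ = ‖(Φ u s - Φ u₀ s) + (Φ u₀ s - u₀)‖ := by congr 1; abel
        _ ≤ ‖Φ u s - Φ u₀ s‖ + ‖Φ u₀ s - u₀‖ := norm_add_le _ _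
        _ < ρ := by linarith [hu.2]
    have e1 := hK2 _ hm0 _ hm
    have e2 : ‖fderiv ℝ f (Φ u₀ s) (w s)‖ ≤ K * S :=
      ((fderiv ℝ f (Φ u₀ s)).le_opNorm _).trans
        (mul_le_mul (hK1 _ hm0) (hmax' s hs) (norm_nonneg _) hK.le)
    calc _ = ‖fderiv ℝ f (Φ u₀ s) (w s) +
          (f (Φ u s) - f (Φ u₀ s) - fderiv ℝ f (Φ u₀ s) (Φ u s - Φ u₀ s))‖ := by
          congr 1
          simp only [hw, map_sub]
          abel
      _ ≤ K * S + K * ‖Φ u s - Φ u₀ s‖ ^ 2 := (norm_add_le _ _).trans (add_le_add e2 e1)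
      _ ≤ _ := by gcongr
  have hw0 : w 0 = 0 := by simp [hw, h0 u hu.1, h0 u₀ hu₀, hA0]
  have hmv := (convex_Icc (-τ) τ).norm_image_sub_le_of_norm_hasDerivWithin_le
    (fun s hs => (hw' s hs).hasDerivWithinAt) hbound h0τ hs₀
  rw [hw0, sub_zero, sub_zero] at hmv
  have hs₀' : ‖s₀‖ ≤ τ := abs_le.2 hs₀
  have hS : S ≤ (K * S + K * (L * ‖u - u₀‖) ^ 2) * τ :=
    hmv.trans (by gcongr)
  have hS0 : 0 ≤ S := norm_nonneg _
  have hfin : S ≤ (L * ‖u - u₀‖) ^ 2 := by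
    have h6 : (K * S + K * (L * ‖u - u₀‖) ^ 2) * τ = (K * τ) * (S + (L * ‖u - u₀‖) ^ 2) := by ring
    have h7 : (K * τ) * (S + (L * ‖u - u₀‖) ^ 2) ≤ 1 / 2 * (S + (L * ‖u - u₀‖) ^ 2) := by gcongr
    linarith
  calc ‖Φ u t - Φ u₀ t - A t (u - u₀)‖ ≤ S := hmax' t ht
    _ ≤ (L * ‖u - u₀‖) ^ 2 := hfin
    _ = L ^ 2 * ‖‖u - u₀‖ ^ 2‖ := by rw [norm_pow, norm_norm, mul_pow]

/-- Local solvability of a linear equation along an integral curve. -/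
lemma exists_linear_along [CompleteSpace E] [CompleteSpace G] {f : E → E} {u₀ : E}
    (hf : ContDiffAt ℝ 1 f u₀)
    {g : E → G →L[ℝ] G} (hg : ContDiffAt ℝ 1 g u₀) {y : ℝ → E} (hy0 : y 0 = u₀)
    (hy : ∀ᶠ t in 𝓝 0, HasDerivAt y (f (y t)) t) (c₀ : G) :
    ∃ c : ℝ → G, c 0 = c₀ ∧ ∀ᶠ t in 𝓝 0, HasDerivAt c (g (y t) (c t)) t := by
  -- Coupling the linear equation with the equation of the curve gives an autonomous `C¹` system on
  -- `E × G`. Uniqueness for `f` then identifies the first component of its solution with `y`.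
  have hF : ContDiffAt ℝ 1 (fun q : E × G => (f q.1, g q.1 q.2)) (u₀, c₀) := by
    have h1 : ContDiffAt ℝ 1 (fun q : E × G => f q.1) (u₀, c₀) :=
      ContDiffAt.comp (u₀, c₀) hf contDiffAt_fst
    have h2 : ContDiffAt ℝ 1 (fun q : E × G => g q.1) (u₀, c₀) :=
      ContDiffAt.comp (u₀, c₀) hg contDiffAt_fst
    exact h1.prodMk (h2.clm_apply contDiffAt_snd)
  obtain ⟨α, hα0, ε, hε, hα⟩ :=
    hF.exists_forall_mem_closedBall_exists_eq_forall_mem_Ioo_hasDerivAt₀ 0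
  have hα' : ∀ᶠ t in 𝓝 0, HasDerivAt α (f (α t).1, g (α t).1 (α t).2) t :=
    eventually_of_mem (Ioo_mem_nhds (a := 0 - ε) (b := 0 + ε) (by linarith) (by linarith)) hα
  obtain ⟨K, s, hs, hK⟩ := hf.exists_lipschitzOnWith
  have hαc : ContinuousAt α 0 := hα'.self_of_nhds.continuousAt
  have heq : (fun t => (α t).1) =ᶠ[𝓝 0] y := by
    refine ODE_solution_unique_of_eventually (v := fun _ => f) (s := fun _ => s) (K := K)
      (Eventually.of_forall fun _ => hK) ?_ ?_ (by simp [hα0, hy0])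
    · refine (hα'.mono fun t ht => ht.fst).and ?_
      have : ContinuousAt (fun t => (α t).1) 0 := hαc.fst
      exact this.preimage_mem_nhds (by simpa [hα0] using hs)
    · exact hy.and (hy.self_of_nhds.continuousAt.preimage_mem_nhds (by rwa [hy0]))
  refine ⟨fun t => (α t).2, by simp [hα0], ?_⟩
  filter_upwards [hα', heq] with t ht hty
  rw [← hty]
  exact ht.snd

/-- Uniqueness for linear equations. -/
lemma linear_unique {B : ℝ → G →L[ℝ] G} (hB : ContinuousAt B 0) {c d : ℝ → G}
    (hc : ∀ᶠ t in 𝓝 0, HasDerivAt c (B t (c t)) t) (hd : ∀ᶠ t in 𝓝 0, HasDerivAt d (B t (d t)) t)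
    (h0 : c 0 = d 0) : c =ᶠ[𝓝 0] d := by
  -- The operator norm of `B t` is a Lipschitz constant on the whole space, and continuity keeps it
  -- below `‖B 0‖ + 1` near `0`.
  refine ODE_solution_unique_of_eventually (v := fun t => B t) (s := fun _ => univ)
    (K := ‖B 0‖₊ + 1) ?_ (hc.mono fun t ht => ⟨ht, mem_univ _⟩)
    (hd.mono fun t ht => ⟨ht, mem_univ _⟩) h0
  have : ∀ᶠ t in 𝓝 (0 : ℝ), ‖B t‖₊ < ‖B 0‖₊ + 1 :=
    hB.nnnorm.eventually_lt continuousAt_const (lt_add_one _)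
  filter_upwards [this] with t ht
  exact ((B t).lipschitz.weaken ht.le).lipschitzOnWith

/-- The local flow of a smooth vector field near a point, and its derivative at this point. -/
theorem exists_local_flow [CompleteSpace E] {f : E → E} {u₀ : E} (hf : ContDiffAt ℝ 2 f u₀)
    {O : Set E} (hO : O ∈ 𝓝 u₀) :
    ∃ r > 0, ∃ ε > 0, ∃ (Φ : E → ℝ → E) (A : ℝ → E →L[ℝ] E),
      (∀ u ∈ ball u₀ r, Φ u 0 = u) ∧
      (∀ u ∈ ball u₀ r, ∀ t ∈ Ioo (-ε) ε, HasDerivAt (Φ u) (f (Φ u t)) t ∧ Φ u t ∈ O) ∧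
      ContinuousOn (fun q : ℝ × E => Φ q.2 q.1) (Ioo (-ε) ε ×ˢ ball u₀ r) ∧
      A 0 = ContinuousLinearMap.id ℝ E ∧
      ∀ᶠ t in 𝓝 0, HasFDerivAt (fun u => Φ u t) (A t) u₀ ∧
        HasDerivAt A ((fderiv ℝ f (Φ u₀ t)).comp (A t)) t := by
  have hf1 : ContDiffAt ℝ 1 f u₀ := hf.of_le (by norm_num)
  obtain ⟨ε, hε, a, r, _, _, hr, hpl⟩ := IsPicardLindelof.of_contDiffAt_one hf1
  obtain ⟨Φ, hΦ, L, hL⟩ :=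
    (hpl 0).exists_forall_mem_closedBall_eq_hasDerivWithinAt_lipschitzOnWith
  simp only [zero_sub, zero_add] at hΦ hL
  have hr' : (0 : ℝ) < r := hr
  have hcont : ContinuousOn (fun q : ℝ × E => Φ q.2 q.1) (Icc (-ε) ε ×ˢ closedBall u₀ r) := by
    have := continuousOn_prod_of_continuousOn_lipschitzOnWith (fun q : E × ℝ => Φ q.1 q.2) L
      (s := closedBall u₀ r) (t := Icc (-ε) ε)
      (fun u hu => HasDerivWithinAt.continuousOn (hΦ u hu).2) hL
    exact this.comp continuous_swap.continuousOn fun q hq => ⟨hq.2, hq.1⟩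
  have hc0 : ContinuousAt (fun q : ℝ × E => Φ q.2 q.1) (0, u₀) :=
    hcont.continuousAt (prod_mem_nhds (Icc_mem_nhds (by linarith) hε)
      (closedBall_mem_nhds _ hr'))
  have hΦ0 : Φ u₀ 0 = u₀ := (hΦ u₀ (mem_closedBall_self hr'.le)).1
  have hOn : ∀ᶠ q in 𝓝 ((0 : ℝ), u₀), Φ q.2 q.1 ∈ O :=
    hc0.preimage_mem_nhds (by simpa [hΦ0] using hO)
  obtain ⟨δ, hδ, hall⟩ := Metric.eventually_nhds_iff_ball.1 hOn
  rw [← ball_prod_same] at hall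
  -- Times and initial points are restricted so that all orbits stay in `O`.
  set ε' := min ε δ
  set r' := min (r : ℝ) δ
  have hε' : 0 < ε' := lt_min hε hδ
  have hr'' : 0 < r' := lt_min hr' hδ
  have hsubε : Ioo (-ε') ε' ⊆ Ioo (-ε) ε :=
    Ioo_subset_Ioo (neg_le_neg (min_le_left _ _)) (min_le_left _ _)
  have hsubr : ball u₀ r' ⊆ closedBall u₀ r :=
    (ball_subset_ball (min_le_left _ _)).trans ball_subset_closedBall
  have hder : ∀ u ∈ ball u₀ r', ∀ t ∈ Ioo (-ε') ε', HasDerivAt (Φ u) (f (Φ u t)) t :=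
    fun u hu t ht => ((hΦ u (hsubr hu)).2 t (Ioo_subset_Icc_self (hsubε ht))).hasDerivAt
      (Icc_mem_nhds (hsubε ht).1 (hsubε ht).2)
  have hy : ∀ᶠ t in 𝓝 0, HasDerivAt (Φ u₀) (f (Φ u₀ t)) t :=
    eventually_of_mem (Ioo_mem_nhds (by linarith) hε') (hder u₀ (mem_ball_self hr''))
  -- Left composition with `f'` is a linear operator on `E →L[ℝ] E`, which makes the variational
  -- equation a linear equation along the orbit of `u₀`.
  have hg : ContDiffAt ℝ 1 (fun x => ContinuousLinearMap.compL ℝ E E E (fderiv ℝ f x)) u₀ :=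
    (ContinuousLinearMap.compL ℝ E E E).contDiff.contDiffAt.comp u₀
      (hf.fderiv_right (m := 1) (by norm_num))
  obtain ⟨A, hA0, hA⟩ := exists_linear_along hf1 hg hΦ0 hy (ContinuousLinearMap.id ℝ E)
  refine ⟨r', hr'', ε', hε', Φ, A, fun u hu => (hΦ u (hsubr hu)).1, fun u hu t ht =>
    ⟨hder u hu t ht, ?_⟩, hcont.mono (prod_mono (hsubε.trans Ioo_subset_Icc_self) hsubr), hA0,
    (eventually_hasFDerivAt_flow hf hr'' hε' (fun u hu => (hΦ u (hsubr hu)).1) hder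
      (L := L) ?_ hA0 hA).and hA⟩
  · refine hall (t, u) ⟨?_, ball_subset_ball (min_le_right _ _) hu⟩
    rw [mem_ball_zero_iff, Real.norm_eq_abs]
    exact (abs_lt.2 ht).trans_le (min_le_right _ _)
  · intro u hu t ht
    exact (hL t (Ioo_subset_Icc_self (hsubε ht))).norm_sub_le (hsubr hu)
      (mem_closedBall_self hr'.le)

end Flows

end TwoThreeFive

/-! ### Brackets with combinations of fields -/

namespace TwoThreeFive

section Brackets

open VectorField Filter Topology

variable {E : Type*} [NormedAddCommGroup E] [NormedSpace ℝ E]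
  {H : Type*} [TopologicalSpace H] {I : ModelWithCorners ℝ E H}
  {M : Type*} [TopologicalSpace M] [ChartedSpace H M] [IsManifold I ∞ M]

lemma SmoothFieldOn.mdifferentiableAt {X : ∀ x : M, TangentSpace I x} {U : Set M} {x : M}
    (hX : SmoothFieldOn I X U) (hU : U ∈ 𝓝 x) :
    MDifferentiableAt I I.tangent (fun y => (⟨y, X y⟩ : TangentBundle I M)) x :=
  (hX.contMDiffAt hU).mdifferentiableAt (by simp)

variable [CompleteSpace E]

/-- This is the Leibniz rule. The derivatives of the coefficients contribute only multiples of the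
fields themselves; their values never matter and are hidden in the existential. -/
lemma exists_mlieBracket_combination_two {W V₁ V₂ : ∀ x : M, TangentSpace I x} {f₁ f₂ : M → ℝ}
    {x : M} (hf₁ : MDifferentiableAt I 𝓘(ℝ, ℝ) f₁ x) (hf₂ : MDifferentiableAt I 𝓘(ℝ, ℝ) f₂ x)
    (hV₁ : MDifferentiableAt I I.tangent (fun y => (⟨y, V₁ y⟩ : TangentBundle I M)) x)
    (hV₂ : MDifferentiableAt I I.tangent (fun y => (⟨y, V₂ y⟩ : TangentBundle I M)) x) :
    ∃ k₁ k₂ : ℝ, mlieBracket I W (f₁ • V₁ + f₂ • V₂) x =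
      (k₁ • V₁ x + f₁ x • mlieBracket I W V₁ x) + (k₂ • V₂ x + f₂ x • mlieBracket I W V₂ x) := by
  have m₁ : MDifferentiableAt I I.tangent (fun y => (⟨y, (f₁ • V₁) y⟩ : TangentBundle I M)) x :=
    hf₁.smul_section hV₁
  have m₂ : MDifferentiableAt I I.tangent (fun y => (⟨y, (f₂ • V₂) y⟩ : TangentBundle I M)) x :=
    hf₂.smul_section hV₂
  refine ⟨mvfderiv I f₁ x (W x), mvfderiv I f₂ x (W x), ?_⟩
  rw [mlieBracket_add_right m₁ m₂, mlieBracket_smul_right hf₁ hV₁, mlieBracket_smul_right hf₂ hV₂]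

lemma exists_mlieBracket_combination_three {W V₁ V₂ V₃ : ∀ x : M, TangentSpace I x}
    {f₁ f₂ f₃ : M → ℝ} {x : M} (hf₁ : MDifferentiableAt I 𝓘(ℝ, ℝ) f₁ x)
    (hf₂ : MDifferentiableAt I 𝓘(ℝ, ℝ) f₂ x) (hf₃ : MDifferentiableAt I 𝓘(ℝ, ℝ) f₃ x)
    (hV₁ : MDifferentiableAt I I.tangent (fun y => (⟨y, V₁ y⟩ : TangentBundle I M)) x)
    (hV₂ : MDifferentiableAt I I.tangent (fun y => (⟨y, V₂ y⟩ : TangentBundle I M)) x)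
    (hV₃ : MDifferentiableAt I I.tangent (fun y => (⟨y, V₃ y⟩ : TangentBundle I M)) x) :
    ∃ k₁ k₂ k₃ : ℝ, mlieBracket I W (f₁ • V₁ + f₂ • V₂ + f₃ • V₃) x =
      (k₁ • V₁ x + f₁ x • mlieBracket I W V₁ x) + (k₂ • V₂ x + f₂ x • mlieBracket I W V₂ x) +
        (k₃ • V₃ x + f₃ x • mlieBracket I W V₃ x) := by
  have m₁ : MDifferentiableAt I I.tangent (fun y => (⟨y, (f₁ • V₁) y⟩ : TangentBundle I M)) x :=
    hf₁.smul_section hV₁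
  have m₂ : MDifferentiableAt I I.tangent (fun y => (⟨y, (f₂ • V₂) y⟩ : TangentBundle I M)) x :=
    hf₂.smul_section hV₂
  have m₃ : MDifferentiableAt I I.tangent (fun y => (⟨y, (f₃ • V₃) y⟩ : TangentBundle I M)) x :=
    hf₃.smul_section hV₃
  have m₁₂ : MDifferentiableAt I I.tangent
      (fun y => (⟨y, (f₁ • V₁ + f₂ • V₂) y⟩ : TangentBundle I M)) x := mdifferentiableAt_add_section m₁ m₂
  obtain ⟨k₁, k₂, h⟩ := exists_mlieBracket_combination_two (W := W) hf₁ hf₂ hV₁ hV₂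
  refine ⟨k₁, k₂, mvfderiv I f₃ x (W x), ?_⟩
  rw [mlieBracket_add_right m₁₂ m₃, h, mlieBracket_smul_right hf₃ hV₃]

end Brackets

/-! ### The Jacobi identity: preserving `D` versus preserving `[D, D]` -/

section Symmetries

open VectorField Filter Topology

variable {M : Type*} [TopologicalSpace M] [ChartedSpace (EuclideanSpace ℝ (Fin 5)) M]
  [IsManifold (𝓡 5) ∞ M]

namespace IsGenericFrame

variable {D : ∀ x : M, Submodule ℝ (TangentSpace (𝓡 5) x)}
  {ξ₁ ξ₂ : ∀ x : M, TangentSpace (𝓡 5) x} {U : Set M}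

lemma mem_derived_iff_coeff (h : IsGenericFrame (𝓡 5) D ξ₁ ξ₂ U) {x : M} (hx : x ∈ U)
    {v : TangentSpace (𝓡 5) x} :
    v ∈ derived (𝓡 5) D x ↔ h.coeff x v 3 = 0 ∧ h.coeff x v 4 = 0 := by
  rw [h.mem_derived_iff hx]
  constructor
  · rintro ⟨a, b, c, rfl⟩
    rw [h.coeff_combination hx]
    simp
  · rintro ⟨h3, h4⟩
    refine ⟨h.coeff x v 0, h.coeff x v 1, h.coeff x v 2, ?_⟩
    conv_lhs => rw [h.sum_coeff hx v, Fin.sum_univ_five, h3, h4]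
    simp [fiveFields]

lemma mem_iff_coeff (h : IsGenericFrame (𝓡 5) D ξ₁ ξ₂ U) {x : M} (hx : x ∈ U)
    {v : TangentSpace (𝓡 5) x} :
    v ∈ D x ↔ h.coeff x v 2 = 0 ∧ h.coeff x v 3 = 0 ∧ h.coeff x v 4 = 0 := by
  constructor
  · intro hv
    obtain ⟨a, b, rfl⟩ := (h.mem_iff hx).1 hv
    have := h.coeff_combination hx a b 0
    rw [zero_smul, add_zero] at this
    rw [this]
    simp
  · rintro ⟨h2, h3, h4⟩
    refine (h.mem_iff hx).2 ⟨h.coeff x v 0, h.coeff x v 1, ?_⟩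
    conv_lhs => rw [h.sum_coeff hx v, Fin.sum_univ_five, h2, h3, h4]
    simp [fiveFields]

lemma eq_coeff_of_mem_derived (h : IsGenericFrame (𝓡 5) D ξ₁ ξ₂ U) {x : M} (hx : x ∈ U)
    {v : TangentSpace (𝓡 5) x} (hv : v ∈ derived (𝓡 5) D x) :
    v = h.coeff x v 0 • ξ₁ x + h.coeff x v 1 • ξ₂ x +
      h.coeff x v 2 • mlieBracket (𝓡 5) ξ₁ ξ₂ x := by
  obtain ⟨a, b, c, rfl⟩ := (h.mem_derived_iff hx).1 hv
  rw [h.coeff_combination hx]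
  simp

lemma mem_derived_of_mem (h : IsGenericFrame (𝓡 5) D ξ₁ ξ₂ U) {x : M} (hx : x ∈ U)
    {v : TangentSpace (𝓡 5) x} (hv : v ∈ D x) : v ∈ derived (𝓡 5) D x :=
  (h.mem_derived_iff_coeff hx).2 ((h.mem_iff_coeff hx).1 hv).2

lemma isSectionOn₁ (h : IsGenericFrame (𝓡 5) D ξ₁ ξ₂ U) : IsSectionOn (𝓡 5) D ξ₁ U :=
  ⟨h.smooth₁, fun y hy => (h.mem_iff hy).2 ⟨1, 0, by simp⟩⟩

lemma isSectionOn₂ (h : IsGenericFrame (𝓡 5) D ξ₁ ξ₂ U) : IsSectionOn (𝓡 5) D ξ₂ U :=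
  ⟨h.smooth₂, fun y hy => (h.mem_iff hy).2 ⟨0, 1, by simp⟩⟩

/-- The Jacobi identity for `X, ξ₁, ξ₂`, if `[X, ξ₁]` and `[X, ξ₂]` are sections of `[D, D]`. -/
lemma exists_mlieBracket_mlieBracket (h : IsGenericFrame (𝓡 5) D ξ₁ ξ₂ U)
    {X : ∀ x : M, TangentSpace (𝓡 5) x} (hX : SmoothFieldOn (𝓡 5) X U)
    (h₁ : ∀ x ∈ U, mlieBracket (𝓡 5) X ξ₁ x ∈ derived (𝓡 5) D x)
    (h₂ : ∀ x ∈ U, mlieBracket (𝓡 5) X ξ₂ x ∈ derived (𝓡 5) D x) {x : M} (hx : x ∈ U) :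
    ∃ a b c : ℝ, mlieBracket (𝓡 5) X (mlieBracket (𝓡 5) ξ₁ ξ₂) x =
      a • ξ₁ x + b • ξ₂ x + c • mlieBracket (𝓡 5) ξ₁ ξ₂ x +
      h.coeff x (mlieBracket (𝓡 5) X ξ₂ x) 2 •
        mlieBracket (𝓡 5) ξ₁ (mlieBracket (𝓡 5) ξ₁ ξ₂) x -
      h.coeff x (mlieBracket (𝓡 5) X ξ₁ x) 2 •
        mlieBracket (𝓡 5) ξ₂ (mlieBracket (𝓡 5) ξ₁ ξ₂) x := by
  have hU := h.isOpen.mem_nhds hx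
  have hs : ∀ {V : ∀ x : M, TangentSpace (𝓡 5) x}, SmoothFieldOn (𝓡 5) V U →
      ContMDiffAt (𝓡 5) (𝓡 5).tangent (minSmoothness ℝ 2)
        (fun y => (⟨y, V y⟩ : TangentBundle (𝓡 5) M)) x := fun hV => by
    rw [minSmoothness_of_isRCLikeNormedField]
    exact (hV.contMDiffAt hU).of_le (WithTop.coe_le_coe.2 le_top)
  have h₃ := h.smooth₁.mlieBracket h.isOpen h.smooth₂
  have hc : ∀ {V : ∀ x : M, TangentSpace (𝓡 5) x}, SmoothFieldOn (𝓡 5) V U → ∀ i,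
      MDifferentiableAt (𝓡 5) 𝓘(ℝ, ℝ)
        (fun y => h.coeff y (mlieBracket (𝓡 5) X V y) i) x := fun hV i =>
    ((h.contMDiffOn_coeff h.isOpen le_rfl (hX.mlieBracket h.isOpen hV) i).contMDiffAt
      hU).mdifferentiableAt (by simp)
  have he : ∀ {V : ∀ x : M, TangentSpace (𝓡 5) x},
      (∀ x ∈ U, mlieBracket (𝓡 5) X V x ∈ derived (𝓡 5) D x) →
      mlieBracket (𝓡 5) X V =ᶠ[𝓝 x] (fun y => h.coeff y (mlieBracket (𝓡 5) X V y) 0) • ξ₁ +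
        (fun y => h.coeff y (mlieBracket (𝓡 5) X V y) 1) • ξ₂ +
        (fun y => h.coeff y (mlieBracket (𝓡 5) X V y) 2) • mlieBracket (𝓡 5) ξ₁ ξ₂ := fun hV => by
    filter_upwards [hU] with y hy
    exact h.eq_coeff_of_mem_derived hy (hV y hy)
  have : IsManifold (𝓡 5) (minSmoothness ℝ 3) M := by
    rw [minSmoothness_of_isRCLikeNormedField]
    exact IsManifold.of_le (n := ∞) (WithTop.coe_le_coe.2 le_top)
  obtain ⟨k₁, k₂, k₃, hk⟩ := exists_mlieBracket_combination_three (W := ξ₂)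
    (hc h.smooth₁ 0) (hc h.smooth₁ 1) (hc h.smooth₁ 2) (h.smooth₁.mdifferentiableAt hU)
    (h.smooth₂.mdifferentiableAt hU) (h₃.mdifferentiableAt hU)
  obtain ⟨l₁, l₂, l₃, hl⟩ := exists_mlieBracket_combination_three (W := ξ₁)
    (hc h.smooth₂ 0) (hc h.smooth₂ 1) (hc h.smooth₂ 2) (h.smooth₁.mdifferentiableAt hU)
    (h.smooth₂.mdifferentiableAt hU) (h₃.mdifferentiableAt hU)
  have e₁ := (he h₁).mlieBracket_vectorField_eq (EventuallyEq.refl (𝓝 x) ξ₂)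
  have e₂ := (EventuallyEq.refl (𝓝 x) ξ₁).mlieBracket_vectorField_eq (he h₂)
  -- In `[[X, ξ₁], ξ₂] + [ξ₁, [X, ξ₂]]` the only terms outside `[D, D]` come from the `[ξ₁,
  -- ξ₂]`-coefficients of `[X, ξ₁]` and `[X, ξ₂]`. Swapping the first bracket accounts for the minus
  -- sign.
  rw [leibniz_identity_mlieBracket_apply (hs hX) (hs h.smooth₁) (hs h.smooth₂), e₁, e₂,
    mlieBracket_swap_apply, hk, hl, mlieBracket_swap_apply (V := ξ₂) (W := ξ₁)]
  simp only [mlieBracket_self, Pi.zero_apply, smul_zero, add_zero]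
  refine ⟨l₁ - k₁, l₂ - k₂,
    l₃ - k₃ + h.coeff x (mlieBracket (𝓡 5) X ξ₁ x) 0 + h.coeff x (mlieBracket (𝓡 5) X ξ₂ x) 1, ?_⟩
  module

/-- The Jacobi identity is read modulo `[D, D]`, where the two triple brackets are independent: what
keeps `[X, ξ₁]` and `[X, ξ₂]` from lying in `D` is exactly what keeps `[X, [ξ₁, ξ₂]]` from lying in
`[D, D]`. Both directions of this equivalence are used below. -/
lemma coeff_mlieBracket_mlieBracket (h : IsGenericFrame (𝓡 5) D ξ₁ ξ₂ U)
    {X : ∀ x : M, TangentSpace (𝓡 5) x} (hX : SmoothFieldOn (𝓡 5) X U)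
    (h₁ : ∀ x ∈ U, mlieBracket (𝓡 5) X ξ₁ x ∈ derived (𝓡 5) D x)
    (h₂ : ∀ x ∈ U, mlieBracket (𝓡 5) X ξ₂ x ∈ derived (𝓡 5) D x) {x : M} (hx : x ∈ U) :
    h.coeff x (mlieBracket (𝓡 5) X (mlieBracket (𝓡 5) ξ₁ ξ₂) x) 3 =
        h.coeff x (mlieBracket (𝓡 5) X ξ₂ x) 2 ∧
      h.coeff x (mlieBracket (𝓡 5) X (mlieBracket (𝓡 5) ξ₁ ξ₂) x) 4 =
        -h.coeff x (mlieBracket (𝓡 5) X ξ₁ x) 2 := by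
  obtain ⟨a, b, c, habc⟩ := h.exists_mlieBracket_mlieBracket hX h₁ h₂ hx
  have := h.coeff_unique hx (v := mlieBracket (𝓡 5) X (mlieBracket (𝓡 5) ξ₁ ξ₂) x)
    (c := ![a, b, c, h.coeff x (mlieBracket (𝓡 5) X ξ₂ x) 2,
      -h.coeff x (mlieBracket (𝓡 5) X ξ₁ x) 2])
    (by rw [habc]; simp [Fin.sum_univ_five, fiveFields, sub_eq_add_neg])
  rw [this]
  simp

/-- A vector field that preserves `[D, D]` preserves `D`. -/
lemma mlieBracket_mem_of_mem_derived (h : IsGenericFrame (𝓡 5) D ξ₁ ξ₂ U)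
    {X : ∀ x : M, TangentSpace (𝓡 5) x} (hX : SmoothFieldOn (𝓡 5) X U)
    (h₁ : ∀ x ∈ U, mlieBracket (𝓡 5) X ξ₁ x ∈ derived (𝓡 5) D x)
    (h₂ : ∀ x ∈ U, mlieBracket (𝓡 5) X ξ₂ x ∈ derived (𝓡 5) D x)
    (h₃ : ∀ x ∈ U, mlieBracket (𝓡 5) X (mlieBracket (𝓡 5) ξ₁ ξ₂) x ∈ derived (𝓡 5) D x)
    {x : M} (hx : x ∈ U) :
    mlieBracket (𝓡 5) X ξ₁ x ∈ D x ∧ mlieBracket (𝓡 5) X ξ₂ x ∈ D x := by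
  have hJ := h.coeff_mlieBracket_mlieBracket hX h₁ h₂ hx
  have h3 := (h.mem_derived_iff_coeff hx).1 (h₃ x hx)
  rw [h3.1, h3.2] at hJ
  exact ⟨(h.mem_iff_coeff hx).2 ⟨neg_eq_zero.1 hJ.2.symm, (h.mem_derived_iff_coeff hx).1 (h₁ x hx)⟩,
    (h.mem_iff_coeff hx).2 ⟨hJ.1.symm, (h.mem_derived_iff_coeff hx).1 (h₂ x hx)⟩⟩

/-- A symmetry of `D` preserves `[D, D]`. -/
lemma mlieBracket_mem_derived (h : IsGenericFrame (𝓡 5) D ξ₁ ξ₂ U)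
    {X : ∀ x : M, TangentSpace (𝓡 5) x} (hX : IsInfinitesimalSymmetry (𝓡 5) D X)
    {x : M} (hx : x ∈ U) :
    mlieBracket (𝓡 5) X (mlieBracket (𝓡 5) ξ₁ ξ₂) x ∈ derived (𝓡 5) D x := by
  have h₁ := (hX.2 U ξ₁ h.isOpen h.isSectionOn₁).2
  have h₂ := (hX.2 U ξ₂ h.isOpen h.isSectionOn₂).2
  have hJ := h.coeff_mlieBracket_mlieBracket (hX.1.mono (Set.subset_univ _))
    (fun x hx => h.mem_derived_of_mem hx (h₁ x hx))
    (fun x hx => h.mem_derived_of_mem hx (h₂ x hx)) hx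
  rw [((h.mem_iff_coeff hx).1 (h₁ x hx)).1, ((h.mem_iff_coeff hx).1 (h₂ x hx)).1, neg_zero] at hJ
  exact (h.mem_derived_iff_coeff hx).2 hJ

/-- It suffices to bracket with the fields of a frame. -/
lemma mlieBracket_mem_of_isSectionOn (h : IsGenericFrame (𝓡 5) D ξ₁ ξ₂ U)
    {X : ∀ x : M, TangentSpace (𝓡 5) x} {x : M} (hx : x ∈ U)
    (h₁ : mlieBracket (𝓡 5) X ξ₁ x ∈ D x) (h₂ : mlieBracket (𝓡 5) X ξ₂ x ∈ D x)
    {V : Set M} (hV : IsOpen V) (hxV : x ∈ V) {ξ : ∀ x : M, TangentSpace (𝓡 5) x}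
    (hξ : IsSectionOn (𝓡 5) D ξ V) : mlieBracket (𝓡 5) X ξ x ∈ D x := by
  have hW : IsOpen (U ∩ V) := h.isOpen.inter hV
  have hxW : U ∩ V ∈ 𝓝 x := hW.mem_nhds ⟨hx, hxV⟩
  have hU := h.isOpen.mem_nhds hx
  have hc : ∀ i, MDifferentiableAt (𝓡 5) 𝓘(ℝ, ℝ) (fun y => h.coeff y (ξ y) i) x := fun i =>
    ((h.contMDiffOn_coeff hW Set.inter_subset_left
      (hξ.1.mono Set.inter_subset_right) i).contMDiffAt hxW).mdifferentiableAt (by simp)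
  have he : ξ =ᶠ[𝓝 x] (fun y => h.coeff y (ξ y) 0) • ξ₁ + (fun y => h.coeff y (ξ y) 1) • ξ₂ := by
    filter_upwards [hxW] with y hy
    exact h.eq_coeff hy.1 (hξ.2 y hy.2)
  obtain ⟨k₁, k₂, hk⟩ := exists_mlieBracket_combination_two (W := X) (hc 0) (hc 1)
    (h.smooth₁.mdifferentiableAt hU) (h.smooth₂.mdifferentiableAt hU)
  rw [(EventuallyEq.refl (𝓝 x) X).mlieBracket_vectorField_eq he, hk]
  exact add_mem (add_mem (Submodule.smul_mem _ _ (h.isSectionOn₁.2 x hx))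
    (Submodule.smul_mem _ _ h₁)) (add_mem (Submodule.smul_mem _ _ (h.isSectionOn₂.2 x hx))
    (Submodule.smul_mem _ _ h₂))

end IsGenericFrame

end Symmetries

end TwoThreeFive

/-! ### The twistor bundle and the prolongation in coordinates -/

namespace TwoThreeFive

namespace Twistor

open VectorField Filter Topology

variable {M : Type*} [TopologicalSpace M] [ChartedSpace (EuclideanSpace ℝ (Fin 5)) M]
  [IsManifold (𝓡 5) ∞ M] {D : GenericDistribution M}

namespace ChartData

/-- The chart of the twistor bundle, as a partial homeomorphism. -/
noncomputable def openChart (c : ChartData D) :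
    OpenPartialHomeomorph (Twistor D) (EuclideanSpace ℝ (Fin 5) × ℝ × ℝ) :=
  (core D).openPartialHomeomorph c.toPartialEquiv ⟨c, rfl⟩

lemma openChart_mem_atlas (c : ChartData D) :
    c.openChart ∈ atlas (EuclideanSpace ℝ (Fin 5) × ℝ × ℝ) (Twistor D) :=
  Set.mem_iUnion₂.2 ⟨c.toPartialEquiv, ⟨c, rfl⟩, rfl⟩

/-- The domain in `ℝ⁵` of the expression of the frame in the chart. -/
def base (c : ChartData D) : Set (EuclideanSpace ℝ (Fin 5)) :=
  c.chart.target ∩ c.chart.symm ⁻¹' c.dom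

lemma isOpen_base (c : ChartData D) : IsOpen c.base :=
  c.chart.isOpen_inter_preimage_symm c.frame.isOpen

lemma mem_openChart_target {c : ChartData D} {w : EuclideanSpace ℝ (Fin 5) × ℝ × ℝ} :
    w ∈ c.openChart.target ↔ w.1 ∈ c.base := Iff.rfl

lemma mem_openChart_source {c : ChartData D} {z : Twistor D} :
    z ∈ c.openChart.source ↔ z.point ∈ c.chart.source ∩ c.dom := Iff.rfl

lemma openChart_apply_fst (c : ChartData D) (z : Twistor D) :
    (c.openChart z).1 = c.chart z.point := rfl

lemma openChart_symm_apply (c : ChartData D) {w : EuclideanSpace ℝ (Fin 5) × ℝ × ℝ}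
    (hw : w.1 ∈ c.base) :
    c.openChart.symm w = ⟨c.chart.symm w.1, affineLine c.ξ₁ c.ξ₂ (c.chart.symm w.1) w.2,
      c.frame.isTransversalLine_affineLine hw.2 w.2⟩ :=
  c.symm_apply hw.2

lemma openChart_symm_point (c : ChartData D) {w : EuclideanSpace ℝ (Fin 5) × ℝ × ℝ}
    (hw : w.1 ∈ c.base) : (c.openChart.symm w).point = c.chart.symm w.1 := by
  rw [c.openChart_symm_apply hw]

end ChartData

lemma mdifferentiableAt_point (z : Twistor D) :
    MDifferentiableAt 𝓘(ℝ, EuclideanSpace ℝ (Fin 5) × ℝ × ℝ) (𝓡 5) Twistor.point z := by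
  set c := chartDataAt z
  have hz : z ∈ c.openChart.source := (core D).mem_chart_source z
  have h1 : MDifferentiableAt 𝓘(ℝ, EuclideanSpace ℝ (Fin 5) × ℝ × ℝ) (𝓡 5)
      (fun y => c.chart.symm (c.openChart y).1) z := by
    have a1 := (mdifferentiable_of_mem_atlas' c.openChart_mem_atlas).mdifferentiableAt hz
    have a2 : MDifferentiableAt 𝓘(ℝ, EuclideanSpace ℝ (Fin 5) × ℝ × ℝ) (𝓡 5)
        (Prod.fst : EuclideanSpace ℝ (Fin 5) × ℝ × ℝ → _) (c.openChart z) :=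
      mdifferentiableAt_iff_differentiableAt.2 differentiableAt_fst
    have a3 := (mdifferentiable_of_mem_atlas' c.chart_mem).mdifferentiableAt_symm
      (x := (c.openChart z).1) (c.chart.map_source hz.1)
    exact a3.comp z (a2.comp z a1)
  refine h1.congr_of_eventuallyEq ?_
  filter_upwards [c.openChart.open_source.mem_nhds hz] with y hy
  exact (c.chart.left_inv hy.1).symm

namespace ChartData

/-- The bundle projection in the charts. -/
lemma mfderiv_point_tangentOf (c : ChartData D) {w : EuclideanSpace ℝ (Fin 5) × ℝ × ℝ}
    (hw : w.1 ∈ c.base) (v : EuclideanSpace ℝ (Fin 5) × ℝ × ℝ) :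
    (mfderiv 𝓘(ℝ, EuclideanSpace ℝ (Fin 5) × ℝ × ℝ) (𝓡 5) Twistor.point (c.openChart.symm w)
      (tangentOf c.openChart w v) : EuclideanSpace ℝ (Fin 5)) = tangentOf c.chart w.1 v.1 := by
  have a1 := (mdifferentiable_of_mem_atlas' c.openChart_mem_atlas).mdifferentiableAt_symm
    (mem_openChart_target.2 hw)
  have h1 := mfderiv_comp w (mdifferentiableAt_point (c.openChart.symm w)) a1
  have a2 : HasMFDerivAt 𝓘(ℝ, EuclideanSpace ℝ (Fin 5) × ℝ × ℝ) (𝓡 5)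
      (Prod.fst : EuclideanSpace ℝ (Fin 5) × ℝ × ℝ → _) w
      (ContinuousLinearMap.fst ℝ (EuclideanSpace ℝ (Fin 5)) (ℝ × ℝ)) :=
    hasFDerivAt_fst.hasMFDerivAt
  have a3 := (mdifferentiable_of_mem_atlas' c.chart_mem).mdifferentiableAt_symm hw.1
  have h2 := (a3.hasMFDerivAt.comp w a2).mfderiv
  have h3 : Twistor.point ∘ c.openChart.symm =ᶠ[𝓝 w] c.chart.symm ∘ Prod.fst := by
    filter_upwards [(c.isOpen_base.preimage continuous_fst).mem_nhds hw] with y hy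
    exact c.openChart_symm_point hy
  have h4 := h3.mfderiv_eq (I := 𝓘(ℝ, EuclideanSpace ℝ (Fin 5) × ℝ × ℝ)) (I' := 𝓡 5)
  exact DFunLike.congr_fun ((h1.symm.trans h4).trans h2) v

/-- The expression of a field of the frame in the chart. -/
noncomputable abbrev x₁ (c : ChartData D) : EuclideanSpace ℝ (Fin 5) → EuclideanSpace ℝ (Fin 5) :=
  localField c.chart c.ξ₁

/-- The expression of a field of the frame in the chart. -/
noncomputable abbrev x₂ (c : ChartData D) : EuclideanSpace ℝ (Fin 5) → EuclideanSpace ℝ (Fin 5) :=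
  localField c.chart c.ξ₂

/-- The expression of the bracket of the fields of the frame in the chart. -/
noncomputable abbrev x₃ (c : ChartData D) : EuclideanSpace ℝ (Fin 5) → EuclideanSpace ℝ (Fin 5) :=
  localField c.chart (mlieBracket (𝓡 5) c.ξ₁ c.ξ₂)

/-- The vector that spans the line with given coordinates. -/
noncomputable def director (c : ChartData D) (w : EuclideanSpace ℝ (Fin 5) × ℝ × ℝ) :
    EuclideanSpace ℝ (Fin 5) :=
  c.x₃ w.1 + w.2.1 • c.x₁ w.1 + w.2.2 • c.x₂ w.1

lemma dom_mem_nhds (c : ChartData D) {u : EuclideanSpace ℝ (Fin 5)} (hu : u ∈ c.base) :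
    c.dom ∈ 𝓝 (c.chart.symm u) := c.frame.isOpen.mem_nhds hu.2

lemma smooth_bracket (c : ChartData D) :
    SmoothFieldOn (𝓡 5) (mlieBracket (𝓡 5) c.ξ₁ c.ξ₂) c.dom :=
  c.frame.smooth₁.mlieBracket c.frame.isOpen c.frame.smooth₂

lemma contDiffAt_x₁ (c : ChartData D) {u : EuclideanSpace ℝ (Fin 5)} (hu : u ∈ c.base) :
    ContDiffAt ℝ ∞ c.x₁ u :=
  contDiffAt_localField c.chart_mem hu.1 c.frame.smooth₁ (c.dom_mem_nhds hu)

lemma contDiffAt_x₂ (c : ChartData D) {u : EuclideanSpace ℝ (Fin 5)} (hu : u ∈ c.base) :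
    ContDiffAt ℝ ∞ c.x₂ u :=
  contDiffAt_localField c.chart_mem hu.1 c.frame.smooth₂ (c.dom_mem_nhds hu)

lemma contDiffAt_x₃ (c : ChartData D) {u : EuclideanSpace ℝ (Fin 5)} (hu : u ∈ c.base) :
    ContDiffAt ℝ ∞ c.x₃ u :=
  contDiffAt_localField c.chart_mem hu.1 c.smooth_bracket (c.dom_mem_nhds hu)

lemma contDiffAt_director (c : ChartData D) {w : EuclideanSpace ℝ (Fin 5) × ℝ × ℝ}
    (hw : w.1 ∈ c.base) : ContDiffAt ℝ ∞ c.director w := by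
  have h : ∀ {f : EuclideanSpace ℝ (Fin 5) → EuclideanSpace ℝ (Fin 5)}, ContDiffAt ℝ ∞ f w.1 →
      ContDiffAt ℝ ∞ (fun w : EuclideanSpace ℝ (Fin 5) × ℝ × ℝ => f w.1) w :=
    fun hf => ContDiffAt.comp w hf contDiffAt_fst
  exact ((h (c.contDiffAt_x₃ hw)).add ((contDiffAt_snd.fst).smul (h (c.contDiffAt_x₁ hw)))).add
    ((contDiffAt_snd.snd).smul (h (c.contDiffAt_x₂ hw)))

lemma tangentOf_combination (c : ChartData D) {u : EuclideanSpace ℝ (Fin 5)} (hu : u ∈ c.base)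
    (a b k : ℝ) : tangentOf c.chart u (a • c.x₁ u + b • c.x₂ u + k • c.x₃ u) =
      a • c.ξ₁ (c.chart.symm u) + b • c.ξ₂ (c.chart.symm u) +
        k • mlieBracket (𝓡 5) c.ξ₁ c.ξ₂ (c.chart.symm u) := by
  rw [map_add, map_add, map_smul, map_smul, map_smul, tangentOf_localField c.chart_mem hu.1,
    tangentOf_localField c.chart_mem hu.1, tangentOf_localField c.chart_mem hu.1]

lemma tangentOf_director (c : ChartData D) {w : EuclideanSpace ℝ (Fin 5) × ℝ × ℝ}
    (hw : w.1 ∈ c.base) : tangentOf c.chart w.1 (c.director w) =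
      mlieBracket (𝓡 5) c.ξ₁ c.ξ₂ (c.chart.symm w.1) + w.2.1 • c.ξ₁ (c.chart.symm w.1) +
        w.2.2 • c.ξ₂ (c.chart.symm w.1) := by
  rw [director, map_add, map_add, map_smul, map_smul, tangentOf_localField c.chart_mem hw.1,
    tangentOf_localField c.chart_mem hw.1, tangentOf_localField c.chart_mem hw.1]

/-- Linear independence of the frame carries over to its coordinate expressions through `tangentOf`;
this is the tool for all comparisons of coefficients below. -/
lemma combination_eq_zero (c : ChartData D) {u : EuclideanSpace ℝ (Fin 5)} (hu : u ∈ c.base)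
    {a b k : ℝ} (h : a • c.x₁ u + b • c.x₂ u + k • c.x₃ u = 0) : a = 0 ∧ b = 0 ∧ k = 0 := by
  have h1 := c.tangentOf_combination hu a b k
  have h2 := c.frame.coeff_combination hu.2 a b k
  rw [← h1, h, map_zero, ← map_zero (tangentOf c.chart u)] at h2
  have h3 := c.frame.coeff_combination hu.2 0 0 0
  rw [← c.tangentOf_combination hu 0 0 0, zero_smul, zero_smul, zero_smul, add_zero, add_zero,
    h2] at h3
  exact ⟨by simpa using congrFun h3 0, by simpa using congrFun h3 1, by simpa using congrFun h3 2⟩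

lemma director_ne_zero (c : ChartData D) {w : EuclideanSpace ℝ (Fin 5) × ℝ × ℝ}
    (hw : w.1 ∈ c.base) : c.director w ≠ 0 := by
  intro h
  have := c.combination_eq_zero (a := w.2.1) (b := w.2.2) (k := 1) hw
    (by rw [← h, director]; module)
  exact one_ne_zero this.2.2

lemma tangentOf_mem_affineLine_iff (c : ChartData D) {w : EuclideanSpace ℝ (Fin 5) × ℝ × ℝ}
    (hw : w.1 ∈ c.base) {v : EuclideanSpace ℝ (Fin 5)} :
    tangentOf c.chart w.1 v ∈ affineLine c.ξ₁ c.ξ₂ (c.chart.symm w.1) w.2 ↔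
      ∃ k : ℝ, v = k • c.director w := by
  rw [affineLine, ← c.tangentOf_director hw, Submodule.mem_span_singleton]
  refine exists_congr fun k => ?_
  rw [← map_smul, (tangentOf_bijective c.chart_mem hw.1).1.eq_iff, eq_comm]

/-- In coordinates the bundle projection is the first projection and the line is spanned by
`director`, so the second component of `v` is unconstrained. -/
lemma tangentOf_mem_prolongation_iff (c : ChartData D) {w : EuclideanSpace ℝ (Fin 5) × ℝ × ℝ}
    (hw : w.1 ∈ c.base) {v : EuclideanSpace ℝ (Fin 5) × ℝ × ℝ} :
    tangentOf c.openChart w v ∈ prolongation D (c.openChart.symm w) ↔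
      ∃ k : ℝ, v.1 = k • c.director w := by
  rw [← c.tangentOf_mem_affineLine_iff hw, prolongation, Submodule.mem_comap]
  -- The two lines live in tangent spaces at points that are only propositionally equal. Vectors are
  -- compared in the model space, to which both tangent spaces reduce.
  have key : ∀ (z z' : Twistor D) (hz : z = z') (a : TangentSpace (𝓡 5) z.point)
      (b : TangentSpace (𝓡 5) z'.point), (a : EuclideanSpace ℝ (Fin 5)) = b →
      (a ∈ z.line ↔ b ∈ z'.line) := by
    rintro z _ rfl a _ rfl
    rfl
  exact key _ _ (c.openChart_symm_apply hw) _ _ (c.mfderiv_point_tangentOf hw v)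

end ChartData

end Twistor

end TwoThreeFive

/-! ### The slope condition and the motion of lines under a symmetry flow -/

namespace TwoThreeFive

namespace Twistor

open VectorField Filter Topology

variable {M : Type*} [TopologicalSpace M] [ChartedSpace (EuclideanSpace ℝ (Fin 5)) M]
  [IsManifold (𝓡 5) ∞ M] {D : GenericDistribution M}

namespace ChartData

/-- The velocities `q` of the coordinates of a line that is moved along `X` within `[D, D]`. -/
def IsLiftSlope (c : ChartData D) (X : ∀ x : M, TangentSpace (𝓡 5) x)
    (w : EuclideanSpace ℝ (Fin 5) × ℝ × ℝ) (q : ℝ × ℝ) : Prop :=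
  ∃ k : ℝ, lieBracket ℝ (localField c.chart X) c.x₃ w.1 +
    w.2.1 • lieBracket ℝ (localField c.chart X) c.x₁ w.1 +
    w.2.2 • lieBracket ℝ (localField c.chart X) c.x₂ w.1 +
    q.1 • c.x₁ w.1 + q.2 • c.x₂ w.1 = k • c.director w

lemma contDiffAt_coeff (c : ChartData D) {V : ∀ x : M, TangentSpace (𝓡 5) x}
    (hV : SmoothFieldOn (𝓡 5) V c.dom) (i : Fin 5) {u : EuclideanSpace ℝ (Fin 5)}
    (hu : u ∈ c.base) :
    ContDiffAt ℝ ∞ (fun u => c.frame.coeff (c.chart.symm u) (V (c.chart.symm u)) i) u := by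
  have h1 := (c.frame.contMDiffOn_coeff c.frame.isOpen le_rfl hV i).contMDiffAt
    (c.dom_mem_nhds hu)
  have h2 : ContMDiffAt (𝓡 5) (𝓡 5) ∞ c.chart.symm u :=
    contMDiffAt_symm_of_mem_maximalAtlas (IsManifold.subset_maximalAtlas c.chart_mem) hu.1
  exact contMDiffAt_iff_contDiffAt.1 (h1.comp u h2)

lemma localField_eq_combination (c : ChartData D) {V : ∀ x : M, TangentSpace (𝓡 5) x}
    {u : EuclideanSpace ℝ (Fin 5)} (hu : u ∈ c.base)
    (hV : V (c.chart.symm u) ∈ derived (𝓡 5) D.fiber (c.chart.symm u)) :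
    localField c.chart V u = c.frame.coeff (c.chart.symm u) (V (c.chart.symm u)) 0 • c.x₁ u +
      c.frame.coeff (c.chart.symm u) (V (c.chart.symm u)) 1 • c.x₂ u +
      c.frame.coeff (c.chart.symm u) (V (c.chart.symm u)) 2 • c.x₃ u := by
  refine (localField_eq_iff c.chart_mem hu.1).2 ?_
  rw [c.tangentOf_combination hu]
  exact (c.frame.eq_coeff_of_mem_derived hu.2 hV).symm

lemma lieBracket_eq (c : ChartData D) {X V : ∀ x : M, TangentSpace (𝓡 5) x}
    (hX : SmoothFieldOn (𝓡 5) X Set.univ) (hV : SmoothFieldOn (𝓡 5) V c.dom)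
    {u : EuclideanSpace ℝ (Fin 5)} (hu : u ∈ c.base) :
    lieBracket ℝ (localField c.chart X) (localField c.chart V) u =
      localField c.chart (mlieBracket (𝓡 5) X V) u :=
  (localField_mlieBracket c.chart_mem hu.1 hX hV univ_mem (c.dom_mem_nhds hu)).symm

/-- The brackets of a symmetry with the fields of the frame, in coordinates. -/
lemma exists_coefficients (c : ChartData D) {X : ∀ x : M, TangentSpace (𝓡 5) x}
    (hX : IsInfinitesimalSymmetry (𝓡 5) D.fiber X) :
    ∃ a₁ a₂ b₁ b₂ k₁ k₂ k₃ : EuclideanSpace ℝ (Fin 5) → ℝ, ∀ u ∈ c.base,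
      (ContDiffAt ℝ ∞ a₁ u ∧ ContDiffAt ℝ ∞ a₂ u ∧ ContDiffAt ℝ ∞ b₁ u ∧ ContDiffAt ℝ ∞ b₂ u ∧
        ContDiffAt ℝ ∞ k₁ u ∧ ContDiffAt ℝ ∞ k₂ u ∧ ContDiffAt ℝ ∞ k₃ u) ∧
      lieBracket ℝ (localField c.chart X) c.x₁ u = a₁ u • c.x₁ u + a₂ u • c.x₂ u ∧
      lieBracket ℝ (localField c.chart X) c.x₂ u = b₁ u • c.x₁ u + b₂ u • c.x₂ u ∧
      lieBracket ℝ (localField c.chart X) c.x₃ u =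
        k₁ u • c.x₁ u + k₂ u • c.x₂ u + k₃ u • c.x₃ u := by
  have hX' : SmoothFieldOn (𝓡 5) X c.dom := hX.1.mono (Set.subset_univ _)
  have s : ∀ {V : ∀ x : M, TangentSpace (𝓡 5) x}, SmoothFieldOn (𝓡 5) V c.dom →
      SmoothFieldOn (𝓡 5) (mlieBracket (𝓡 5) X V) c.dom :=
    fun hV => hX'.mlieBracket c.frame.isOpen hV
  have h₁ := (hX.2 c.dom c.ξ₁ c.frame.isOpen c.frame.isSectionOn₁).2
  have h₂ := (hX.2 c.dom c.ξ₂ c.frame.isOpen c.frame.isSectionOn₂).2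
  let f (V : ∀ x : M, TangentSpace (𝓡 5) x) (i : Fin 5) (u : EuclideanSpace ℝ (Fin 5)) : ℝ :=
    c.frame.coeff (c.chart.symm u) (mlieBracket (𝓡 5) X V (c.chart.symm u)) i
  refine ⟨f c.ξ₁ 0, f c.ξ₁ 1, f c.ξ₂ 0, f c.ξ₂ 1, f (mlieBracket (𝓡 5) c.ξ₁ c.ξ₂) 0,
    f (mlieBracket (𝓡 5) c.ξ₁ c.ξ₂) 1, f (mlieBracket (𝓡 5) c.ξ₁ c.ξ₂) 2, fun u hu =>
    ⟨⟨c.contDiffAt_coeff (s c.frame.smooth₁) 0 hu, c.contDiffAt_coeff (s c.frame.smooth₁) 1 hu,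
      c.contDiffAt_coeff (s c.frame.smooth₂) 0 hu, c.contDiffAt_coeff (s c.frame.smooth₂) 1 hu,
      c.contDiffAt_coeff (s c.smooth_bracket) 0 hu, c.contDiffAt_coeff (s c.smooth_bracket) 1 hu,
      c.contDiffAt_coeff (s c.smooth_bracket) 2 hu⟩, ?_, ?_, ?_⟩⟩
  · rw [c.lieBracket_eq hX.1 c.frame.smooth₁ hu, c.localField_eq_combination hu
      (c.frame.mem_derived_of_mem hu.2 (h₁ _ hu.2)),
      ((c.frame.mem_iff_coeff hu.2).1 (h₁ _ hu.2)).1, zero_smul, add_zero]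
  · rw [c.lieBracket_eq hX.1 c.frame.smooth₂ hu, c.localField_eq_combination hu
      (c.frame.mem_derived_of_mem hu.2 (h₂ _ hu.2)),
      ((c.frame.mem_iff_coeff hu.2).1 (h₂ _ hu.2)).1, zero_smul, add_zero]
  · rw [c.lieBracket_eq hX.1 c.smooth_bracket hu, c.localField_eq_combination hu
      (c.frame.mlieBracket_mem_derived hX hu.2)]

/-- The coefficient of `x₃` forces the multiple of `director` to be `k₃`; those of `x₁` and `x₂`
then determine `q`. -/
lemma isLiftSlope_iff (c : ChartData D) {X : ∀ x : M, TangentSpace (𝓡 5) x}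
    {w : EuclideanSpace ℝ (Fin 5) × ℝ × ℝ} (hw : w.1 ∈ c.base) {q : ℝ × ℝ}
    {a₁ a₂ b₁ b₂ k₁ k₂ k₃ : ℝ}
    (h₁ : lieBracket ℝ (localField c.chart X) c.x₁ w.1 = a₁ • c.x₁ w.1 + a₂ • c.x₂ w.1)
    (h₂ : lieBracket ℝ (localField c.chart X) c.x₂ w.1 = b₁ • c.x₁ w.1 + b₂ • c.x₂ w.1)
    (h₃ : lieBracket ℝ (localField c.chart X) c.x₃ w.1 =
      k₁ • c.x₁ w.1 + k₂ • c.x₂ w.1 + k₃ • c.x₃ w.1) :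
    c.IsLiftSlope X w q ↔ q = (k₃ * w.2.1 - (w.2.1 * a₁ + w.2.2 * b₁ + k₁),
      k₃ * w.2.2 - (w.2.1 * a₂ + w.2.2 * b₂ + k₂)) := by
  unfold IsLiftSlope
  rw [h₁, h₂, h₃]
  constructor
  · rintro ⟨k, hk⟩
    rw [director, ← sub_eq_zero] at hk
    obtain ⟨e₁, e₂, e₃⟩ := c.combination_eq_zero hw
      (a := k₁ + w.2.1 * a₁ + w.2.2 * b₁ + q.1 - k * w.2.1)
      (b := k₂ + w.2.1 * a₂ + w.2.2 * b₂ + q.2 - k * w.2.2) (k := k₃ - k) (by rw [← hk]; module)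
    rw [sub_eq_zero] at e₃
    subst e₃
    exact Prod.ext (by dsimp only; linarith) (by dsimp only; linarith)
  · rintro rfl
    refine ⟨k₃, ?_⟩
    rw [director]
    module

/-- The slope found by comparing coefficients is affine in the fibre coordinates, with coefficients
smooth in `u`. -/
lemma exists_contDiffAt_isLiftSlope (c : ChartData D) {X : ∀ x : M, TangentSpace (𝓡 5) x}
    (hX : IsInfinitesimalSymmetry (𝓡 5) D.fiber X) :
    ∃ q : EuclideanSpace ℝ (Fin 5) × ℝ × ℝ → ℝ × ℝ, ∀ w : EuclideanSpace ℝ (Fin 5) × ℝ × ℝ,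
      w.1 ∈ c.base → ContDiffAt ℝ ∞ q w ∧ c.IsLiftSlope X w (q w) := by
  obtain ⟨a₁, a₂, b₁, b₂, k₁, k₂, k₃, h⟩ := c.exists_coefficients hX
  refine ⟨fun w => (k₃ w.1 * w.2.1 - (w.2.1 * a₁ w.1 + w.2.2 * b₁ w.1 + k₁ w.1),
      k₃ w.1 * w.2.2 - (w.2.1 * a₂ w.1 + w.2.2 * b₂ w.1 + k₂ w.1)), fun w hw => ⟨?_, ?_⟩⟩
  · obtain ⟨⟨s₁, s₂, s₃, s₄, s₅, s₆, s₇⟩, -⟩ := h w.1 hw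
    have l : ∀ {f : EuclideanSpace ℝ (Fin 5) → ℝ}, ContDiffAt ℝ ∞ f w.1 →
        ContDiffAt ℝ ∞ (fun w : EuclideanSpace ℝ (Fin 5) × ℝ × ℝ => f w.1) w :=
      fun hf => ContDiffAt.comp w hf contDiffAt_fst
    have p₁ : ContDiffAt ℝ ∞ (fun w : EuclideanSpace ℝ (Fin 5) × ℝ × ℝ => w.2.1) w :=
      contDiffAt_snd.fst
    have p₂ : ContDiffAt ℝ ∞ (fun w : EuclideanSpace ℝ (Fin 5) × ℝ × ℝ => w.2.2) w :=
      contDiffAt_snd.snd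
    exact (((l s₇).mul p₁).sub (((p₁.mul (l s₁)).add (p₂.mul (l s₃))).add (l s₅))).prodMk
      (((l s₇).mul p₂).sub (((p₁.mul (l s₂)).add (p₂.mul (l s₄))).add (l s₆)))
  · obtain ⟨-, h₁, h₂, h₃⟩ := h w.1 hw
    exact (c.isLiftSlope_iff hw h₁ h₂ h₃).2 rfl

/-- The derivative of a symmetry flow maps a line to a line of `[D, D]`: the coefficients of the
image of a vector of `[D, D]` satisfy a linear equation. -/
lemma exists_variational_solution (c : ChartData D) {X : ∀ x : M, TangentSpace (𝓡 5) x}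
    (hX : IsInfinitesimalSymmetry (𝓡 5) D.fiber X) {u₀ : EuclideanSpace ℝ (Fin 5)}
    (hu₀ : u₀ ∈ c.base) {p q : ℝ × ℝ} (hq : c.IsLiftSlope X (u₀, p) q)
    {y : ℝ → EuclideanSpace ℝ (Fin 5)} (hy0 : y 0 = u₀)
    (hy : ∀ᶠ t in 𝓝 0, HasDerivAt y (localField c.chart X (y t)) t ∧ y t ∈ c.base) :
    ∃ s : ℝ → ℝ × ℝ × ℝ, s 0 = (p.1, p.2, 1) ∧
      HasDerivAt (fun t => ((s t).1 / (s t).2.2, (s t).2.1 / (s t).2.2)) q 0 ∧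
      (∀ᶠ t in 𝓝 0, (s t).2.2 ≠ 0) ∧
      ∀ᶠ t in 𝓝 0, HasDerivAt (fun t => (s t).1 • c.x₁ (y t) + (s t).2.1 • c.x₂ (y t) +
          (s t).2.2 • c.x₃ (y t)) (fderiv ℝ (localField c.chart X) (y t)
            ((s t).1 • c.x₁ (y t) + (s t).2.1 • c.x₂ (y t) + (s t).2.2 • c.x₃ (y t))) t := by
  obtain ⟨a₁, a₂, b₁, b₂, k₁, k₂, k₃, h⟩ := c.exists_coefficients hX
  have hXs : ContDiffAt ℝ ∞ (localField c.chart X) u₀ :=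
    contDiffAt_localField c.chart_mem hu₀.1 hX.1 univ_mem
  let π₁ : ℝ × ℝ × ℝ →L[ℝ] ℝ := ContinuousLinearMap.fst ℝ ℝ (ℝ × ℝ)
  let π₂ : ℝ × ℝ × ℝ →L[ℝ] ℝ :=
    (ContinuousLinearMap.fst ℝ ℝ ℝ).comp (ContinuousLinearMap.snd ℝ ℝ (ℝ × ℝ))
  let π₃ : ℝ × ℝ × ℝ →L[ℝ] ℝ :=
    (ContinuousLinearMap.snd ℝ ℝ ℝ).comp (ContinuousLinearMap.snd ℝ ℝ (ℝ × ℝ))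
  let e₁ : ℝ × ℝ × ℝ := (1, 0, 0)
  let e₂ : ℝ × ℝ × ℝ := (0, 1, 0)
  let e₃ : ℝ × ℝ × ℝ := (0, 0, 1)
  -- Minus the matrix of `[X, ·]` in the frame. Along `y` one has `x_i'(X) = [X, x_i] + X'(x_i)`, so
  -- `v = ∑ s_i x_i` satisfies `v' = X'(v)` as soon as `∑ (s_i' x_i + s_i [X, x_i]) = 0`.
  let g : EuclideanSpace ℝ (Fin 5) → (ℝ × ℝ × ℝ) →L[ℝ] (ℝ × ℝ × ℝ) := fun u =>
    -(a₁ u • π₁.smulRight e₁ + b₁ u • π₂.smulRight e₁ + k₁ u • π₃.smulRight e₁ +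
      (a₂ u • π₁.smulRight e₂ + b₂ u • π₂.smulRight e₂ + k₂ u • π₃.smulRight e₂) +
      k₃ u • π₃.smulRight e₃)
  have hgs : ∀ u s, g u s = (-(a₁ u * s.1 + b₁ u * s.2.1 + k₁ u * s.2.2),
      -(a₂ u * s.1 + b₂ u * s.2.1 + k₂ u * s.2.2), -(k₃ u * s.2.2)) := by
    intro u s
    simp [g, π₁, π₂, π₃, e₁, e₂, e₃]
  have hg : ContDiffAt ℝ 1 g u₀ := by
    obtain ⟨⟨s₁, s₂, s₃, s₄, s₅, s₆, s₇⟩, -⟩ := h u₀ hu₀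
    have l : ∀ {f : EuclideanSpace ℝ (Fin 5) → ℝ} (L : (ℝ × ℝ × ℝ) →L[ℝ] (ℝ × ℝ × ℝ)),
        ContDiffAt ℝ ∞ f u₀ → ContDiffAt ℝ 1 (fun u => f u • L) u₀ :=
      fun L hf => (hf.of_le (by simp)).smul contDiffAt_const
    exact ((((l _ s₁).add (l _ s₃)).add (l _ s₅)).add
      (((l _ s₂).add (l _ s₄)).add (l _ s₆)) |>.add (l _ s₇)).neg
  obtain ⟨s, hs0, hs⟩ := exists_linear_along (hXs.of_le (by simp)) hg hy0
    (hy.mono fun t ht => ht.1) (p.1, p.2, 1)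
  have hs3 : ∀ᶠ t in 𝓝 0, (s t).2.2 ≠ 0 := by
    have : ContinuousAt (fun t => (s t).2.2) 0 := hs.self_of_nhds.continuousAt.snd.snd
    exact this.eventually_ne (by simp [hs0])
  have f₁ : ∀ {t v}, HasDerivAt s v t → HasDerivAt (fun t => (s t).1) v.1 t := fun hv => hv.fst
  have f₂ : ∀ {t v}, HasDerivAt s v t → HasDerivAt (fun t => (s t).2.1) v.2.1 t :=
    fun hv => hv.snd.fst
  have f₃ : ∀ {t v}, HasDerivAt s v t → HasDerivAt (fun t => (s t).2.2) v.2.2 t :=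
    fun hv => hv.snd.snd
  refine ⟨s, hs0, ?_, hs3, ?_⟩
  -- The third coefficient is `1` at time `0`, so the quotient rule gives the velocities `s₁' - p₁
  -- s₃'` and `s₂' - p₂ s₃'`, the two components of the slope formula.
  · have d := hs.self_of_nhds
    rw [hgs, hy0, hs0] at d
    have h3 : (s 0).2.2 ≠ 0 := by simp [hs0]
    have d' := ((f₁ d).div (f₃ d) h3).prodMk ((f₂ d).div (f₃ d) h3)
    obtain ⟨-, h₁, h₂, h₃⟩ := h u₀ hu₀
    rw [(c.isLiftSlope_iff (w := (u₀, p)) hu₀ h₁ h₂ h₃).1 hq]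
    refine d'.congr_deriv ?_
    rw [hs0]
    simp only
    refine Prod.ext ?_ ?_ <;> simp only <;> ring
  · filter_upwards [hs, hy] with t ht hyt
    rw [hgs] at ht
    obtain ⟨-, h₁, h₂, h₃⟩ := h (y t) hyt.2
    have dx : ∀ {f : EuclideanSpace ℝ (Fin 5) → EuclideanSpace ℝ (Fin 5)},
        ContDiffAt ℝ ∞ f (y t) →
        HasDerivAt (fun t => f (y t)) (fderiv ℝ f (y t) (localField c.chart X (y t))) t :=
      fun hf => (hf.differentiableAt (by simp)).hasFDerivAt.comp_hasDerivAt t hyt.1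
    have d := (((f₁ ht).smul (dx (c.contDiffAt_x₁ hyt.2))).add
      ((f₂ ht).smul (dx (c.contDiffAt_x₂ hyt.2)))).add
      ((f₃ ht).smul (dx (c.contDiffAt_x₃ hyt.2)))
    refine d.congr_deriv ?_
    simp only [lieBracket, sub_eq_iff_eq_add] at h₁ h₂ h₃
    simp only [h₁, h₂, h₃, map_add, map_smul]
    module

end ChartData

end Twistor

end TwoThreeFive

/-! ### Velocities of curves in charts -/

namespace TwoThreeFive

section Curves

open Filter Topology

variable {F : Type*} [NormedAddCommGroup F] [NormedSpace ℝ F]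
  {N : Type*} [TopologicalSpace N] [ChartedSpace F N] [IsManifold 𝓘(ℝ, F) ∞ N]
  {e : OpenPartialHomeomorph N F}

lemma hasMFDerivAt_symm_comp (he : e ∈ atlas F N) {y : ℝ → F} {v : F} {t : ℝ}
    (hy : HasDerivAt y v t) (hyt : y t ∈ e.target) :
    HasMFDerivAt 𝓘(ℝ, ℝ) 𝓘(ℝ, F) (fun t => e.symm (y t)) t
      ((1 : ℝ →L[ℝ] ℝ).smulRight (tangentOf e (y t) v)) := by
  have h1 := ((mdifferentiable_of_mem_atlas' he).mdifferentiableAt_symm hyt).hasMFDerivAt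
  have h2 : HasMFDerivAt 𝓘(ℝ, ℝ) 𝓘(ℝ, F) y t ((1 : ℝ →L[ℝ] ℝ).smulRight v) :=
    hy.hasFDerivAt.hasMFDerivAt
  have h3 := h1.comp t h2
  have h4 : (mfderiv 𝓘(ℝ, F) 𝓘(ℝ, F) e.symm (y t)).comp ((1 : ℝ →L[ℝ] ℝ).smulRight v) =
      (1 : ℝ →L[ℝ] ℝ).smulRight (tangentOf e (y t) v) := by
    ext
    exact (mfderiv 𝓘(ℝ, F) 𝓘(ℝ, F) e.symm (y t)).map_smul (1 : ℝ) v
  exact h4 ▸ h3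

lemma mfderiv_apply_eq_localField (he : e ∈ atlas F N) {z : N} (hz : z ∈ e.source)
    (Y : ∀ z : N, TangentSpace 𝓘(ℝ, F) z) :
    mfderiv 𝓘(ℝ, F) 𝓘(ℝ, F) e z (Y z) = localField e Y (e z) := by
  have key : ∀ w ∈ e.target,
      (mfderiv 𝓘(ℝ, F) 𝓘(ℝ, F) e (e.symm w) (Y (e.symm w)) : F) = localField e Y w := by
    intro w hw
    have h := DFunLike.congr_fun ((mdifferentiable_of_mem_atlas' he).comp_symm_deriv hw)
      (localField e Y w)
    rw [← tangentOf_localField he hw Y]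
    exact h
  have := key (e z) (e.map_source hz)
  rwa [e.left_inv hz] at this

end Curves

/-! ### Construction of the lift from the flow -/

namespace Twistor

open VectorField Filter Topology

variable {M : Type*} [TopologicalSpace M] [ChartedSpace (EuclideanSpace ℝ (Fin 5)) M]
  [IsManifold (𝓡 5) ∞ M] {D : GenericDistribution M}

/-- The condition that defines the prolongation lift, at one point. -/
def IsProlongationLiftAt (D : GenericDistribution M) (X : ∀ x : M, TangentSpace (𝓡 5) x)
    (Y : ∀ z : Twistor D, TangentSpace 𝓘(ℝ, EuclideanSpace ℝ (Fin 5) × ℝ × ℝ) z)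
    (z : Twistor D) : Prop :=
  ∃ (U : Set M) (ε : ℝ) (φ : ℝ → M → M) (γ : ℝ → Twistor D),
    z.point ∈ U ∧ IsLocalFlow X U ε φ ∧ γ 0 = z ∧
    (∀ t ∈ Set.Ioo (-ε) ε,
      ∃ h : IsTransversalLine D.fiber (φ t z.point)
          (z.line.map (mfderiv (𝓡 5) (𝓡 5) (φ t) z.point).toLinearMap),
        γ t = ⟨φ t z.point,
          z.line.map (mfderiv (𝓡 5) (𝓡 5) (φ t) z.point).toLinearMap, h⟩) ∧
    HasMFDerivAt 𝓘(ℝ, ℝ) 𝓘(ℝ, EuclideanSpace ℝ (Fin 5) × ℝ × ℝ) γ 0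
      ((1 : ℝ →L[ℝ] ℝ).smulRight (Y (γ 0)))

lemma isProlongationLift_iff {X : ∀ x : M, TangentSpace (𝓡 5) x}
    {Y : ∀ z : Twistor D, TangentSpace 𝓘(ℝ, EuclideanSpace ℝ (Fin 5) × ℝ × ℝ) z} :
    IsProlongationLift D X Y ↔ ∀ z, IsProlongationLiftAt D X Y z := Iff.rfl

namespace ChartData

lemma line_eq (c : ChartData D) {z : Twistor D} (hz : z ∈ c.openChart.source) :
    affineLine c.ξ₁ c.ξ₂ z.point (c.openChart z).2 = z.line :=
  affineLine_slope (c.frame.exists_affineLine hz.2 z.isTransversal)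

lemma isLocalFlow_of_coordinates (c : ChartData D) {X : ∀ x : M, TangentSpace (𝓡 5) x}
    {Φ : EuclideanSpace ℝ (Fin 5) → ℝ → EuclideanSpace ℝ (Fin 5)}
    {B : Set (EuclideanSpace ℝ (Fin 5))} (hB : IsOpen B) {ε : ℝ} (hε : 0 < ε)
    (h0 : ∀ u ∈ B, Φ u 0 = u)
    (hΦ : ∀ u ∈ B, ∀ t ∈ Set.Ioo (-ε) ε,
      HasDerivAt (Φ u) (localField c.chart X (Φ u t)) t ∧ Φ u t ∈ c.base)
    (hc : ContinuousOn (fun q : ℝ × EuclideanSpace ℝ (Fin 5) => Φ q.2 q.1)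
      (Set.Ioo (-ε) ε ×ˢ B)) :
    IsLocalFlow X (c.chart.source ∩ c.chart ⁻¹' B) ε
      (fun t x => c.chart.symm (Φ (c.chart x) t)) where
  isOpen := c.chart.isOpen_inter_preimage hB
  pos := hε
  continuousOn := by
    refine c.chart.continuousOn_symm.comp (hc.comp (f := fun q : ℝ × M => (q.1, c.chart q.2))
      ?_ fun q hq => ⟨hq.1, hq.2.2⟩) fun q hq => (hΦ _ hq.2.2 _ hq.1).2.1
    exact continuousOn_fst.prodMk (c.chart.continuousOn.comp continuousOn_snd fun q hq => hq.2.1)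
  map_zero x hx := by rw [h0 _ hx.2, c.chart.left_inv hx.1]
  isMIntegralCurveOn x hx t ht := by
    obtain ⟨h1, h2⟩ := hΦ _ hx.2 t ht
    have := hasMFDerivAt_symm_comp c.chart_mem h1 h2.1
    rw [tangentOf_localField c.chart_mem h2.1] at this
    exact this.hasMFDerivWithinAt

/-- Dividing by the third coefficient normalises the spanning vector; hence the coordinates of a
moved line are quotients of solutions of a linear equation. -/
lemma span_combination (c : ChartData D) {u : EuclideanSpace ℝ (Fin 5)} (hu : u ∈ c.base)
    {s : ℝ × ℝ × ℝ} (hs : s.2.2 ≠ 0) :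
    Submodule.span ℝ {tangentOf c.chart u (s.1 • c.x₁ u + s.2.1 • c.x₂ u + s.2.2 • c.x₃ u)} =
      affineLine c.ξ₁ c.ξ₂ (c.chart.symm u) (s.1 / s.2.2, s.2.1 / s.2.2) := by
  rw [c.tangentOf_combination hu, affineLine,
    ← Submodule.span_singleton_smul_eq (IsUnit.mk0 _ hs)
      (mlieBracket (𝓡 5) c.ξ₁ c.ξ₂ (c.chart.symm u) + (s.1 / s.2.2) • c.ξ₁ (c.chart.symm u) +
        (s.2.1 / s.2.2) • c.ξ₂ (c.chart.symm u))]
  congr 2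
  rw [smul_add, smul_add, smul_smul, smul_smul, mul_div_cancel₀ _ hs, mul_div_cancel₀ _ hs]
  abel

/-- The derivative of the coordinate flow applied to `director`, and the combination supplied by
`exists_variational_solution`, solve the same linear equation with the same initial value, so they
agree. The moved line thus has affine coordinates `(s₁ / s₃, s₂ / s₃)`. These show that it is
transversal and that its coordinate velocity at time `0` is `q`. -/
lemma isProlongationLiftAt (c : ChartData D) {X : ∀ x : M, TangentSpace (𝓡 5) x}
    (hX : IsInfinitesimalSymmetry (𝓡 5) D.fiber X) {z : Twistor D} (hz : z ∈ c.openChart.source)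
    {Y : ∀ z : Twistor D, TangentSpace 𝓘(ℝ, EuclideanSpace ℝ (Fin 5) × ℝ × ℝ) z} {q : ℝ × ℝ}
    (hY : localField c.openChart Y (c.openChart z) =
      (localField c.chart X (c.openChart z).1, q))
    (hq : c.IsLiftSlope X (c.openChart z) q) : IsProlongationLiftAt D X Y z := by
  set w := c.openChart z with hw
  have hwt : w ∈ c.openChart.target := c.openChart.map_source hz
  have hu : w.1 ∈ c.base := hwt
  have hXs : ContDiffAt ℝ ∞ (localField c.chart X) w.1 :=
    contDiffAt_localField c.chart_mem hu.1 hX.1 univ_mem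
  obtain ⟨r, hr, ε, hε, Φ, A, h0, hΦ, hcont, hA0, hA⟩ :=
    exists_local_flow (hXs.of_le (by exact WithTop.coe_le_coe.2 le_top))
      (c.isOpen_base.mem_nhds hu)
  have hball : w.1 ∈ Metric.ball w.1 r := Metric.mem_ball_self hr
  have hy : ∀ᶠ t in 𝓝 0, HasDerivAt (Φ w.1) (localField c.chart X (Φ w.1 t)) t ∧
      Φ w.1 t ∈ c.base :=
    eventually_of_mem (Ioo_mem_nhds (neg_lt_zero.2 hε) hε) (hΦ w.1 hball)
  obtain ⟨s, hs0, hsd, hs3, hsv⟩ := c.exists_variational_solution hX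
    (u₀ := w.1) hu (p := w.2) (q := q) hq (h0 w.1 hball) hy
  have hAv : (fun t => A t (c.director w)) =ᶠ[𝓝 0] fun t =>
      (s t).1 • c.x₁ (Φ w.1 t) + (s t).2.1 • c.x₂ (Φ w.1 t) + (s t).2.2 • c.x₃ (Φ w.1 t) := by
    refine linear_unique (B := fun t => fderiv ℝ (localField c.chart X) (Φ w.1 t)) ?_ ?_ hsv ?_
    · have h1 : ContinuousAt (fderiv ℝ (localField c.chart X)) (Φ w.1 0) := by
        rw [h0 _ hball]
        exact (hXs.fderiv_right (m := 1) (by exact WithTop.coe_le_coe.2 le_top)).continuousAt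
      exact h1.comp hy.self_of_nhds.1.continuousAt
    · filter_upwards [hA] with t ht
      exact (ht.2.clm_apply (hasDerivAt_const t (c.director w))).congr_deriv (by simp)
    · simp only [hA0, hs0, h0 _ hball, director]
      simp only [ContinuousLinearMap.id_apply]
      module
  obtain ⟨δ, hδ, hall⟩ := Metric.eventually_nhds_iff_ball.1 ((hA.and hs3).and hAv)
  -- The moved line has to be controlled at every time of the flow interval, so the interval is cut
  -- down to where the facts known near `0` hold.
  set ε' := min ε δ
  have hε' : 0 < ε' := lt_min hε hδ
  have hsub : Set.Ioo (-ε') ε' ⊆ Set.Ioo (-ε) ε :=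
    Set.Ioo_subset_Ioo (neg_le_neg (min_le_left _ _)) (min_le_left _ _)
  have hsub' : ∀ t ∈ Set.Ioo (-ε') ε', t ∈ Metric.ball (0 : ℝ) δ := by
    intro t ht
    rw [mem_ball_zero_iff, Real.norm_eq_abs]
    exact (abs_lt.2 ht).trans_le (min_le_right _ _)
  set W : ℝ → EuclideanSpace ℝ (Fin 5) × ℝ × ℝ :=
    fun t => (Φ w.1 t, (s t).1 / (s t).2.2, (s t).2.1 / (s t).2.2) with hW
  have hW0 : W 0 = w := by
    rw [hW]
    refine Prod.ext (h0 _ hball) (Prod.ext ?_ ?_) <;> simp [hs0]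
  refine ⟨c.chart.source ∩ c.chart ⁻¹' Metric.ball w.1 r, ε', fun t x => c.chart.symm (Φ (c.chart x) t), fun t => c.openChart.symm (W t),
    ⟨hz.1, hball⟩, c.isLocalFlow_of_coordinates Metric.isOpen_ball hε' h0
      (fun u hu t ht => hΦ u hu t (hsub ht)) (hcont.mono (Set.prod_mono hsub le_rfl)), ?_, ?_, ?_⟩
  · simp only [hW0]
    exact c.openChart.left_inv hz
  · intro t ht
    obtain ⟨⟨⟨hAt, -⟩, hst⟩, hvt⟩ := hall t (hsub' t ht)
    have hyt : Φ w.1 t ∈ c.base := (hΦ w.1 hball t (hsub ht)).2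
    have d1 := ((mdifferentiable_of_mem_atlas' c.chart_mem).mdifferentiableAt hz.1).hasMFDerivAt
    have d2 : HasMFDerivAt (𝓡 5) (𝓡 5) (fun u => Φ u t) (c.chart z.point) (A t) :=
      hAt.hasMFDerivAt
    have d3 := ((mdifferentiable_of_mem_atlas' c.chart_mem).mdifferentiableAt_symm
      hyt.1).hasMFDerivAt
    have d := (d3.comp z.point (d2.comp z.point d1)).mfderiv
    have hline : z.line.map (mfderiv (𝓡 5) (𝓡 5) (fun x => c.chart.symm (Φ (c.chart x) t))
        z.point).toLinearMap = affineLine c.ξ₁ c.ξ₂ (c.chart.symm (Φ w.1 t)) (W t).2 := by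
      rw [← c.line_eq hz, affineLine, Submodule.map_span, Set.image_singleton]
      have hvt' : A t (c.director w) = (s t).1 • c.x₁ (Φ w.1 t) + (s t).2.1 • c.x₂ (Φ w.1 t) +
        (s t).2.2 • c.x₃ (Φ w.1 t) := hvt
      have e1 : mfderiv (𝓡 5) (𝓡 5) c.chart z.point
          (mlieBracket (𝓡 5) c.ξ₁ c.ξ₂ z.point + w.2.1 • c.ξ₁ z.point + w.2.2 • c.ξ₂ z.point) =
          c.director w := by
        rw [map_add, map_add, map_smul, map_smul, mfderiv_apply_eq_localField c.chart_mem hz.1,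
          mfderiv_apply_eq_localField c.chart_mem hz.1,
          mfderiv_apply_eq_localField c.chart_mem hz.1]
        rfl
      have e2 := (DFunLike.congr_fun d (mlieBracket (𝓡 5) c.ξ₁ c.ξ₂ z.point +
        w.2.1 • c.ξ₁ z.point + w.2.2 • c.ξ₂ z.point)).trans
          ((congrArg (fun v => tangentOf c.chart (Φ w.1 t) (A t v)) e1).trans
            (congrArg (tangentOf c.chart (Φ w.1 t)) hvt'))
      refine Eq.trans ?_ (c.span_combination hyt hst)
      exact congrArg (fun v => Submodule.span ℝ {v}) e2
    have hT : IsTransversalLine D.fiber (c.chart.symm (Φ w.1 t))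
        (z.line.map (mfderiv (𝓡 5) (𝓡 5) (fun x => c.chart.symm (Φ (c.chart x) t))
          z.point).toLinearMap) := by
      have key : ∀ (x : M) (l l' : Submodule ℝ (TangentSpace (𝓡 5) x)),
          l = l' → IsTransversalLine D.fiber x l' → IsTransversalLine D.fiber x l := by
        rintro x l _ rfl h
        exact h
      exact key _ _ _ hline (c.frame.isTransversalLine_affineLine hyt.2 _)
    refine ⟨hT, (c.openChart_symm_apply (w := W t) hyt).trans ?_⟩
    have key : ∀ (x : M) (l l' : Submodule ℝ (TangentSpace (𝓡 5) x)) (h h'),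
        l = l' → (⟨x, l, h⟩ : Twistor D) = ⟨x, l', h'⟩ := by
      rintro x l _ h h' rfl
      rfl
    exact key _ _ _ _ _ hline.symm
  · have hWd : HasDerivAt W (localField c.openChart Y (W 0)) 0 := by
      rw [hW0, hY]
      exact ((hy.self_of_nhds.1).congr_deriv (by rw [h0 _ hball])).prodMk hsd
    have := hasMFDerivAt_symm_comp c.openChart_mem_atlas hWd (by rwa [hW0])
    rwa [tangentOf_localField c.openChart_mem_atlas (by rwa [hW0])] at this

end ChartData

end Twistor

end TwoThreeFive

/-! ### Uniqueness of the lift and its form in a chart -/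

namespace TwoThreeFive

namespace Twistor

open VectorField Filter Topology

variable {M : Type*} [TopologicalSpace M] [ChartedSpace (EuclideanSpace ℝ (Fin 5)) M]
  [IsManifold (𝓡 5) ∞ M] {D : GenericDistribution M}

/-- Comparing the lines as subspaces of the model space avoids a heterogeneous equality. -/
lemma mk_congr {x x' : M} {l : Submodule ℝ (TangentSpace (𝓡 5) x)}
    {l' : Submodule ℝ (TangentSpace (𝓡 5) x')} (h : IsTransversalLine D.fiber x l)
    (h' : IsTransversalLine D.fiber x' l') (hx : x = x')
    (hl : (l : Submodule ℝ (EuclideanSpace ℝ (Fin 5))) = l') :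
    (⟨x, l, h⟩ : Twistor D) = ⟨x', l', h'⟩ := by
  subst hx
  have hl' : l = l' := hl
  subst hl'
  rfl

/-- Two local flows of a smooth vector field agree near each common initial point. -/
lemma _root_.TwoThreeFive.IsLocalFlow.eq_of_mem [T2Space M] {X : ∀ x : M, TangentSpace (𝓡 5) x}
    (hX : SmoothFieldOn (𝓡 5) X Set.univ) {U U' : Set M} {ε ε' : ℝ} {φ φ' : ℝ → M → M}
    (h : IsLocalFlow X U ε φ) (h' : IsLocalFlow X U' ε' φ') {x : M} (hx : x ∈ U ∩ U')
    {t : ℝ} (ht : t ∈ Set.Ioo (-min ε ε') (min ε ε')) : φ t x = φ' t x := by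
  have : IsManifold (𝓡 5) 1 M := IsManifold.of_le (n := ∞) (by exact WithTop.coe_le_coe.2 le_top)
  have h0 : 0 < min ε ε' := lt_min h.pos h'.pos
  refine isMIntegralCurveOn_Ioo_eqOn_of_contMDiff_boundaryless (I := 𝓡 5) (t₀ := 0)
    (γ := fun t => φ t x) (γ' := fun t => φ' t x) ⟨neg_lt_zero.2 h0, h0⟩
    ((contMDiffOn_univ.1 hX).of_le (by exact WithTop.coe_le_coe.2 le_top))
    ((h.isMIntegralCurveOn x hx.1).mono ?_) ((h'.isMIntegralCurveOn x hx.2).mono ?_)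
    ((h.map_zero x hx.1).trans (h'.map_zero x hx.2).symm) ht
  · exact Set.Ioo_subset_Ioo (neg_le_neg (min_le_left _ _)) (min_le_left _ _)
  · exact Set.Ioo_subset_Ioo (neg_le_neg (min_le_right _ _)) (min_le_right _ _)

/-- The value of a lift at a point is unique. -/
lemma IsProlongationLiftAt.eq [T2Space M] {X : ∀ x : M, TangentSpace (𝓡 5) x}
    (hX : SmoothFieldOn (𝓡 5) X Set.univ)
    {Y Y' : ∀ z : Twistor D, TangentSpace 𝓘(ℝ, EuclideanSpace ℝ (Fin 5) × ℝ × ℝ) z}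
    {z : Twistor D} (h : IsProlongationLiftAt D X Y z) (h' : IsProlongationLiftAt D X Y' z) :
    Y z = Y' z := by
  obtain ⟨U, ε, φ, γ, hU, hφ, h0, hγ, hd⟩ := h
  obtain ⟨U', ε', φ', γ', hU', hφ', h0', hγ', hd'⟩ := h'
  have hε : 0 < min ε ε' := lt_min hφ.pos hφ'.pos
  have hγγ : γ =ᶠ[𝓝 0] γ' := by
    filter_upwards [Ioo_mem_nhds (neg_lt_zero.2 hε) hε] with t ht
    obtain ⟨k, hk⟩ := hγ t (Set.Ioo_subset_Ioo (neg_le_neg (min_le_left _ _)) (min_le_left _ _) ht)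
    obtain ⟨k', hk'⟩ :=
      hγ' t (Set.Ioo_subset_Ioo (neg_le_neg (min_le_right _ _)) (min_le_right _ _) ht)
    -- Agreement on a neighbourhood of the base point, not just at it, is needed because the
    -- derivatives of the two flow maps are compared as well.
    have hφφ : φ t =ᶠ[𝓝 z.point] φ' t := by
      filter_upwards [(hφ.isOpen.inter hφ'.isOpen).mem_nhds ⟨hU, hU'⟩] with x hx
      exact hφ.eq_of_mem hX hφ' hx ht
    rw [hk, hk']
    refine mk_congr k k' hφφ.self_of_nhds ?_
    have hm := hφφ.mfderiv_eq (I := 𝓡 5) (I' := 𝓡 5)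
    exact congrArg (fun A : EuclideanSpace ℝ (Fin 5) →L[ℝ] EuclideanSpace ℝ (Fin 5) =>
      Submodule.map A.toLinearMap z.line) hm
  have h1 := hd'.congr_of_eventuallyEq hγγ
  have h2 := DFunLike.congr_fun (hasMFDerivAt_unique hd h1) (1 : ℝ)
  have h3 : (Y (γ 0) : EuclideanSpace ℝ (Fin 5) × ℝ × ℝ) = Y' (γ' 0) := by
    have e1 := one_smul ℝ (Y (γ 0) : EuclideanSpace ℝ (Fin 5) × ℝ × ℝ)
    have e2 := one_smul ℝ (Y' (γ' 0) : EuclideanSpace ℝ (Fin 5) × ℝ × ℝ)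
    exact e1.symm.trans (h2.trans e2)
  have h4 := congrArg (fun z => (Y z : EuclideanSpace ℝ (Fin 5) × ℝ × ℝ)) h0
  have h5 := congrArg (fun z => (Y' z : EuclideanSpace ℝ (Fin 5) × ℝ × ℝ)) h0'
  exact h4.symm.trans (h3.trans h5)

namespace ChartData

lemma mem_source_chartDataAt (z : Twistor D) : z ∈ (chartDataAt z).openChart.source :=
  (core D).mem_chart_source z

/-- The lift of a symmetry in a chart. -/
lemma isProlongationLiftAt_pushField (c : ChartData D) {X : ∀ x : M, TangentSpace (𝓡 5) x}
    (hX : IsInfinitesimalSymmetry (𝓡 5) D.fiber X)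
    {q : EuclideanSpace ℝ (Fin 5) × ℝ × ℝ → ℝ × ℝ} {z : Twistor D} (hz : z ∈ c.openChart.source)
    (hq : c.IsLiftSlope X (c.openChart z) (q (c.openChart z))) :
    IsProlongationLiftAt D X (pushField c.openChart fun w => (localField c.chart X w.1, q w)) z :=
  c.isProlongationLiftAt hX hz
    (localField_pushField c.openChart_mem_atlas (c.openChart.map_source hz) _) hq

end ChartData

lemma IsProlongationLiftAt.congr {X : ∀ x : M, TangentSpace (𝓡 5) x}
    {Y Y' : ∀ z : Twistor D, TangentSpace 𝓘(ℝ, EuclideanSpace ℝ (Fin 5) × ℝ × ℝ) z}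
    {z : Twistor D} (h : IsProlongationLiftAt D X Y z) (hY : Y z = Y' z) :
    IsProlongationLiftAt D X Y' z := by
  obtain ⟨U, ε, φ, γ, hU, hφ, rfl, hγ, hd⟩ := h
  exact ⟨U, ε, φ, γ, hU, hφ, rfl, hγ, hY ▸ hd⟩

/-- The condition at `z` depends on `Y` only through `Y z`. The values may therefore be taken from a
different chart at each point, with no compatibility to check. -/
theorem existsUnique_isProlongationLift [T2Space M] {X : ∀ x : M, TangentSpace (𝓡 5) x}
    (hX : IsInfinitesimalSymmetry (𝓡 5) D.fiber X) :
    ∃! Y : ∀ z : Twistor D, TangentSpace 𝓘(ℝ, EuclideanSpace ℝ (Fin 5) × ℝ × ℝ) z,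
      IsProlongationLift D X Y := by
  choose q hq using fun z : Twistor D => (chartDataAt z).exists_contDiffAt_isLiftSlope hX
  have h : ∀ z : Twistor D, IsProlongationLiftAt D X (pushField (chartDataAt z).openChart
      fun w => (localField (chartDataAt z).chart X w.1, q z w)) z := fun z =>
    (chartDataAt z).isProlongationLiftAt_pushField hX (ChartData.mem_source_chartDataAt z)
      (hq z _ ((chartDataAt z).openChart.map_source (ChartData.mem_source_chartDataAt z))).2
  refine ⟨fun z => pushField (chartDataAt z).openChart
      (fun w => (localField (chartDataAt z).chart X w.1, q z w)) z,
    isProlongationLift_iff.2 fun z => (h z).congr rfl,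
    fun Y hY => funext fun z => (isProlongationLift_iff.1 hY z).eq hX.1 (h z)⟩

/-- The lift of a symmetry in a chart. -/
lemma _root_.TwoThreeFive.IsProlongationLift.exists_localField [T2Space M] {X : ∀ x : M, TangentSpace (𝓡 5) x}
    {Y : ∀ z : Twistor D, TangentSpace 𝓘(ℝ, EuclideanSpace ℝ (Fin 5) × ℝ × ℝ) z}
    (hY : IsProlongationLift D X Y) (hX : IsInfinitesimalSymmetry (𝓡 5) D.fiber X)
    (c : ChartData D) :
    ∃ q : EuclideanSpace ℝ (Fin 5) × ℝ × ℝ → ℝ × ℝ, ∀ w : EuclideanSpace ℝ (Fin 5) × ℝ × ℝ,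
      w.1 ∈ c.base → ContDiffAt ℝ ∞ q w ∧ c.IsLiftSlope X w (q w) ∧
        localField c.openChart Y w = (localField c.chart X w.1, q w) := by
  obtain ⟨q, hq⟩ := c.exists_contDiffAt_isLiftSlope hX
  refine ⟨q, fun w hw => ⟨(hq w hw).1, (hq w hw).2, ?_⟩⟩
  have hwt : w ∈ c.openChart.target := hw
  -- The field built in this chart satisfies the lift condition at each of its points, and
  -- uniqueness of the value identifies it with `Y`.
  have h := c.isProlongationLiftAt_pushField (q := q) hX (c.openChart.map_target hwt)
    (by rw [c.openChart.right_inv hwt]; exact (hq w hw).2)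
  refine (localField_eq_iff c.openChart_mem_atlas hwt).2 (Eq.trans ?_
    ((isProlongationLift_iff.1 hY (c.openChart.symm w)).eq hX.1 h).symm)
  exact tangentOf_eq_pushField c.openChart_mem_atlas hwt
    (fun w => (localField c.chart X w.1, q w))

end Twistor

end TwoThreeFive

/-! ### Lifts are symmetries of the prolongation -/

namespace TwoThreeFive

open VectorField Filter Topology

/-- A field of multiples of a nowhere vanishing field has smooth coefficients. -/
lemma exists_contDiffAt_smul {F G : Type*} [NormedAddCommGroup F] [NormedSpace ℝ F]
    [NormedAddCommGroup G] [NormedSpace ℝ G] {n : ℕ∞ω} {g d : F → G} {w : F}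
    (hg : ContDiffAt ℝ n g w) (hd : ContDiffAt ℝ n d w) (h0 : d w ≠ 0)
    (h : ∀ᶠ w in 𝓝 w, ∃ k : ℝ, g w = k • d w) :
    ∃ f : F → ℝ, ContDiffAt ℝ n f w ∧ g =ᶠ[𝓝 w] fun w => f w • d w := by
  -- A functional that does not vanish on `d w` recovers the coefficient as the quotient `l g / l d`
  -- near `w`.
  obtain ⟨l, hl⟩ := SeparatingDual.exists_eq_one (R := ℝ) h0
  have hl0 : l (d w) ≠ 0 := by rw [hl]; exact one_ne_zero
  have cg : ContDiffAt ℝ n (fun w => l (g w)) w := l.contDiff.contDiffAt.comp w hg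
  have cd : ContDiffAt ℝ n (fun w => l (d w)) w := l.contDiff.contDiffAt.comp w hd
  refine ⟨fun w => l (g w) / l (d w), cg.div cd hl0, ?_⟩
  have hne : ∀ᶠ w in 𝓝 w, l (d w) ≠ 0 :=
    (l.continuous.continuousAt.comp hd.continuousAt).eventually_ne hl0
  filter_upwards [h, hne] with w hw hlw
  obtain ⟨k, hk⟩ := hw
  rw [hk, map_smul, smul_eq_mul, mul_div_cancel_right₀ _ hlw]

/-- Membership in the prolongation constrains only the first component, so this half of the bracket
suffices. -/
lemma lieBracket_fst {F G : Type*} [NormedAddCommGroup F] [NormedSpace ℝ F]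
    [NormedAddCommGroup G] [NormedSpace ℝ G] {V W : F × G → F × G} {w : F × G}
    (hV : DifferentiableAt ℝ V w) (hW : DifferentiableAt ℝ W w) :
    (lieBracket ℝ V W w).1 =
      fderiv ℝ (fun w => (W w).1) w (V w) - fderiv ℝ (fun w => (V w).1) w (W w) := by
  rw [hV.hasFDerivAt.fst.fderiv, hW.hasFDerivAt.fst.fderiv]
  rfl

namespace Twistor

variable {M : Type*} [TopologicalSpace M] [ChartedSpace (EuclideanSpace ℝ (Fin 5)) M]
  [IsManifold (𝓡 5) ∞ M] {D : GenericDistribution M}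

namespace ChartData

lemma fderiv_director_apply (c : ChartData D) {w : EuclideanSpace ℝ (Fin 5) × ℝ × ℝ}
    (hw : w.1 ∈ c.base) (v : EuclideanSpace ℝ (Fin 5) × ℝ × ℝ) :
    fderiv ℝ c.director w v = fderiv ℝ c.x₃ w.1 v.1 + w.2.1 • fderiv ℝ c.x₁ w.1 v.1 +
      w.2.2 • fderiv ℝ c.x₂ w.1 v.1 + v.2.1 • c.x₁ w.1 + v.2.2 • c.x₂ w.1 := by
  have hf := hasFDerivAt_fst (𝕜 := ℝ) (p := w)
  have hs := hasFDerivAt_snd (𝕜 := ℝ) (p := w)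
  have h : ∀ {f : EuclideanSpace ℝ (Fin 5) → EuclideanSpace ℝ (Fin 5)}, ContDiffAt ℝ ∞ f w.1 →
      HasFDerivAt (fun w : EuclideanSpace ℝ (Fin 5) × ℝ × ℝ => f w.1) _ w :=
    fun hk => (hk.differentiableAt (by simp)).hasFDerivAt.comp w hf
  have key := ((h (c.contDiffAt_x₃ hw)).add (hs.fst.smul (h (c.contDiffAt_x₁ hw)))).add
    (hs.snd.smul (h (c.contDiffAt_x₂ hw)))
  refine (DFunLike.congr_fun key.fderiv v).trans ?_
  simp
  module

/-- Differentiating `director` along `(X, q)` and subtracting `X'(director)` assembles the three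
brackets and the terms in `q`. For a field `(X, q)` on the twistor chart this difference is the
first component of its bracket with `(director, 0)`, which links slopes to symmetries of the
prolongation. -/
lemma isLiftSlope_iff_director (c : ChartData D) {X : ∀ x : M, TangentSpace (𝓡 5) x}
    {w : EuclideanSpace ℝ (Fin 5) × ℝ × ℝ} (hw : w.1 ∈ c.base) {q : ℝ × ℝ} :
    c.IsLiftSlope X w q ↔ ∃ k : ℝ, fderiv ℝ c.director w (localField c.chart X w.1, q) -
      fderiv ℝ (localField c.chart X) w.1 (c.director w) = k • c.director w := by
  refine exists_congr fun k => ?_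
  rw [c.fderiv_director_apply hw]
  simp only [lieBracket, director, map_add, map_smul]
  refine Eq.congr ?_ rfl
  module

lemma mem_prolongation_iff (c : ChartData D) {w : EuclideanSpace ℝ (Fin 5) × ℝ × ℝ}
    (hw : w.1 ∈ c.base)
    {Z : ∀ z : Twistor D, TangentSpace 𝓘(ℝ, EuclideanSpace ℝ (Fin 5) × ℝ × ℝ) z} :
    Z (c.openChart.symm w) ∈ prolongation D (c.openChart.symm w) ↔
      ∃ k : ℝ, (localField c.openChart Z w).1 = k • c.director w := by
  have hwt : w ∈ c.openChart.target := hw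
  rw [← c.tangentOf_mem_prolongation_iff hw, tangentOf_localField c.openChart_mem_atlas hwt]

lemma source_mem_nhds (c : ChartData D) {w : EuclideanSpace ℝ (Fin 5) × ℝ × ℝ}
    (hw : w.1 ∈ c.base) {U : Set (Twistor D)} (hU : U ∈ 𝓝 (c.openChart.symm w)) :
    ∀ᶠ w in 𝓝 w, w.1 ∈ c.base ∧ c.openChart.symm w ∈ U :=
  Filter.Eventually.and ((c.isOpen_base.preimage continuous_fst).mem_nhds hw)
    ((c.openChart.continuousAt_symm (mem_openChart_target.2 hw)).eventually hU)

end ChartData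

/-- The lift of a symmetry is smooth. -/
lemma _root_.TwoThreeFive.IsProlongationLift.smoothFieldOn [T2Space M]
    {X : ∀ x : M, TangentSpace (𝓡 5) x}
    {Y : ∀ z : Twistor D, TangentSpace 𝓘(ℝ, EuclideanSpace ℝ (Fin 5) × ℝ × ℝ) z}
    (hY : IsProlongationLift D X Y) (hX : IsInfinitesimalSymmetry (𝓡 5) D.fiber X) :
    SmoothFieldOn 𝓘(ℝ, EuclideanSpace ℝ (Fin 5) × ℝ × ℝ) Y Set.univ := by
  refine contMDiffOn_univ.2 fun z => ?_
  set c := chartDataAt z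
  have hz : z ∈ c.openChart.source := ChartData.mem_source_chartDataAt z
  obtain ⟨q, hq⟩ := hY.exists_localField hX c
  refine ContMDiffOn.contMDiffAt (smoothFieldOn_of_localField c.openChart_mem_atlas le_rfl
    fun z hz => ?_) (c.openChart.open_source.mem_nhds hz)
  have hw : (c.openChart z).1 ∈ c.base := c.openChart.map_source hz
  have h1 : ContDiffAt ℝ ∞ (fun w : EuclideanSpace ℝ (Fin 5) × ℝ × ℝ =>
      (localField c.chart X w.1, q w)) (c.openChart z) :=
    ((contDiffAt_localField c.chart_mem hw.1 hX.1 univ_mem).comp (c.openChart z)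
      contDiffAt_fst).prodMk (hq _ hw).1
  refine h1.congr_of_eventuallyEq ?_
  filter_upwards [(c.isOpen_base.preimage continuous_fst).mem_nhds hw] with w hw
  exact (hq w hw).2.2

/-- The lift of a symmetry is a symmetry of the prolongation. -/
theorem _root_.TwoThreeFive.IsProlongationLift.isInfinitesimalSymmetry [T2Space M]
    {X : ∀ x : M, TangentSpace (𝓡 5) x}
    {Y : ∀ z : Twistor D, TangentSpace 𝓘(ℝ, EuclideanSpace ℝ (Fin 5) × ℝ × ℝ) z}
    (hY : IsProlongationLift D X Y) (hX : IsInfinitesimalSymmetry (𝓡 5) D.fiber X) :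
    IsInfinitesimalSymmetry 𝓘(ℝ, EuclideanSpace ℝ (Fin 5) × ℝ × ℝ) (prolongation D) Y := by
  have hs := hY.smoothFieldOn hX
  refine ⟨hs, fun U ξ hU hξ =>
    ⟨SmoothFieldOn.mlieBracket hU (hs.mono (Set.subset_univ _)) hξ.1, fun z hz => ?_⟩⟩
  set c := chartDataAt z
  have hzc : z ∈ c.openChart.source := ChartData.mem_source_chartDataAt z
  obtain ⟨w, hw, hwz⟩ : ∃ w : EuclideanSpace ℝ (Fin 5) × ℝ × ℝ,
      w.1 ∈ c.base ∧ c.openChart.symm w = z :=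
    ⟨c.openChart z, c.openChart.map_source hzc, c.openChart.left_inv hzc⟩
  -- The chart was chosen from `z`; making it opaque allows `z` to be replaced by its coordinate
  -- form.
  clear_value c
  subst hwz
  have hwt : w ∈ c.openChart.target := hw
  have hUn := hU.mem_nhds hz
  obtain ⟨q, hq⟩ := hY.exists_localField hX c
  refine (c.mem_prolongation_iff hw).2 ?_
  have sY := contDiffAt_localField c.openChart_mem_atlas hwt hs univ_mem
  have sξ := contDiffAt_localField c.openChart_mem_atlas hwt hξ.1 hUn
  have hXs := contDiffAt_localField c.chart_mem (w := w.1) hw.1 hX.1 univ_mem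
  rw [localField_mlieBracket c.openChart_mem_atlas hwt hs hξ.1 univ_mem hUn,
    lieBracket_fst (sY.differentiableAt (by simp)) (sξ.differentiableAt (by simp))]
  -- A section of the prolongation has first component `f • director`; `f` has to be smooth for the
  -- Leibniz rule to apply.
  obtain ⟨f, hf, hfe⟩ := exists_contDiffAt_smul sξ.fst (c.contDiffAt_director hw)
    (c.director_ne_zero hw) ((c.source_mem_nhds hw hUn).mono fun w hw =>
      (c.mem_prolongation_iff hw.1).1 (hξ.2 _ hw.2))
  have hYe : (fun w => (localField c.openChart Y w).1) =ᶠ[𝓝 w]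
      fun w => localField c.chart X w.1 := by
    filter_upwards [(c.isOpen_base.preimage continuous_fst).mem_nhds hw] with w hw
    rw [(hq w hw).2.2]
  have d1 : HasFDerivAt (fun w : EuclideanSpace ℝ (Fin 5) × ℝ × ℝ => localField c.chart X w.1) _ w :=
    (hXs.differentiableAt (by simp)).hasFDerivAt.comp w hasFDerivAt_fst
  have d2 := (hf.differentiableAt (by simp)).hasFDerivAt.fun_smul
    ((c.contDiffAt_director hw).differentiableAt (by simp)).hasFDerivAt
  obtain ⟨k, hk⟩ := (c.isLiftSlope_iff_director hw).1 (hq w hw).2.1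
  rw [hfe.fderiv_eq, hYe.fderiv_eq, d1.fderiv, d2.fderiv, (hq w hw).2.2]
  have e : (localField c.openChart ξ w).1 = f w • c.director w := hfe.self_of_nhds
  -- The derivative of `f` along the lift comes from the Leibniz rule, and `f w * k` from the slope
  -- condition.
  refine ⟨fderiv ℝ f w (localField c.chart X w.1, q w) + f w * k, ?_⟩
  simp only [add_apply, smul_apply,
    ContinuousLinearMap.smulRight_apply, ContinuousLinearMap.comp_apply,
    ContinuousLinearMap.coe_fst', e, map_smul]
  rw [add_smul, mul_smul, ← hk]
  module

end Twistor

end TwoThreeFive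

/-! ### Symmetries of the prolongation project to symmetries of `D` -/

namespace TwoThreeFive

namespace Twistor

open VectorField Filter Topology

variable {M : Type*} [TopologicalSpace M] [ChartedSpace (EuclideanSpace ℝ (Fin 5)) M]
  [IsManifold (𝓡 5) ∞ M] {D : GenericDistribution M}
  {Y : ∀ z : Twistor D, TangentSpace 𝓘(ℝ, EuclideanSpace ℝ (Fin 5) × ℝ × ℝ) z}

namespace ChartData

/-- A symmetry of the prolongation, bracketed in a chart with a section of the prolongation. -/
lemma exists_lieBracket_fst (c : ChartData D)
    (hY : IsInfinitesimalSymmetry 𝓘(ℝ, EuclideanSpace ℝ (Fin 5) × ℝ × ℝ) (prolongation D) Y)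
    {V : EuclideanSpace ℝ (Fin 5) × ℝ × ℝ → EuclideanSpace ℝ (Fin 5) × ℝ × ℝ}
    (hV : ∀ w : EuclideanSpace ℝ (Fin 5) × ℝ × ℝ, w.1 ∈ c.base →
      ContDiffAt ℝ ∞ V w ∧ ∃ k : ℝ, (V w).1 = k • c.director w)
    {w : EuclideanSpace ℝ (Fin 5) × ℝ × ℝ} (hw : w.1 ∈ c.base) :
    ∃ k : ℝ, (lieBracket ℝ (localField c.openChart Y) V w).1 = k • c.director w := by
  have hwt : w ∈ c.openChart.target := hw
  have hs : SmoothFieldOn 𝓘(ℝ, EuclideanSpace ℝ (Fin 5) × ℝ × ℝ) (pushField c.openChart V)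
      c.openChart.source := fun z hz => (contMDiffAt_pushField c.openChart_mem_atlas hz
    (hV _ (c.openChart.map_source hz)).1).contMDiffWithinAt
  have hsec : IsSectionOn 𝓘(ℝ, EuclideanSpace ℝ (Fin 5) × ℝ × ℝ) (prolongation D)
      (pushField c.openChart V) c.openChart.source := by
    refine ⟨hs, fun z hz => ?_⟩
    have hz' := c.openChart.map_source hz
    have := (c.mem_prolongation_iff (Z := pushField c.openChart V) (w := c.openChart z) hz').2
    rw [c.openChart.left_inv hz, localField_pushField c.openChart_mem_atlas hz'] at this
    exact this (hV _ hz').2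
  have h1 := (hY.2 _ _ c.openChart.open_source hsec).2 _ (c.openChart.map_target hwt)
  have h2 := (c.mem_prolongation_iff hw).1 h1
  rw [localField_mlieBracket c.openChart_mem_atlas hwt hY.1 hs univ_mem
    (c.openChart.open_source.mem_nhds (c.openChart.map_target hwt))] at h2
  have h3 : localField c.openChart (pushField c.openChart V) =ᶠ[𝓝 w] V := by
    filter_upwards [c.openChart.open_target.mem_nhds hwt] with w hw
    exact localField_pushField c.openChart_mem_atlas hw V
  rwa [(EventuallyEq.refl (𝓝 w) _).lieBracket_vectorField_eq h3] at h2

lemma contDiffAt_localField_of_symmetry {c : ChartData D}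
    (hY : IsInfinitesimalSymmetry 𝓘(ℝ, EuclideanSpace ℝ (Fin 5) × ℝ × ℝ) (prolongation D) Y)
    {w : EuclideanSpace ℝ (Fin 5) × ℝ × ℝ} (hw : w.1 ∈ c.base) :
    ContDiffAt ℝ ∞ (localField c.openChart Y) w :=
  contDiffAt_localField c.openChart_mem_atlas hw hY.1 univ_mem

/-- Constant vertical fields are sections of the prolongation, and the first component of their
bracket with the symmetry is minus this vertical derivative. -/
lemma exists_fderiv_fst_localField (c : ChartData D)
    (hY : IsInfinitesimalSymmetry 𝓘(ℝ, EuclideanSpace ℝ (Fin 5) × ℝ × ℝ) (prolongation D) Y)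
    (e : ℝ × ℝ) {w : EuclideanSpace ℝ (Fin 5) × ℝ × ℝ} (hw : w.1 ∈ c.base) :
    ∃ k : ℝ, fderiv ℝ (fun w => (localField c.openChart Y w).1) w (0, e) = k • c.director w := by
  obtain ⟨k, hk⟩ := c.exists_lieBracket_fst hY (V := fun _ => (0, e))
    (fun w _ => ⟨contDiffAt_const, 0, by simp⟩) hw
  rw [lieBracket_fst ((contDiffAt_localField_of_symmetry hY hw).differentiableAt (by simp))
    (differentiableAt_const _), fderiv_fun_const, Pi.zero_apply, zero_apply, zero_sub] at hk
  exact ⟨-k, by rw [neg_smul, ← hk, neg_neg]⟩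

/-- The first component of a symmetry of the prolongation is constant along the fibres. -/
lemma fderiv_fst_localField_eq_zero (c : ChartData D)
    (hY : IsInfinitesimalSymmetry 𝓘(ℝ, EuclideanSpace ℝ (Fin 5) × ℝ × ℝ) (prolongation D) Y)
    {w : EuclideanSpace ℝ (Fin 5) × ℝ × ℝ} (hw : w.1 ∈ c.base) (e : ℝ × ℝ) :
    fderiv ℝ (fun w => (localField c.openChart Y w).1) w (0, e) = 0 := by
  set Q := fun w => (localField c.openChart Y w).1 with hQ
  have sQ : ContDiffAt ℝ ∞ Q w := (contDiffAt_localField_of_symmetry hY hw).fst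
  have sQ' : ContDiffAt ℝ 1 (fderiv ℝ Q) w :=
    sQ.fderiv_right (by exact WithTop.coe_le_coe.2 le_top)
  have sd := (c.contDiffAt_director hw).of_le (m := 1) (by exact WithTop.coe_le_coe.2 le_top)
  have hnear : ∀ᶠ w : EuclideanSpace ℝ (Fin 5) × ℝ × ℝ in 𝓝 w, w.1 ∈ c.base :=
    (c.isOpen_base.preimage continuous_fst).mem_nhds hw
  -- The multiples of `director` are chosen `C¹`, so that the vertical derivatives can be
  -- differentiated once more.
  have hf : ∀ e : ℝ × ℝ, ∃ f : EuclideanSpace ℝ (Fin 5) × ℝ × ℝ → ℝ, ContDiffAt ℝ 1 f w ∧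
      (fun w => fderiv ℝ Q w (0, e)) =ᶠ[𝓝 w] fun w => f w • c.director w := fun e =>
    exists_contDiffAt_smul (sQ'.clm_apply contDiffAt_const) sd (c.director_ne_zero hw)
      (hnear.mono fun w hw => c.exists_fderiv_fst_localField hY e hw)
  have h2 : ∀ (e : ℝ × ℝ) (f : EuclideanSpace ℝ (Fin 5) × ℝ × ℝ → ℝ), ContDiffAt ℝ 1 f w →
      ((fun w => fderiv ℝ Q w (0, e)) =ᶠ[𝓝 w] fun w => f w • c.director w) → ∀ e' : ℝ × ℝ,
      fderiv ℝ (fderiv ℝ Q) w (0, e') (0, e) = f w • (e'.1 • c.x₁ w.1 + e'.2 • c.x₂ w.1) +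
        fderiv ℝ f w (0, e') • c.director w := by
    intro e f hf he e'
    have d1 := (sQ'.differentiableAt one_ne_zero).hasFDerivAt.clm_apply
      (hasFDerivAt_const ((0, e) : EuclideanSpace ℝ (Fin 5) × ℝ × ℝ) w)
    have d2 := (hf.differentiableAt one_ne_zero).hasFDerivAt.fun_smul
      (sd.differentiableAt one_ne_zero).hasFDerivAt
    have := DFunLike.congr_fun (d1.fderiv.symm.trans (he.fderiv_eq.trans d2.fderiv)) (0, e')
    simpa [c.fderiv_director_apply hw] using this
  obtain ⟨f₁, hf₁, he₁⟩ := hf (1, 0)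
  obtain ⟨f₂, hf₂, he₂⟩ := hf (0, 1)
  -- The two mixed derivatives are `f₂ x₁ + (∂_a f₂) d` and `f₁ x₂ + (∂_b f₁) d`. Their
  -- `x₃`-coefficients give `∂_a f₂ = ∂_b f₁`, and then independence of `x₁` and `x₂` gives `f₁ = f₂
  -- = 0`.
  have hsymm := (sQ.isSymmSndFDerivAt (minSmoothness_of_isRCLikeNormedField.trans_le
    (WithTop.coe_le_coe.2 le_top))).eq (0, (1, 0)) (0, (0, 1))
  rw [h2 _ f₁ hf₁ he₁, h2 _ f₂ hf₂ he₂, director] at hsymm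
  have hz := c.combination_eq_zero hw
    (a := f₂ w + (fderiv ℝ f₂ w (0, (1, 0)) - fderiv ℝ f₁ w (0, (0, 1))) * w.2.1)
    (b := -f₁ w + (fderiv ℝ f₂ w (0, (1, 0)) - fderiv ℝ f₁ w (0, (0, 1))) * w.2.2)
    (k := fderiv ℝ f₂ w (0, (1, 0)) - fderiv ℝ f₁ w (0, (0, 1)))
    (by refine Eq.trans ?_ (sub_eq_zero.2 hsymm); module)
  rw [hz.2.2, zero_mul, zero_mul, add_zero, add_zero, neg_eq_zero] at hz
  have a1 : fderiv ℝ Q w (0, (1, 0)) = 0 :=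
    he₁.self_of_nhds.trans (smul_eq_zero_of_left hz.2.1 _)
  have a2 : fderiv ℝ Q w (0, (0, 1)) = 0 :=
    he₂.self_of_nhds.trans (smul_eq_zero_of_left hz.1 _)
  have he : ((0, e) : EuclideanSpace ℝ (Fin 5) × ℝ × ℝ) =
      e.1 • (0, (1, 0)) + e.2 • (0, (0, 1)) := by
    simp
  rw [he, map_add, map_smul, map_smul, a1, a2, smul_zero, smul_zero, add_zero]

/-- In the chart the whole fibre over `u` is the plane of slopes, so vanishing vertical derivatives
give constancy along it. -/
lemma fst_localField_eq (c : ChartData D)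
    (hY : IsInfinitesimalSymmetry 𝓘(ℝ, EuclideanSpace ℝ (Fin 5) × ℝ × ℝ) (prolongation D) Y)
    {u : EuclideanSpace ℝ (Fin 5)} (hu : u ∈ c.base) (p p' : ℝ × ℝ) :
    (localField c.openChart Y (u, p)).1 = (localField c.openChart Y (u, p')).1 := by
  have hd : ∀ p : ℝ × ℝ, HasFDerivAt (fun p => (localField c.openChart Y (u, p)).1)
      ((fderiv ℝ (fun w => (localField c.openChart Y w).1) (u, p)).comp
        (ContinuousLinearMap.inr ℝ (EuclideanSpace ℝ (Fin 5)) (ℝ × ℝ))) p := by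
    intro p
    have h1 : HasFDerivAt (fun p : ℝ × ℝ => (u, p))
        (ContinuousLinearMap.inr ℝ (EuclideanSpace ℝ (Fin 5)) (ℝ × ℝ)) p :=
      hasFDerivAt_prodMk_right u p
    exact ((contDiffAt_localField_of_symmetry hY (w := (u, p))
      hu).fst.differentiableAt (by simp)).hasFDerivAt.comp p h1
  refine is_const_of_fderiv_eq_zero (𝕜 := ℝ) (fun p => (hd p).differentiableAt)
    (fun p => ?_) p p'
  rw [(hd p).fderiv]
  refine ContinuousLinearMap.ext fun e => ?_
  exact c.fderiv_fst_localField_eq_zero hY (w := (u, p)) hu e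

end ChartData

/-- The vector field on `M` to which a vector field on the twistor bundle projects. -/
noncomputable def project (Y : ∀ z : Twistor D,
    TangentSpace 𝓘(ℝ, EuclideanSpace ℝ (Fin 5) × ℝ × ℝ) z) (x : M) : TangentSpace (𝓡 5) x :=
  (mfderiv 𝓘(ℝ, EuclideanSpace ℝ (Fin 5) × ℝ × ℝ) (𝓡 5) Twistor.point (exists_over D x).choose
    (Y (exists_over D x).choose) : EuclideanSpace ℝ (Fin 5))

namespace ChartData

/-- `project` evaluates at an arbitrarily chosen point of the fibre; constancy along fibres makes
the choice immaterial. -/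
lemma localField_project (c : ChartData D)
    (hY : IsInfinitesimalSymmetry 𝓘(ℝ, EuclideanSpace ℝ (Fin 5) × ℝ × ℝ) (prolongation D) Y)
    {w : EuclideanSpace ℝ (Fin 5) × ℝ × ℝ} (hw : w.1 ∈ c.base) :
    localField c.chart (project Y) w.1 = (localField c.openChart Y w).1 := by
  refine (localField_eq_iff c.chart_mem hw.1).2 ?_
  rw [project]
  generalize hz : (exists_over D (c.chart.symm w.1)).choose = z
  have hzp : z.point = c.chart.symm w.1 := hz ▸ (exists_over D (c.chart.symm w.1)).choose_spec
  have hzs : z ∈ c.openChart.source := by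
    rw [mem_openChart_source, hzp]
    exact ⟨c.chart.map_target hw.1, hw.2⟩
  have hz1 : (c.openChart z).1 = w.1 := by
    rw [openChart_apply_fst, hzp, c.chart.right_inv hw.1]
  obtain ⟨w', hw', hwz⟩ : ∃ w' : EuclideanSpace ℝ (Fin 5) × ℝ × ℝ,
      w'.1 = w.1 ∧ c.openChart.symm w' = z := ⟨_, hz1, c.openChart.left_inv hzs⟩
  subst hwz
  have hwt' : w' ∈ c.openChart.target := by
    rw [mem_openChart_target, hw']
    exact hw
  have key := c.mfderiv_point_tangentOf hwt' (localField c.openChart Y w')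
  rw [tangentOf_localField c.openChart_mem_atlas hwt'] at key
  have e : (localField c.openChart Y w').1 = (localField c.openChart Y w).1 := by
    obtain ⟨u, p⟩ := w
    obtain ⟨u', p'⟩ := w'
    obtain rfl : u' = u := hw'
    exact c.fst_localField_eq hY hw p' p
  rw [e, hw'] at key
  exact key.symm

end ChartData

lemma smoothFieldOn_project
    (hY : IsInfinitesimalSymmetry 𝓘(ℝ, EuclideanSpace ℝ (Fin 5) × ℝ × ℝ) (prolongation D) Y) :
    SmoothFieldOn (𝓡 5) (project Y) Set.univ := by
  refine contMDiffOn_univ.2 fun x => ?_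
  obtain ⟨z, rfl⟩ := exists_over D x
  set c := chartDataAt z
  have hz : z.point ∈ c.chart.source ∩ c.dom := ChartData.mem_source_chartDataAt z
  refine ContMDiffOn.contMDiffAt (smoothFieldOn_of_localField c.chart_mem Set.inter_subset_left
    fun x hx => ?_) ((c.chart.open_source.inter c.frame.isOpen).mem_nhds hz)
  have hu : c.chart x ∈ c.base :=
    ⟨c.chart.map_source hx.1, by rw [Set.mem_preimage, c.chart.left_inv hx.1]; exact hx.2⟩
  -- The projected field is read off along the section of slope `0`; any other fixed slope would do.
  have h1 : ContDiffAt ℝ ∞ (fun u => (localField c.openChart Y (u, 0)).1) (c.chart x) :=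
    ContDiffAt.comp (c.chart x) (g := fun w => (localField c.openChart Y w).1)
      (ChartData.contDiffAt_localField_of_symmetry hY (w := (c.chart x, 0)) hu).fst
      (contDiffAt_id.prodMk contDiffAt_const)
  refine h1.congr_of_eventuallyEq ?_
  filter_upwards [c.isOpen_base.mem_nhds hu] with u hu
  exact c.localField_project hY (w := (u, 0)) hu

namespace ChartData

/-- The symmetry is bracketed with the section `(director, 0)` of the prolongation; as its first
component depends on `u` alone, the result is the slope condition in the form of
`isLiftSlope_iff_director`. -/
lemma isLiftSlope_project (c : ChartData D)
    (hY : IsInfinitesimalSymmetry 𝓘(ℝ, EuclideanSpace ℝ (Fin 5) × ℝ × ℝ) (prolongation D) Y)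
    {w : EuclideanSpace ℝ (Fin 5) × ℝ × ℝ} (hw : w.1 ∈ c.base) :
    c.IsLiftSlope (project Y) w (localField c.openChart Y w).2 := by
  have hV : ∀ w : EuclideanSpace ℝ (Fin 5) × ℝ × ℝ, w.1 ∈ c.base →
      ContDiffAt ℝ ∞ (fun w => (c.director w, (0 : ℝ × ℝ))) w := fun w hw =>
    (c.contDiffAt_director hw).prodMk contDiffAt_const
  obtain ⟨k, hk⟩ := c.exists_lieBracket_fst hY (V := fun w => (c.director w, 0))
    (fun w hw => ⟨hV w hw, 1, (one_smul ℝ _).symm⟩) hw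
  refine (c.isLiftSlope_iff_director hw).2 ⟨k, ?_⟩
  have hYe : (fun w => (localField c.openChart Y w).1) =ᶠ[𝓝 w]
      fun w => localField c.chart (project Y) w.1 := by
    filter_upwards [(c.isOpen_base.preimage continuous_fst).mem_nhds hw] with w hw
    exact (c.localField_project hY hw).symm
  have hXs := contDiffAt_localField c.chart_mem (w := w.1) hw.1 (smoothFieldOn_project hY) univ_mem
  have d1 : HasFDerivAt
      (fun w : EuclideanSpace ℝ (Fin 5) × ℝ × ℝ => localField c.chart (project Y) w.1) _ w :=
    (hXs.differentiableAt (by simp)).hasFDerivAt.comp w hasFDerivAt_fst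
  rw [lieBracket_fst ((contDiffAt_localField_of_symmetry hY hw).differentiableAt (by simp))
    ((hV w hw).differentiableAt (by simp)), hYe.fderiv_eq, d1.fderiv] at hk
  rw [c.localField_project hY hw]
  exact hk

lemma mem_derived_of_localField_eq (c : ChartData D) {V : ∀ x : M, TangentSpace (𝓡 5) x}
    {u : EuclideanSpace ℝ (Fin 5)} (hu : u ∈ c.base) {a b k : ℝ}
    (h : localField c.chart V u = a • c.x₁ u + b • c.x₂ u + k • c.x₃ u) :
    V (c.chart.symm u) ∈ derived (𝓡 5) D.fiber (c.chart.symm u) := by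
  rw [c.frame.mem_derived_iff hu.2]
  refine ⟨a, b, k, ?_⟩
  rw [← c.tangentOf_combination hu]
  exact ((localField_eq_iff c.chart_mem hu.1).1 h).symm

/-- The brackets enter the slope condition affinely in the fibre coordinates. The slope `(0, 0)`
isolates the bracket with `x₃`, and subtracting it from the conditions at `(1, 0)` and `(0, 1)`
isolates those with `x₁` and `x₂`. -/
lemma mlieBracket_project_mem_derived (c : ChartData D)
    (hY : IsInfinitesimalSymmetry 𝓘(ℝ, EuclideanSpace ℝ (Fin 5) × ℝ × ℝ) (prolongation D) Y)
    {u : EuclideanSpace ℝ (Fin 5)} (hu : u ∈ c.base) :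
    mlieBracket (𝓡 5) (project Y) c.ξ₁ (c.chart.symm u) ∈
        derived (𝓡 5) D.fiber (c.chart.symm u) ∧
      mlieBracket (𝓡 5) (project Y) c.ξ₂ (c.chart.symm u) ∈
        derived (𝓡 5) D.fiber (c.chart.symm u) ∧
      mlieBracket (𝓡 5) (project Y) (mlieBracket (𝓡 5) c.ξ₁ c.ξ₂) (c.chart.symm u) ∈
        derived (𝓡 5) D.fiber (c.chart.symm u) := by
  have hX := smoothFieldOn_project hY
  have e₁ := c.lieBracket_eq hX c.frame.smooth₁ hu
  have e₂ := c.lieBracket_eq hX c.frame.smooth₂ hu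
  have e₃ := c.lieBracket_eq hX c.smooth_bracket hu
  obtain ⟨k₀, h₀⟩ := c.isLiftSlope_project hY (w := (u, (0, 0))) hu
  obtain ⟨k₁, h₁⟩ := c.isLiftSlope_project hY (w := (u, (1, 0))) hu
  obtain ⟨k₂, h₂⟩ := c.isLiftSlope_project hY (w := (u, (0, 1))) hu
  rw [e₁, e₂, e₃] at h₀ h₁ h₂
  simp only [director, zero_smul, one_smul, add_zero] at h₀ h₁ h₂
  generalize (localField c.openChart Y (u, 0, 0)).2 = q₀ at h₀
  generalize (localField c.openChart Y (u, 1, 0)).2 = q₁ at h₁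
  generalize (localField c.openChart Y (u, 0, 1)).2 = q₂ at h₂
  refine ⟨c.mem_derived_of_localField_eq hu (a := k₁ - q₁.1 + q₀.1) (b := q₀.2 - q₁.2)
      (k := k₁ - k₀) ?_, c.mem_derived_of_localField_eq hu (a := q₀.1 - q₂.1)
      (b := k₂ - q₂.2 + q₀.2) (k := k₂ - k₀) ?_,
    c.mem_derived_of_localField_eq hu (a := -q₀.1) (b := -q₀.2) (k := k₀) ?_⟩
  · linear_combination (norm := module) h₁ - h₀
  · linear_combination (norm := module) h₂ - h₀
  · linear_combination (norm := module) h₀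

end ChartData

/-- A symmetry of the prolongation projects to a symmetry of `D`. -/
theorem isInfinitesimalSymmetry_project
    (hY : IsInfinitesimalSymmetry 𝓘(ℝ, EuclideanSpace ℝ (Fin 5) × ℝ × ℝ) (prolongation D) Y) :
    IsInfinitesimalSymmetry (𝓡 5) D.fiber (project Y) := by
  have hX := smoothFieldOn_project hY
  refine ⟨hX, fun V ξ hV hξ =>
    ⟨SmoothFieldOn.mlieBracket hV (hX.mono (Set.subset_univ _)) hξ.1, fun x hx => ?_⟩⟩
  obtain ⟨U, ξ₁, ξ₂, hxU, h⟩ := D.exists_frame x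
  -- This is needed on all of `U`, not only at `x`, because the Jacobi argument differentiates the
  -- coefficients of the brackets.
  have key : ∀ y ∈ U, mlieBracket (𝓡 5) (project Y) ξ₁ y ∈ derived (𝓡 5) D.fiber y ∧
      mlieBracket (𝓡 5) (project Y) ξ₂ y ∈ derived (𝓡 5) D.fiber y ∧
      mlieBracket (𝓡 5) (project Y) (mlieBracket (𝓡 5) ξ₁ ξ₂) y ∈ derived (𝓡 5) D.fiber y := by
    intro y hy
    have hl := (chartAt (EuclideanSpace ℝ (Fin 5)) y).left_inv (mem_chart_source _ y)
    -- Any chart of `M` may be paired with the given frame, so the frame stays fixed while the chart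
    -- varies with `y`.
    have := ChartData.mlieBracket_project_mem_derived (D := D)
      ⟨chartAt _ y, chart_mem_atlas _ y, U, ξ₁, ξ₂, h⟩ hY
      (u := chartAt (EuclideanSpace ℝ (Fin 5)) y y)
      ⟨(chartAt (EuclideanSpace ℝ (Fin 5)) y).map_source (mem_chart_source _ y),
        by rw [Set.mem_preimage, hl]; exact hy⟩
    rwa [hl] at this
  have hb := h.mlieBracket_mem_of_mem_derived (hX.mono (Set.subset_univ _))
    (fun y hy => (key y hy).1) (fun y hy => (key y hy).2.1) (fun y hy => (key y hy).2.2) hxU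
  exact h.mlieBracket_mem_of_isSectionOn hxU hb.1 hb.2 hV hx hξ

/-- A symmetry of the prolongation is the lift of its projection. -/
theorem isProlongationLift_project
    (hY : IsInfinitesimalSymmetry 𝓘(ℝ, EuclideanSpace ℝ (Fin 5) × ℝ × ℝ) (prolongation D) Y) :
    IsProlongationLift D (project Y) Y := by
  refine isProlongationLift_iff.2 fun z => ?_
  have hz := ChartData.mem_source_chartDataAt z
  have hw := (chartDataAt z).openChart.map_source hz
  exact (chartDataAt z).isProlongationLiftAt (isInfinitesimalSymmetry_project hY) hz
    (Prod.ext ((chartDataAt z).localField_project hY hw).symm rfl)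
    ((chartDataAt z).isLiftSlope_project hY hw)

end Twistor

end TwoThreeFive
-- The correspondence between symmetries of `D` and of its prolongation
theorem mainTheorem6 {M : Type*} [TopologicalSpace M]
    [ChartedSpace (EuclideanSpace ℝ (Fin 5)) M] [IsManifold (𝓡 5) ∞ M] [T2Space M]
    (D : TwoThreeFive.GenericDistribution M) :
    (∀ X : ∀ x : M, TangentSpace (𝓡 5) x,
      TwoThreeFive.IsInfinitesimalSymmetry (𝓡 5) D.fiber X →
        ∃! Y : ∀ z : TwoThreeFive.Twistor D,
            TangentSpace 𝓘(ℝ, EuclideanSpace ℝ (Fin 5) × ℝ × ℝ) z,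
          TwoThreeFive.IsProlongationLift D X Y) ∧
    ∀ Y : ∀ z : TwoThreeFive.Twistor D, TangentSpace 𝓘(ℝ, EuclideanSpace ℝ (Fin 5) × ℝ × ℝ) z,
      TwoThreeFive.IsInfinitesimalSymmetry 𝓘(ℝ, EuclideanSpace ℝ (Fin 5) × ℝ × ℝ)
          (TwoThreeFive.prolongation D) Y ↔
        ∃ X : ∀ x : M, TangentSpace (𝓡 5) x,
          TwoThreeFive.IsInfinitesimalSymmetry (𝓡 5) D.fiber X ∧
            TwoThreeFive.IsProlongationLift D X Y := by
  refine ⟨fun X hX => TwoThreeFive.Twistor.existsUnique_isProlongationLift hX, fun Y =>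
    ⟨fun hY => ⟨TwoThreeFive.Twistor.project Y, ?_, ?_⟩, ?_⟩⟩
  · exact TwoThreeFive.Twistor.isInfinitesimalSymmetry_project hY
  · exact TwoThreeFive.Twistor.isProlongationLift_project hY
  · rintro ⟨X, hX, hY⟩
    exact hY.isInfinitesimalSymmetry hX
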